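/- \textbf{Theorem 2 (fully reduced Hamiltonian).} Consider three bodies with masses $m_1,m_2,m_3>0$, positions $r_i\in\mathbb R^4$ and momenta $P_i=m_i\dot r_i$, with Hamiltonian $\sum_i\|P_i\|^2/(2m_i)+U$, where $U$ is a smooth function of the (positive) mutual distances (for instance the Newtonian potential $-\sum_{i<j} m_im_j/\|r_i-r_j\|$). Put $x_1=r_2-r_3$, $x_2=r_1-\frac{m_2r_2+m_3r_3}{m_2+m_3}$, $y_1=\frac{m_3P_2-m_2P_3}{m_2+m_3}$, $y_2=\frac{(m_2+m_3)P_1-m_1(P_2+P_3)}{m_1+m_2+m_3}$, $\nu_1=\frac{m_2m_3}{m_2+m_3}$, $\nu_2=\frac{m_1(m_2+m_3)}{m_1+m_2+m_3}$, and write $U=V(\|x_1\|^2,\|x_2\|^2,x_1\cdot x_2)$. Fix the total linear momentum to be $0$ and the total angular momentum $\sum_i (r_iP_i^t-P_ir_i^t)$ to be a skew-symmetric matrix $\Lambda$ with eigenvalues $\pm i\mu_1,\pm i\mu_2$, $\mu_1>\mu_2\ge 0$. For $(q,p)\in\mathbb R^4\times\mathbb R^4$ let $$A=\tfrac12(q_1q_4-q_2q_3),\qquad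 L_3=q_1p_2-q_2p_1+q_3p_4-q_4p_3,$$ let $L_d,L_s$ be square roots, with arbitrary fixed signs, of $L_d^2=(\mu_1-\mu_2)^2-L_3^2$ and $L_s^2=(\mu_1+\mu_2)^2-L_3^2$, let $$f(q_i,q_j)=\frac{(L_d+L_s)^2q_i^2+(L_d-L_s)^2q_j^2}{16A^2},$$ and let $$H=\frac1{2\nu_1}\bigl(p_1^2+p_2^2+f(q_3,q_4)\bigr)+\frac1{2\nu_2}\bigl(p_3^2+p_4^2+f(q_1,q_2)\bigr)+V(q_1^2+q_2^2,\;q_3^2+q_4^2,\;q_1q_3+q_2q_4).$$ With $B_{ij}=E_{ij}-E_{ji}$ there is an orthogonal matrix $N$ with $N^t\Lambda N=\mu_1B_{12}+\mu_2B_{34}$ such that the following holds. Say that a state with the above momenta has coordinates $(q,p)$ if for some angles $\theta_1,\theta_2,\psi_1,\psi_2$, reals $\alpha_1,\dots,\alpha_4$, and $M=N\exp(B_{12}\theta_1)\exp(B_{34}\theta_2)\exp(B_{13}\psi_1)\exp(B_{24}\psi_2)$, $$x_1=M(q_1,q_2,0,0)^t,\quad x_2=M(q_3,q_4,0,0)^t,\quad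 y_1=M(p_1,p_2,\alpha_1,\alpha_2)^t,\quad y_2=M(p_3,p_4,\alpha_3,\alpha_4)^t .$$ (1) Every state with the above momenta for which $x_1,x_2$ are linearly independent has coordinates $(q,p)$ with $A\ne0$ and $|L_3|\le\mu_1-\mu_2$ for which its energy equals $H(q,p)$. (2) Wherever $A\neq 0$ and $L_d\ne0$ (that is, $|L_3|<\mu_1-\mu_2$), these are local symplectic coordinates on the reduced phase space, with reduced Hamiltonian $H$. Precisely: around every state with the above momenta that has coordinates satisfying $A\ne0$, $|L_3|<\mu_1-\mu_2$, and around every point $(q,p)$ with $A\ne 0$, $|L_3|<\mu_1-\mu_2$, there is a smooth local chart, by such coordinates $(q,p)$, of the $8$-dimensional quotient of the level set of the momenta by all translations and by the rotations in $SO(4)$ fixing $\Lambda$; the reduced symplectic form is $\sum_k dq_k\wedge dp_k$ in this chart, the energy is $H(q,p)$, and motions of the three bodies project to solutions of Hamilton's equations $\dot q=\partial H/\partial p$, $\dot p=-\partial H/\partial q$. -/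

import Mathlib

open scoped ContDiff Matrix Topology

noncomputable section

namespace ThreeBody

/-- Euclidean four-space. -/
abbrev E4 : Type := EuclideanSpace ℝ (Fin 4)

/-- Phase space of three bodies in four-space: positions `z.1 i` and momenta `z.2 i`, where the
index `i = 0, 1, 2` stands for the bodies 1, 2, 3. -/
abbrev Phase : Type := (Fin 3 → E4) × (Fin 3 → E4)

/-- The reduced coordinates `w = (q, p)` with `q = (q₁, …, q₄)` and `p = (p₁, …, p₄)`
(indexed by `0, …, 3`). -/
abbrev Coord : Type := (Fin 4 → ℝ) × (Fin 4 → ℝ)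

/-! ### The three-body problem -/

/-- The potential energy: a function `W` of the three mutual distances
`‖r₂ - r₃‖`, `‖r₃ - r₁‖`, `‖r₁ - r₂‖`. -/
def potential (W : ℝ × ℝ × ℝ → ℝ) (r : Fin 3 → E4) : ℝ :=
  W (‖r 1 - r 2‖, ‖r 2 - r 0‖, ‖r 0 - r 1‖)

/-- The Hamiltonian (total energy) of the three-body problem. -/
def hamiltonian (m : Fin 3 → ℝ) (W : ℝ × ℝ × ℝ → ℝ) (z : Phase) : ℝ :=
  (∑ i, ‖z.2 i‖ ^ 2 / (2 * m i)) + potential W z.1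

/-- The curve `γ` of positions and momenta satisfies the equations of motion
`m i • r i' = P i`, `P i' = - ∇_{r i} U` at time `t`. -/
def SatisfiesNewtonAt (m : Fin 3 → ℝ) (W : ℝ × ℝ × ℝ → ℝ) (γ : ℝ → Phase) (t : ℝ) : Prop :=
  ∀ i, HasDerivAt (fun τ => (γ τ).1 i) ((m i)⁻¹ • (γ t).2 i) t ∧
    HasDerivAt (fun τ => (γ τ).2 i)
      (-gradient (fun x : E4 => potential W (Function.update (γ t).1 i x)) ((γ t).1 i)) t

/-- The canonical symplectic form `∑ dr ∧ dP` on the phase space. -/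
def omega (u v : Phase) : ℝ :=
  ∑ i, (inner ℝ (u.1 i) (v.2 i) - inner ℝ (u.2 i) (v.1 i))

/-- The wedge product `x ∧ y = x yᵗ - y xᵗ`. -/
def wedge (x y : E4) : Matrix (Fin 4) (Fin 4) ℝ :=
  Matrix.vecMulVec x.ofLp y.ofLp - Matrix.vecMulVec y.ofLp x.ofLp

/-- The total angular momentum `∑ r_i ∧ P_i`. -/
def angularMomentum (z : Phase) : Matrix (Fin 4) (Fin 4) ℝ :=
  ∑ i, wedge (z.1 i) (z.2 i)

/-- The common level set of the two momentum maps: total linear momentum `0` and total angular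
momentum `Λ`. -/
def level (Λ : Matrix (Fin 4) (Fin 4) ℝ) : Set Phase :=
  {z | ∑ i, z.2 i = 0 ∧ angularMomentum z = Λ}

/-- `u` is annihilated by the derivatives at `z` of total linear and total angular momentum, that
is, `u` is tangent to the level set of the momentum maps through `z`. -/
def TangentToLevel (z u : Phase) : Prop :=
  ∑ i, u.2 i = 0 ∧ ∀ j k, fderiv ℝ (fun z' : Phase => angularMomentum z' j k) z u = 0

/-- `z'` is obtained from `z` by a translation and a rotation which fixes the angular momentum
`Λ`: the two states lie in one orbit of the isotropy group of the momentum value `(0, Λ)`. -/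
def SameOrbit (Λ : Matrix (Fin 4) (Fin 4) ℝ) (z z' : Phase) : Prop :=
  ∃ R ∈ Matrix.specialOrthogonalGroup (Fin 4) ℝ, R * Λ * Rᵀ = Λ ∧ ∃ c : E4, ∀ i,
    z'.1 i = WithLp.toLp 2 (R *ᵥ (z.1 i).ofLp) + c ∧
    z'.2 i = WithLp.toLp 2 (R *ᵥ (z.2 i).ofLp)

/-! ### Jacobi vectors -/

/-- The Jacobi vector `x₁ = r₂ - r₃`. -/
def jacobiX1 (z : Phase) : E4 := z.1 1 - z.1 2

/-- The Jacobi vector `x₂ = r₁ - (m₂ r₂ + m₃ r₃) / (m₂ + m₃)`. -/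
def jacobiX2 (m : Fin 3 → ℝ) (z : Phase) : E4 :=
  z.1 0 - (m 1 + m 2)⁻¹ • (m 1 • z.1 1 + m 2 • z.1 2)

/-- The momentum conjugate to `x₁`. -/
def jacobiY1 (m : Fin 3 → ℝ) (z : Phase) : E4 :=
  (m 1 + m 2)⁻¹ • (m 2 • z.2 1 - m 1 • z.2 2)

/-- The momentum conjugate to `x₂`. -/
def jacobiY2 (m : Fin 3 → ℝ) (z : Phase) : E4 :=
  (m 0 + m 1 + m 2)⁻¹ • ((m 1 + m 2) • z.2 0 - m 0 • (z.2 1 + z.2 2))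

/-- The reduced mass `ν₁`. -/
def nu1 (m : Fin 3 → ℝ) : ℝ := m 1 * m 2 / (m 1 + m 2)

/-- The reduced mass `ν₂`. -/
def nu2 (m : Fin 3 → ℝ) : ℝ := m 0 * (m 1 + m 2) / (m 0 + m 1 + m 2)

/-- The potential as a function `V(a, b, c)` of the scalar products `a = ‖x₁‖²`, `b = ‖x₂‖²`,
`c = x₁ · x₂` of the Jacobi vectors. -/
def potentialV (m : Fin 3 → ℝ) (W : ℝ × ℝ × ℝ → ℝ) (a b c : ℝ) : ℝ :=
  let a₂ := m 1 / (m 1 + m 2)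
  let a₃ := m 2 / (m 1 + m 2)
  W (√a, √(a₂ ^ 2 * a + 2 * a₂ * c + b), √(a₃ ^ 2 * a - 2 * a₃ * c + b))

/-! ### The reduced coordinates -/

/-- The basis element `B_{ij} = E_{ij} - E_{ji}` of `so(4)`. -/
def so4Basis (i j : Fin 4) : Matrix (Fin 4) (Fin 4) ℝ :=
  Matrix.single i j 1 - Matrix.single j i 1

/-- The elementary rotation `exp (θ B_{ij})`, for `i ≠ j`, written out. -/
def elemRot (i j : Fin 4) (θ : ℝ) : Matrix (Fin 4) (Fin 4) ℝ :=
  1 + (Real.cos θ - 1) • (Matrix.single i i 1 + Matrix.single j j 1) + Real.sin θ • so4Basis i j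

/-- The rotation `M = exp (B₁₂ θ₁) exp (B₃₄ θ₂) exp (B₁₃ ψ₁) exp (B₂₄ ψ₂)`. -/
def rotM (θ₁ θ₂ ψ₁ ψ₂ : ℝ) : Matrix (Fin 4) (Fin 4) ℝ :=
  elemRot 0 1 θ₁ * elemRot 2 3 θ₂ * elemRot 0 2 ψ₁ * elemRot 1 3 ψ₂

/-- The normal form `L₀ = μ₁ B₁₂ + μ₂ B₃₄` of the angular momentum. -/
def normalForm (μ₁ μ₂ : ℝ) : Matrix (Fin 4) (Fin 4) ℝ :=
  μ₁ • so4Basis 0 1 + μ₂ • so4Basis 2 3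

/-- The state `z` has the coordinates `w = (q, p)`: in the frame given by the rotation `M`, taken
with respect to the orthonormal basis formed by the columns of `N`, the Jacobi vectors `x₁`, `x₂`
are `(q₁, q₂, 0, 0)`, `(q₃, q₄, 0, 0)`, and the first two components of their momenta `y₁`, `y₂`
are `(p₁, p₂)`, `(p₃, p₄)`. -/
def HasCoord (m : Fin 3 → ℝ) (N : Matrix (Fin 4) (Fin 4) ℝ) (z : Phase) (w : Coord) : Prop :=
  ∃ θ₁ θ₂ ψ₁ ψ₂ α₁ α₂ α₃ α₄ : ℝ,
    (jacobiX1 z).ofLp = (N * rotM θ₁ θ₂ ψ₁ ψ₂) *ᵥ ![w.1 0, w.1 1, 0, 0] ∧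
    (jacobiX2 m z).ofLp = (N * rotM θ₁ θ₂ ψ₁ ψ₂) *ᵥ ![w.1 2, w.1 3, 0, 0] ∧
    (jacobiY1 m z).ofLp = (N * rotM θ₁ θ₂ ψ₁ ψ₂) *ᵥ ![w.2 0, w.2 1, α₁, α₂] ∧
    (jacobiY2 m z).ofLp = (N * rotM θ₁ θ₂ ψ₁ ψ₂) *ᵥ ![w.2 2, w.2 3, α₃, α₄]

/-- The canonical symplectic form `∑ dq ∧ dp` in the reduced coordinates. -/
def omegaRed (a b : Coord) : ℝ := ∑ k, (a.1 k * b.2 k - a.2 k * b.1 k)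

/-- The oriented area `A` of the triangle spanned by `(q₁, q₂)` and `(q₃, q₄)`. -/
def area (w : Coord) : ℝ := (w.1 0 * w.1 3 - w.1 1 * w.1 2) / 2

/-- The angular momentum `L₃ = q₁ p₂ - q₂ p₁ + q₃ p₄ - q₄ p₃`. -/
def L3 (w : Coord) : ℝ :=
  w.1 0 * w.2 1 - w.1 1 * w.2 0 + w.1 2 * w.2 3 - w.1 3 * w.2 2

/-- The square root `L_d` of `Δ² - L₃²`, `Δ = μ₁ - μ₂`, with sign `ε`. -/
def Ld (μ₁ μ₂ ε : ℝ) (w : Coord) : ℝ := ε * √((μ₁ - μ₂) ^ 2 - L3 w ^ 2)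

/-- The square root `L_s` of `Σ² - L₃²`, `Σ = μ₁ + μ₂`, with sign `ε`. -/
def Ls (μ₁ μ₂ ε : ℝ) (w : Coord) : ℝ := ε * √((μ₁ + μ₂) ^ 2 - L3 w ^ 2)

/-- `f(q_i, q_j) = ((L_d + L_s)² q_i² + (L_d - L_s)² q_j²) / (16 A²)`, where `i`, `j` are given in
zero-based numbering. -/
def fRed (μ₁ μ₂ εd εs : ℝ) (i j : Fin 4) (w : Coord) : ℝ :=
  ((Ld μ₁ μ₂ εd w + Ls μ₁ μ₂ εs w) ^ 2 * w.1 i ^ 2 +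
    (Ld μ₁ μ₂ εd w - Ls μ₁ μ₂ εs w) ^ 2 * w.1 j ^ 2) / (16 * area w ^ 2)

/-- The fully reduced Hamiltonian. -/
def reducedHamiltonian (m : Fin 3 → ℝ) (W : ℝ × ℝ × ℝ → ℝ) (μ₁ μ₂ εd εs : ℝ) (w : Coord) : ℝ :=
  1 / (2 * nu1 m) * (w.2 0 ^ 2 + w.2 1 ^ 2 + fRed μ₁ μ₂ εd εs 2 3 w) +
  1 / (2 * nu2 m) * (w.2 2 ^ 2 + w.2 3 ^ 2 + fRed μ₁ μ₂ εd εs 0 1 w) +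
  potentialV m W (w.1 0 ^ 2 + w.1 1 ^ 2) (w.1 2 ^ 2 + w.1 3 ^ 2)
    (w.1 0 * w.1 2 + w.1 1 * w.1 3)

/-! ### Symplectic reduction -/

/-- Local symplectic coordinates on the reduced phase space, the quotient of `level Λ` by the
isotropy group. A chart is given upstairs: `χ` is a smooth invariant map on the invariant open set
`O`, which identifies the orbits in `O ∩ level Λ` with the points of the open set `V`, with a
smooth section `s`; the symplectic form of the quotient, which is characterised by having the
restriction of `omega` to the level set as its pull-back, is `∑ dq ∧ dp` in this chart. -/
structure IsReducedChart (Λ : Matrix (Fin 4) (Fin 4) ℝ) (O : Set Phase) (χ : Phase → Coord)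
    (V : Set Coord) (s : Coord → Phase) : Prop where
  isOpen_source : IsOpen O
  isOpen_target : IsOpen V
  invariant : ∀ z ∈ O, ∀ z', SameOrbit Λ z z' → z' ∈ O
  smooth : ContDiffOn ℝ ∞ χ O
  smooth_section : ContDiffOn ℝ ∞ s V
  mapsTo : ∀ z ∈ O ∩ level Λ, χ z ∈ V
  section_mem : ∀ w ∈ V, s w ∈ O ∩ level Λ
  right_inv : ∀ w ∈ V, χ (s w) = w
  eq_iff : ∀ z ∈ O ∩ level Λ, ∀ z' ∈ O ∩ level Λ, (χ z = χ z' ↔ SameOrbit Λ z z')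
  symplectic : ∀ z ∈ O ∩ level Λ, ∀ u v, TangentToLevel z u → TangentToLevel z v →
    omega u v = omegaRed (fderiv ℝ χ z u) (fderiv ℝ χ z v)

/-- The curve `c` satisfies Hamilton's equations `q' = ∂h/∂p`, `p' = -∂h/∂q` at time `t`. -/
def SatisfiesHamiltonAt (h : Coord → ℝ) (c : ℝ → Coord) (t : ℝ) : Prop :=
  ∀ k, HasDerivAt (fun τ => (c τ).1 k) (fderiv ℝ h (c t) (0, Pi.single k 1)) t ∧
    HasDerivAt (fun τ => (c τ).2 k) (-fderiv ℝ h (c t) (Pi.single k 1, 0)) t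

/-- In the chart `(O, χ, V, s)` by symplectic coordinates of the reduced phase space, `h` is the
reduced Hamiltonian of the three-body problem: `χ` reads off the coordinates `(q, p)` of a state,
the energy is `h ∘ χ`, and `χ` sends motions of the three bodies to solutions of Hamilton's
equations for `h`. -/
structure IsReduction (m : Fin 3 → ℝ) (W : ℝ × ℝ × ℝ → ℝ) (Λ N : Matrix (Fin 4) (Fin 4) ℝ)
    (h : Coord → ℝ) (O : Set Phase) (χ : Phase → Coord) (V : Set Coord) (s : Coord → Phase) :
    Prop extends IsReducedChart Λ O χ V s where
  hasCoord : ∀ z ∈ O ∩ level Λ, HasCoord m N z (χ z)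
  energy : ∀ z ∈ O ∩ level Λ, hamiltonian m W z = h (χ z)
  differentiable : ∀ w ∈ V, DifferentiableAt ℝ h w
  motion : ∀ (γ : ℝ → Phase) (a b : ℝ),
    (∀ t ∈ Set.Ioo a b, γ t ∈ O ∩ level Λ ∧ SatisfiesNewtonAt m W γ t) →
    ∀ t ∈ Set.Ioo a b, SatisfiesHamiltonAt h (fun τ => χ (γ τ)) t

end ThreeBody

end

/-! ### Body forms of the angular momentum and the four angles. -/

noncomputable section
namespace ThreeBody

/-! In a frame whose first two vectors span the plane of `x₁`, `x₂`, the entry of the angular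
momentum between the two normal vectors vanishes, because each of its terms contains a normal
component of a position. The 2×2 block between the plane and its normal plane becomes antidiagonal
as in a singular value decomposition: turn the plane until its axes are principal directions of `‖Λ
·‖²`, then turn the normal plane. This is `bodyForm c a b`, and `c = L₃`. Conjugation by rotations
preserves the norm and the Pfaffian, so `c² + a² + b² = μ₁² + μ₂²` and `ab = μ₁μ₂`, that is `(b -
a)² = (μ₁ - μ₂)² - L₃²` and `(b + a)² = (μ₁ + μ₂)² - L₃²`. Thus `|L₃| ≤ μ₁ - μ₂`, and `b - a`, `b +
a` are `L_d`, `L_s` up to sign. A half turn of the normal plane changes both signs, simultaneous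
quarter turns of both planes change only that of `b + a`, so all choices of signs occur
(`IsBodyFrame.exists_signed`). Each body frame is given by four angles: tilts reach every body form,
and the centralizer of the normal form in `SO(4)` is a torus (`exists_angles`).

For the normal components of `y₁`, `y₂` the momentum equations are linear systems with determinant
`2A`. Their solution turns the energy into `H` (`IsSignedFrame.energy`) and shows that coordinates
and signs determine all Jacobi vectors in the frame. Two states with the same coordinates therefore
differ by the rotation between their frames, which fixes `Λ` (`IsSignedFrame.sameOrbit`).

A chart needs a smooth choice of principal directions. Since `b² - a² = L_d L_s`, the two principal
values differ when `|L₃| < μ₁ - μ₂`, and the directions are unique up to order and signs. Turning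
the Gram-Schmidt frame of two fixed combinations of `x₁`, `x₂` by half an arctangent gives a smooth
choice (`contDiffAt_prin`), which commutes with the isotropy group (`prin_act`) and is characterized
by inequalities (`prin_unique`). Explicit angles give a smooth section.

For the symplectic form the frame is differentiated. Tangency to the level set removes all terms
except `∑ dq ∧ dp` and the pairing of the angular momentum with the commutator of two infinitesimal
frame motions; the latter vanishes by the derivative of the principal-direction condition
(`BodyVariation.symplectic`). Hamilton's equations then follow from the symplectic form and the
energy alone (`IsReducedChart.motion`). -/

/-- The angular momentum in a frame whose first two vectors are the principal directions of the
plane of the bodies. -/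
def bodyForm (c a b : ℝ) : Matrix (Fin 4) (Fin 4) ℝ :=
  !![0, c, 0, a; -c, 0, b, 0; 0, -b, 0, 0; -a, 0, 0, 0]

lemma normalForm_eq (μ₁ μ₂ : ℝ) :
    normalForm μ₁ μ₂ = !![0, μ₁, 0, 0; -μ₁, 0, 0, 0; 0, 0, 0, μ₂; 0, 0, -μ₂, 0] := by
  ext i j; fin_cases i <;> fin_cases j <;> simp [normalForm, so4Basis, Matrix.single]

/-- The rotation `exp (B₁₂ θ₁) exp (B₃₄ θ₂)`. -/
def torusRot (x y s t : ℝ) : Matrix (Fin 4) (Fin 4) ℝ :=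
  !![x, y, 0, 0; -y, x, 0, 0; 0, 0, s, t; 0, 0, -t, s]

lemma elemRot_mul_torus (θ₁ θ₂ : ℝ) : elemRot 0 1 θ₁ * elemRot 2 3 θ₂ =
    torusRot (Real.cos θ₁) (Real.sin θ₁) (Real.cos θ₂) (Real.sin θ₂) := by
  have h1 : elemRot 0 1 θ₁ = !![Real.cos θ₁, Real.sin θ₁, 0, 0; -Real.sin θ₁, Real.cos θ₁, 0, 0;
      0, 0, 1, 0; 0, 0, 0, 1] := by
    ext i j; fin_cases i <;> fin_cases j <;> simp [elemRot, so4Basis, Matrix.single]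
  have h2 : elemRot 2 3 θ₂ = !![1, 0, 0, 0; 0, 1, 0, 0; 0, 0, Real.cos θ₂, Real.sin θ₂;
      0, 0, -Real.sin θ₂, Real.cos θ₂] := by
    ext i j; fin_cases i <;> fin_cases j <;> simp [elemRot, so4Basis, Matrix.single]
  rw [h1, h2]
  ext i j; fin_cases i <;> fin_cases j <;>
    simp [torusRot, Matrix.mul_apply, Fin.sum_univ_four]

/-- The rotation `exp (B₁₃ ψ₁) exp (B₂₄ ψ₂)`. -/
def tiltRot (ψ₁ ψ₂ : ℝ) : Matrix (Fin 4) (Fin 4) ℝ :=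
  !![Real.cos ψ₁, 0, Real.sin ψ₁, 0; 0, Real.cos ψ₂, 0, Real.sin ψ₂;
    -Real.sin ψ₁, 0, Real.cos ψ₁, 0; 0, -Real.sin ψ₂, 0, Real.cos ψ₂]

lemma elemRot_mul_tilt (ψ₁ ψ₂ : ℝ) : elemRot 0 2 ψ₁ * elemRot 1 3 ψ₂ = tiltRot ψ₁ ψ₂ := by
  have h1 : elemRot 0 2 ψ₁ = !![Real.cos ψ₁, 0, Real.sin ψ₁, 0; 0, 1, 0, 0;
      -Real.sin ψ₁, 0, Real.cos ψ₁, 0; 0, 0, 0, 1] := by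
    ext i j; fin_cases i <;> fin_cases j <;> simp [elemRot, so4Basis, Matrix.single]
  have h2 : elemRot 1 3 ψ₂ = !![1, 0, 0, 0; 0, Real.cos ψ₂, 0, Real.sin ψ₂; 0, 0, 1, 0;
      0, -Real.sin ψ₂, 0, Real.cos ψ₂] := by
    ext i j; fin_cases i <;> fin_cases j <;> simp [elemRot, so4Basis, Matrix.single]
  rw [h1, h2]
  ext i j; fin_cases i <;> fin_cases j <;>
    simp [tiltRot, Matrix.mul_apply, Fin.sum_univ_four]

lemma rotM_eq (θ₁ θ₂ ψ₁ ψ₂ : ℝ) : rotM θ₁ θ₂ ψ₁ ψ₂ =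
    torusRot (Real.cos θ₁) (Real.sin θ₁) (Real.cos θ₂) (Real.sin θ₂) * tiltRot ψ₁ ψ₂ := by
  rw [rotM, elemRot_mul_torus, Matrix.mul_assoc, elemRot_mul_tilt]

lemma det_four (A : Matrix (Fin 4) (Fin 4) ℝ) : A.det =
    A 0 0 * (A 1 1 * (A 2 2 * A 3 3 - A 2 3 * A 3 2) - A 1 2 * (A 2 1 * A 3 3 - A 2 3 * A 3 1)
      + A 1 3 * (A 2 1 * A 3 2 - A 2 2 * A 3 1))
    - A 0 1 * (A 1 0 * (A 2 2 * A 3 3 - A 2 3 * A 3 2) - A 1 2 * (A 2 0 * A 3 3 - A 2 3 * A 3 0)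
      + A 1 3 * (A 2 0 * A 3 2 - A 2 2 * A 3 0))
    + A 0 2 * (A 1 0 * (A 2 1 * A 3 3 - A 2 3 * A 3 1) - A 1 1 * (A 2 0 * A 3 3 - A 2 3 * A 3 0)
      + A 1 3 * (A 2 0 * A 3 1 - A 2 1 * A 3 0))
    - A 0 3 * (A 1 0 * (A 2 1 * A 3 2 - A 2 2 * A 3 1) - A 1 1 * (A 2 0 * A 3 2 - A 2 2 * A 3 0)
      + A 1 2 * (A 2 0 * A 3 1 - A 2 1 * A 3 0)) := by
  rw [Matrix.det_succ_row_zero]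
  simp [Fin.sum_univ_four, Matrix.det_fin_three, Fin.succAbove, Matrix.submatrix]
  ring

lemma tiltRot_transpose_mul (ψ₁ ψ₂ : ℝ) : (tiltRot ψ₁ ψ₂)ᵀ * tiltRot ψ₁ ψ₂ = 1 := by
  have h1 := Real.sin_sq_add_cos_sq ψ₁
  have h2 := Real.sin_sq_add_cos_sq ψ₂
  ext i j; fin_cases i <;> fin_cases j <;>
    simp [tiltRot, Matrix.mul_apply, Fin.sum_univ_four] <;> nlinarith

lemma det_tiltRot (ψ₁ ψ₂ : ℝ) : (tiltRot ψ₁ ψ₂).det = 1 := by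
  have h1 := Real.sin_sq_add_cos_sq ψ₁
  have h2 := Real.sin_sq_add_cos_sq ψ₂
  rw [det_four]
  simp [tiltRot]
  linear_combination (Real.sin ψ₂ ^ 2 + Real.cos ψ₂ ^ 2) * h1 + h2

lemma torusRot_transpose_mul {x y s t : ℝ} (h : x ^ 2 + y ^ 2 = 1) (h' : s ^ 2 + t ^ 2 = 1) :
    (torusRot x y s t)ᵀ * torusRot x y s t = 1 := by
  ext i j; fin_cases i <;> fin_cases j <;>
    simp [torusRot, Matrix.mul_apply, Fin.sum_univ_four] <;> nlinarith

lemma det_torusRot {x y s t : ℝ} (h : x ^ 2 + y ^ 2 = 1) (h' : s ^ 2 + t ^ 2 = 1) :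
    (torusRot x y s t).det = 1 := by
  rw [det_four]
  simp [torusRot]
  linear_combination (s ^ 2 + t ^ 2) * h + h'

lemma torusRot_conj_normalForm (μ₁ μ₂ : ℝ) {x y s t : ℝ} (h : x ^ 2 + y ^ 2 = 1)
    (h' : s ^ 2 + t ^ 2 = 1) :
    (torusRot x y s t)ᵀ * normalForm μ₁ μ₂ * torusRot x y s t = normalForm μ₁ μ₂ := by
  rw [normalForm_eq]
  ext i j; fin_cases i <;> fin_cases j <;>
    simp [torusRot, Matrix.mul_apply, Fin.sum_univ_four] <;>
    try ring_nf
  · linear_combination μ₁ * h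
  · linear_combination -μ₁ * h
  · linear_combination μ₂ * h'
  · linear_combination -μ₂ * h'

lemma exists_angle {x y : ℝ} (h : x ^ 2 + y ^ 2 = 1) :
    ∃ θ : ℝ, Real.cos θ = x ∧ Real.sin θ = y := by
  have hn : ‖(⟨x, y⟩ : ℂ)‖ = 1 := by
    rw [Complex.norm_def, Complex.normSq_apply, Real.sqrt_eq_one]; linarith
  have h0 : (⟨x, y⟩ : ℂ) ≠ 0 := by rw [← norm_ne_zero_iff, hn]; exact one_ne_zero
  exact ⟨Complex.arg ⟨x, y⟩, by rw [Complex.cos_arg h0, hn, div_one],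
    by rw [Complex.sin_arg, hn, div_one]⟩

lemma tiltRot_conj_normalForm (μ₁ μ₂ ψ₁ ψ₂ : ℝ) :
    (tiltRot ψ₁ ψ₂)ᵀ * normalForm μ₁ μ₂ * tiltRot ψ₁ ψ₂ =
    !![0, μ₁ * (Real.cos ψ₁ * Real.cos ψ₂) + μ₂ * (Real.sin ψ₁ * Real.sin ψ₂), 0,
        μ₁ * (Real.cos ψ₁ * Real.sin ψ₂) - μ₂ * (Real.sin ψ₁ * Real.cos ψ₂);
      -(μ₁ * (Real.cos ψ₁ * Real.cos ψ₂) + μ₂ * (Real.sin ψ₁ * Real.sin ψ₂)), 0,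
        μ₂ * (Real.cos ψ₁ * Real.sin ψ₂) - μ₁ * (Real.sin ψ₁ * Real.cos ψ₂), 0;
      0, -(μ₂ * (Real.cos ψ₁ * Real.sin ψ₂) - μ₁ * (Real.sin ψ₁ * Real.cos ψ₂)), 0,
        μ₁ * (Real.sin ψ₁ * Real.sin ψ₂) + μ₂ * (Real.cos ψ₁ * Real.cos ψ₂);
      -(μ₁ * (Real.cos ψ₁ * Real.sin ψ₂) - μ₂ * (Real.sin ψ₁ * Real.cos ψ₂)), 0,
        -(μ₁ * (Real.sin ψ₁ * Real.sin ψ₂) + μ₂ * (Real.cos ψ₁ * Real.cos ψ₂)), 0] := by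
  rw [normalForm_eq]
  ext i j; fin_cases i <;> fin_cases j <;>
    simp [tiltRot, Matrix.mul_apply, Fin.sum_univ_four] <;> ring

/-- Tilting by half the sum and half the difference of angles `σ`, `δ`. -/
lemma tiltRot_conj_half {μ₁ μ₂ σ δ c a b : ℝ} (h1 : (μ₁ - μ₂) * Real.cos σ = c)
    (h2 : (μ₁ - μ₂) * Real.sin σ = a - b) (h3 : (μ₁ + μ₂) * Real.cos δ = c)
    (h4 : (μ₁ + μ₂) * Real.sin δ = -(a + b)) :
    (tiltRot ((σ + δ) / 2) ((σ - δ) / 2))ᵀ * normalForm μ₁ μ₂ *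
      tiltRot ((σ + δ) / 2) ((σ - δ) / 2) = bodyForm c a b := by
  have e1 : σ = (σ + δ) / 2 + (σ - δ) / 2 := by ring
  have e2 : δ = (σ + δ) / 2 - (σ - δ) / 2 := by ring
  rw [tiltRot_conj_normalForm]
  generalize (σ + δ) / 2 = ψ₁ at *
  generalize (σ - δ) / 2 = ψ₂ at *
  -- After expansion every entry is half a sum or half a difference of two of the four equations;
  -- the normal entry is half the difference of the two that equal `c`, hence zero.
  subst e1 e2
  rw [Real.cos_add] at h1
  rw [Real.sin_add] at h2
  rw [Real.cos_sub] at h3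
  rw [Real.sin_sub] at h4
  ext i j; fin_cases i <;> fin_cases j <;> simp [bodyForm] <;> nlinarith

/-- Two invariants of the angular momentum: its norm and its Pfaffian. -/
lemma bodyForm_invariants {μ₁ μ₂ c a b : ℝ} {G : Matrix (Fin 4) (Fin 4) ℝ} (hG : Gᵀ * G = 1)
    (hdet : G.det = 1) (h : Gᵀ * normalForm μ₁ μ₂ * G = bodyForm c a b) :
    c ^ 2 + a ^ 2 + b ^ 2 = μ₁ ^ 2 + μ₂ ^ 2 ∧ a * b = μ₁ * μ₂ := by
  have hG' : G * Gᵀ = 1 := mul_eq_one_comm.mp hG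
  constructor
  · have key : (bodyForm c a b * (bodyForm c a b)ᵀ).trace =
        (normalForm μ₁ μ₂ * (normalForm μ₁ μ₂)ᵀ).trace := by
      rw [← h, Matrix.transpose_mul, Matrix.transpose_mul, Matrix.transpose_transpose]
      calc _ = (Gᵀ * (normalForm μ₁ μ₂ * (G * Gᵀ) * ((normalForm μ₁ μ₂)ᵀ * G))).trace := by
            simp only [Matrix.mul_assoc]
        _ = _ := by 
            rw [Matrix.trace_mul_comm]
            simp only [Matrix.mul_assoc, hG', Matrix.mul_one]
    rw [normalForm_eq] at key
    simp only [Matrix.trace, Matrix.diag_apply, Matrix.mul_apply, Fin.sum_univ_four,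
      Matrix.transpose_apply] at key
    simp [bodyForm] at key
    linarith
  · have e : ∀ i j, bodyForm c a b i j = μ₁ * (G 0 i * G 1 j - G 1 i * G 0 j) +
        μ₂ * (G 2 i * G 3 j - G 3 i * G 2 j) := by
      intro i j
      rw [← h, normalForm_eq]
      simp [Matrix.mul_apply, Fin.sum_univ_four]
      ring
    -- The Pfaffian of `Gᵀ L G` is `det G` times that of `L`.
    have pf : bodyForm c a b 0 1 * bodyForm c a b 2 3 - bodyForm c a b 0 2 * bodyForm c a b 1 3 +
        bodyForm c a b 0 3 * bodyForm c a b 1 2 = μ₁ * μ₂ * G.det := by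
      rw [det_four]
      simp only [e]
      ring
    rw [hdet] at pf
    simpa [bodyForm] using pf

/-- Commutation links the entries of each off-diagonal block in such a way that `μ₁² - μ₂²` times
every entry is zero. The upper block commutes with a nonzero multiple of the quarter turn and is
therefore a rotation. -/
lemma eq_torusRot_of_commute {μ₁ μ₂ : ℝ} (hμ₂ : 0 ≤ μ₂) (hμ : μ₂ < μ₁)
    {G : Matrix (Fin 4) (Fin 4) ℝ} (hG : Gᵀ * G = 1) (hdet : G.det = 1)
    (h : normalForm μ₁ μ₂ * G = G * normalForm μ₁ μ₂) :
    ∃ x y s t : ℝ, x ^ 2 + y ^ 2 = 1 ∧ s ^ 2 + t ^ 2 = 1 ∧ G = torusRot x y s t := by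
  rw [normalForm_eq] at h
  have hμ₁ : μ₁ ≠ 0 := by linarith
  have hd : μ₁ ^ 2 - μ₂ ^ 2 ≠ 0 := by nlinarith
  have e := fun i j => congrFun (congrFun h i) j
  simp only [Matrix.mul_apply, Fin.sum_univ_four] at e
  have e00 := e 0 0
  have e01 := e 0 1
  have e02 := e 0 2
  have e03 := e 0 3
  have e12 := e 1 2
  have e13 := e 1 3
  have e20 := e 2 0
  have e21 := e 2 1
  have e30 := e 3 0
  have e31 := e 3 1
  simp at e00 e01 e02 e03 e12 e13 e20 e21 e30 e31
  have z : ∀ x : ℝ, (μ₁ ^ 2 - μ₂ ^ 2) * x = 0 → x = 0 := fun x hx =>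
    (mul_eq_zero.mp hx).resolve_left hd
  have g02 : G 0 2 = 0 := z _ (by linear_combination μ₁ * e12 + μ₂ * e03)
  have g12 : G 1 2 = 0 := z _ (by linear_combination μ₁ * e02 + μ₂ * e13)
  have g03 : G 0 3 = 0 := z _ (by linear_combination -μ₁ * e13 - μ₂ * e02)
  have g13 : G 1 3 = 0 := z _ (by linear_combination μ₁ * e03 + μ₂ * e12)
  have g20 : G 2 0 = 0 := z _ (by linear_combination -μ₂ * e30 - μ₁ * e21)
  have g21 : G 2 1 = 0 := z _ (by linear_combination μ₂ * e31 + μ₁ * e20)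
  have g30 : G 3 0 = 0 := z _ (by linear_combination -μ₂ * e20 - μ₁ * e31)
  have g31 : G 3 1 = 0 := z _ (by linear_combination -μ₂ * e21 - μ₁ * e30)
  have g11 : G 1 1 = G 0 0 := mul_left_cancel₀ hμ₁ (by linarith)
  have g10 : G 1 0 = -G 0 1 := mul_left_cancel₀ hμ₁ (by linarith)
  have o := fun i j => congrFun (congrFun hG i) j
  simp only [Matrix.mul_apply, Fin.sum_univ_four, Matrix.transpose_apply] at o
  have o00 := o 0 0
  have o22 := o 2 2
  have o23 := o 2 3
  have o33 := o 3 3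
  simp [g02, g12, g03, g13, g20, g30, g10] at o00 o22 o23 o33
  rw [det_four] at hdet
  simp [g02, g12, g03, g13, g20, g21, g30, g31, g11, g10] at hdet
  -- As `μ₂` may be zero, commutation says nothing about the lower block; orthogonality and
  -- determinant 1 make it a rotation.
  have hS : G 2 2 * G 3 3 - G 2 3 * G 3 2 = 1 := by
    linear_combination hdet - (G 2 2 * G 3 3 - G 2 3 * G 3 2) * o00
  have g33 : G 3 3 = G 2 2 := by
    linear_combination G 2 2 * hS - G 3 3 * o22 + G 3 2 * o23
  have g32 : G 3 2 = -G 2 3 := by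
    linear_combination -G 2 3 * hS + G 3 3 * o23 - G 3 2 * o33
  refine ⟨G 0 0, G 0 1, G 2 2, G 2 3, by linarith, ?_, ?_⟩
  · linear_combination hS - G 2 2 * g33 + G 2 3 * g32
  · ext i j; fin_cases i <;> fin_cases j <;> 
      simp [torusRot, g02, g12, g03, g13, g20, g21, g30, g31, g11, g10, g33, g32]

/-- Frames in which the angular momentum has body form are parametrized by the four angles. -/
lemma exists_angles {μ₁ μ₂ c a b : ℝ} (hμ₂ : 0 ≤ μ₂) (hμ : μ₂ < μ₁)
    {G : Matrix (Fin 4) (Fin 4) ℝ} (hG : Gᵀ * G = 1) (hdet : G.det = 1)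
    (h : Gᵀ * normalForm μ₁ μ₂ * G = bodyForm c a b) :
    ∃ θ₁ θ₂ ψ₁ ψ₂ : ℝ, G = rotM θ₁ θ₂ ψ₁ ψ₂ := by
  obtain ⟨i1, i2⟩ := bodyForm_invariants hG hdet h
  have hD : μ₁ - μ₂ ≠ 0 := by linarith
  have hS : μ₁ + μ₂ ≠ 0 := by linarith
  -- The two invariants say exactly that these points lie on the unit circle. The angles `σ`, `δ`
  -- are `ψ₁ + ψ₂` and `ψ₁ - ψ₂`.
  obtain ⟨σ, hσ1, hσ2⟩ := exists_angle (x := c / (μ₁ - μ₂)) (y := (a - b) / (μ₁ - μ₂)) (by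
    field_simp; linear_combination i1 - 2 * i2)
  obtain ⟨δ, hδ1, hδ2⟩ := exists_angle (x := c / (μ₁ + μ₂)) (y := -(a + b) / (μ₁ + μ₂)) (by
    field_simp; linear_combination i1 + 2 * i2)
  have hR := tiltRot_conj_half (μ₁ := μ₁) (μ₂ := μ₂) (σ := σ) (δ := δ) (c := c) (a := a) (b := b)
    (by rw [hσ1]; field_simp) (by rw [hσ2]; field_simp) (by rw [hδ1]; field_simp)
    (by rw [hδ2]; field_simp)
  set R := tiltRot ((σ + δ) / 2) ((σ - δ) / 2) with hRdef
  have hR1 : Rᵀ * R = 1 := tiltRot_transpose_mul _ _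
  have hR2 : R * Rᵀ = 1 := mul_eq_one_comm.mp hR1
  have hG2 : G * Gᵀ = 1 := mul_eq_one_comm.mp hG
  have hRd : R.det = 1 := det_tiltRot _ _
  -- `G` and `R` conjugate the normal form to the same matrix, so they differ by an element of its
  -- centralizer.
  have hc : normalForm μ₁ μ₂ * (G * Rᵀ) = (G * Rᵀ) * normalForm μ₁ μ₂ := by
    have e1 : normalForm μ₁ μ₂ * G = G * bodyForm c a b := by
      rw [← h]; simp only [← Matrix.mul_assoc, hG2, Matrix.one_mul]
    have e2 : Rᵀ * normalForm μ₁ μ₂ = bodyForm c a b * Rᵀ := by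
      rw [← hR]; simp only [Matrix.mul_assoc, hR2, Matrix.mul_one]
    rw [← Matrix.mul_assoc, e1, Matrix.mul_assoc, ← e2, Matrix.mul_assoc]
  obtain ⟨x, y, s, t, hxy, hst, hT⟩ := eq_torusRot_of_commute hμ₂ hμ (G := G * Rᵀ)
    (by rw [Matrix.transpose_mul, Matrix.transpose_transpose, Matrix.mul_assoc,
          ← Matrix.mul_assoc Gᵀ, hG, Matrix.one_mul, hR2])
    (by rw [Matrix.det_mul, Matrix.det_transpose, hdet, hRd, one_mul]) hc
  obtain ⟨θ₁, rfl, rfl⟩ := exists_angle hxy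
  obtain ⟨θ₂, rfl, rfl⟩ := exists_angle hst
  refine ⟨θ₁, θ₂, (σ + δ) / 2, (σ - δ) / 2, ?_⟩
  rw [rotM_eq, ← hT, Matrix.mul_assoc, ← hRdef, hR1, Matrix.mul_one]

end ThreeBody

end

/-! ### Jacobi vectors. -/

noncomputable section

namespace ThreeBody

variable {m : Fin 3 → ℝ}

/-- The change to Jacobi vectors is canonical: the full pairing contains one more term, the centre
of mass times the total momentum, which is zero here. This one scalar identity, taken componentwise,
serves both the angular momentum and the symplectic form. -/
lemma jacobi_pairing {a b c : ℝ} (ha : 0 < a) (hb : 0 < b) (hc : 0 < c) {P₀ P₁ P₂ : ℝ}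
    (h : P₀ + P₁ + P₂ = 0) (r₀ r₁ r₂ : ℝ) :
    r₀ * P₀ + r₁ * P₁ + r₂ * P₂ =
      (r₁ - r₂) * ((b + c)⁻¹ * (c * P₁ - b * P₂)) +
      (r₀ - (b + c)⁻¹ * (b * r₁ + c * r₂)) *
        ((a + b + c)⁻¹ * ((b + c) * P₀ - a * (P₁ + P₂))) := by
  obtain rfl : P₀ = -P₁ - P₂ := by linarith
  field_simp
  ring

lemma sum_momentum_apply {z : Phase} (h : ∑ i, z.2 i = 0) (k : Fin 4) :
    z.2 0 k + z.2 1 k + z.2 2 k = 0 := by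
  have := congrArg (fun x : E4 => x k) h
  simpa [Fin.sum_univ_three] using this

lemma sum_mul_eq_jacobi (hm : ∀ i, 0 < m i) {v : Phase} (h : ∑ i, v.2 i = 0) (u : Phase)
    (j k : Fin 4) : ∑ i, u.1 i j * v.2 i k =
      jacobiX1 u j * jacobiY1 m v k + jacobiX2 m u j * jacobiY2 m v k := by
  have := jacobi_pairing (hm 0) (hm 1) (hm 2) (sum_momentum_apply h k) (u.1 0 j) (u.1 1 j)
    (u.1 2 j)
  simpa [Fin.sum_univ_three, jacobiX1, jacobiX2, jacobiY1, jacobiY2, mul_add] using this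

lemma sum_wedge_eq_jacobi (hm : ∀ i, 0 < m i) {v : Phase} (h : ∑ i, v.2 i = 0) (u : Phase) :
    ∑ i, wedge (u.1 i) (v.2 i) =
      wedge (jacobiX1 u) (jacobiY1 m v) + wedge (jacobiX2 m u) (jacobiY2 m v) := by
  ext j k
  have h1 := sum_mul_eq_jacobi hm h u j k
  have h2 := sum_mul_eq_jacobi hm h u k j
  simp only [Matrix.sum_apply, wedge, Matrix.sub_apply, Matrix.add_apply, Matrix.vecMulVec_apply,
    Finset.sum_sub_distrib]
  simp only [mul_comm (((v.2 _).ofLp) j), h1, h2]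
  ring

lemma angularMomentum_eq_jacobi (hm : ∀ i, 0 < m i) {z : Phase} (h : ∑ i, z.2 i = 0) :
    angularMomentum z =
      wedge (jacobiX1 z) (jacobiY1 m z) + wedge (jacobiX2 m z) (jacobiY2 m z) :=
  sum_wedge_eq_jacobi hm h z

lemma E4.inner_eq (x y : E4) :
    inner ℝ x y = x 0 * y 0 + x 1 * y 1 + x 2 * y 2 + x 3 * y 3 := by
  simp [PiLp.inner_apply, Fin.sum_univ_four, mul_comm]

lemma sum_inner_eq_jacobi (hm : ∀ i, 0 < m i) {v : Phase} (h : ∑ i, v.2 i = 0) (u : Phase) :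
    ∑ i, inner ℝ (u.1 i) (v.2 i) =
      inner ℝ (jacobiX1 u) (jacobiY1 m v) + inner ℝ (jacobiX2 m u) (jacobiY2 m v) := by
  have := fun k => sum_mul_eq_jacobi hm h u k k
  simp only [E4.inner_eq, Finset.sum_add_distrib, this]
  ring

lemma omega_eq_jacobi (hm : ∀ i, 0 < m i) {u v : Phase} (hu : ∑ i, u.2 i = 0)
    (hv : ∑ i, v.2 i = 0) : omega u v =
      inner ℝ (jacobiX1 u) (jacobiY1 m v) - inner ℝ (jacobiX1 v) (jacobiY1 m u) +
      (inner ℝ (jacobiX2 m u) (jacobiY2 m v) - inner ℝ (jacobiX2 m v) (jacobiY2 m u)) := by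
  have h1 := sum_inner_eq_jacobi hm hv u
  have h2 := sum_inner_eq_jacobi hm hu v
  have h3 : ∑ i, inner ℝ (u.2 i) (v.1 i) = ∑ i, inner ℝ (v.1 i) (u.2 i) :=
    Finset.sum_congr rfl fun i _ => real_inner_comm _ _
  rw [omega, Finset.sum_sub_distrib, h1, h3, h2]
  ring

lemma kinetic_scalar {a b c : ℝ} (ha : 0 < a) (hb : 0 < b) (hc : 0 < c) {P₀ P₁ P₂ : ℝ}
    (h : P₀ + P₁ + P₂ = 0) :
    P₀ ^ 2 / (2 * a) + P₁ ^ 2 / (2 * b) + P₂ ^ 2 / (2 * c) =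
      1 / (2 * (b * c / (b + c))) * ((b + c)⁻¹ * (c * P₁ - b * P₂)) ^ 2 +
      1 / (2 * (a * (b + c) / (a + b + c))) *
        ((a + b + c)⁻¹ * ((b + c) * P₀ - a * (P₁ + P₂))) ^ 2 := by
  obtain rfl : P₀ = -P₁ - P₂ := by linarith
  field_simp
  ring

lemma E4.norm_sq_eq (x : E4) : ‖x‖ ^ 2 = x 0 ^ 2 + x 1 ^ 2 + x 2 ^ 2 + x 3 ^ 2 := by
  rw [← real_inner_self_eq_norm_sq, E4.inner_eq]; ring

lemma kinetic_eq_jacobi (hm : ∀ i, 0 < m i) {z : Phase} (h : ∑ i, z.2 i = 0) :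
    ∑ i, ‖z.2 i‖ ^ 2 / (2 * m i) =
      1 / (2 * nu1 m) * ‖jacobiY1 m z‖ ^ 2 + 1 / (2 * nu2 m) * ‖jacobiY2 m z‖ ^ 2 := by
  have := fun k => kinetic_scalar (hm 0) (hm 1) (hm 2) (sum_momentum_apply h k)
  have h0 := this 0
  have h1 := this 1
  have h2 := this 2
  have h3 := this 3
  simp only [Fin.sum_univ_three, E4.norm_sq_eq, jacobiY1, jacobiY2, nu1, nu2, PiLp.smul_apply,
    PiLp.sub_apply, PiLp.add_apply, smul_eq_mul]
  linear_combination h0 + h1 + h2 + h3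

lemma potential_eq_jacobi (hm : ∀ i, 0 < m i) (W : ℝ × ℝ × ℝ → ℝ) (z : Phase) :
    potential W z.1 = potentialV m W (‖jacobiX1 z‖ ^ 2) (‖jacobiX2 m z‖ ^ 2)
      (inner ℝ (jacobiX1 z) (jacobiX2 m z)) := by
  have h1 := hm 1
  have h2 := hm 2
  have e1 : ‖z.1 2 - z.1 0‖ ^ 2 = (m 1 / (m 1 + m 2)) ^ 2 * ‖jacobiX1 z‖ ^ 2 +
      2 * (m 1 / (m 1 + m 2)) * inner ℝ (jacobiX1 z) (jacobiX2 m z) + ‖jacobiX2 m z‖ ^ 2 := by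
    simp only [E4.norm_sq_eq, E4.inner_eq, jacobiX1, jacobiX2, PiLp.smul_apply,
      PiLp.sub_apply, PiLp.add_apply, smul_eq_mul]
    field_simp
    ring
  have e2 : ‖z.1 0 - z.1 1‖ ^ 2 = (m 2 / (m 1 + m 2)) ^ 2 * ‖jacobiX1 z‖ ^ 2 -
      2 * (m 2 / (m 1 + m 2)) * inner ℝ (jacobiX1 z) (jacobiX2 m z) + ‖jacobiX2 m z‖ ^ 2 := by
    simp only [E4.norm_sq_eq, E4.inner_eq, jacobiX1, jacobiX2, PiLp.smul_apply,
      PiLp.sub_apply, PiLp.add_apply, smul_eq_mul]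
    field_simp
    ring
  simp only [potential, potentialV]
  rw [← e1, ← e2, Real.sqrt_sq (norm_nonneg _), Real.sqrt_sq (norm_nonneg _),
    Real.sqrt_sq (norm_nonneg _), jacobiX1]

/-- The state with zero total momentum and given Jacobi vectors, with the centre of mass of the
second and third body at the origin. -/
def ofJacobi (m : Fin 3 → ℝ) (x₁ x₂ y₁ y₂ : E4) : Phase :=
  (![x₂, (m 2 / (m 1 + m 2)) • x₁, -(m 1 / (m 1 + m 2)) • x₁],
   ![y₂, y₁ - (m 1 / (m 1 + m 2)) • y₂, -y₁ - (m 2 / (m 1 + m 2)) • y₂])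

lemma jacobi_ofJacobi (hm : ∀ i, 0 < m i) (x₁ x₂ y₁ y₂ : E4) :
    jacobiX1 (ofJacobi m x₁ x₂ y₁ y₂) = x₁ ∧ jacobiX2 m (ofJacobi m x₁ x₂ y₁ y₂) = x₂ ∧
    jacobiY1 m (ofJacobi m x₁ x₂ y₁ y₂) = y₁ ∧ jacobiY2 m (ofJacobi m x₁ x₂ y₁ y₂) = y₂ ∧
    ∑ i, (ofJacobi m x₁ x₂ y₁ y₂).2 i = 0 := by
  have h0 := hm 0
  have h1 := hm 1
  have h2 := hm 2
  refine ⟨?_, ?_, ?_, ?_, ?_⟩ <;> ext k <;>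
    simp [ofJacobi, jacobiX1, jacobiX2, jacobiY1, jacobiY2, Fin.sum_univ_three] <;>
    field_simp <;> ring

lemma momentum_eq_jacobi (hm : ∀ i, 0 < m i) {z : Phase} (h : ∑ i, z.2 i = 0) :
    z.2 0 = jacobiY2 m z ∧ z.2 1 = jacobiY1 m z - (m 1 / (m 1 + m 2)) • jacobiY2 m z ∧
    z.2 2 = -jacobiY1 m z - (m 2 / (m 1 + m 2)) • jacobiY2 m z := by
  have h0 := hm 0
  have h1 := hm 1
  have h2 := hm 2
  have e : z.2 0 = - z.2 1 - z.2 2 := by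
    rw [Fin.sum_univ_three] at h
    rw [eq_sub_iff_add_eq, eq_neg_iff_add_eq_zero, ← h]; abel
  refine ⟨?_, ?_, ?_⟩ <;> ext k <;>
    simp [jacobiY1, jacobiY2, e] <;>
    field_simp <;> ring

lemma position_eq_jacobi (hm : ∀ i, 0 < m i) (z : Phase) :
    z.1 1 = z.1 0 - jacobiX2 m z + (m 2 / (m 1 + m 2)) • jacobiX1 z ∧
    z.1 2 = z.1 0 - jacobiX2 m z - (m 1 / (m 1 + m 2)) • jacobiX1 z := by
  have h1 := hm 1
  have h2 := hm 2
  refine ⟨?_, ?_⟩ <;> ext k <;>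
    simp [jacobiX1, jacobiX2] <;>
    field_simp <;> ring

/-- A matrix acting on four-space. -/
def act (R : Matrix (Fin 4) (Fin 4) ℝ) : E4 →L[ℝ] E4 := Matrix.toEuclideanCLM (𝕜 := ℝ) R

lemma act_apply (R : Matrix (Fin 4) (Fin 4) ℝ) (x : E4) :
    act R x = WithLp.toLp 2 (R *ᵥ x.ofLp) := rfl

@[simp] lemma ofLp_act (R : Matrix (Fin 4) (Fin 4) ℝ) (x : E4) : (act R x).ofLp = R *ᵥ x.ofLp :=
  rfl

lemma act_mul (R S : Matrix (Fin 4) (Fin 4) ℝ) (x : E4) : act (R * S) x = act R (act S x) := by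
  ext k; simp [Matrix.mulVec_mulVec]

/-- At zero total momentum the Jacobi vectors determine all momenta, and the positions up to a
common translation, which is read off from the first body. -/
lemma sameOrbit_of_jacobi (hm : ∀ i, 0 < m i) {Λ R : Matrix (Fin 4) (Fin 4) ℝ} {z z' : Phase}
    (hz : ∑ i, z.2 i = 0) (hz' : ∑ i, z'.2 i = 0)
    (hR : R ∈ Matrix.specialOrthogonalGroup (Fin 4) ℝ) (hRΛ : R * Λ * Rᵀ = Λ)
    (h1 : jacobiX1 z' = act R (jacobiX1 z)) (h2 : jacobiX2 m z' = act R (jacobiX2 m z))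
    (h3 : jacobiY1 m z' = act R (jacobiY1 m z)) (h4 : jacobiY2 m z' = act R (jacobiY2 m z)) :
    SameOrbit Λ z z' := by
  refine ⟨R, hR, hRΛ, z'.1 0 - act R (z.1 0), ?_⟩
  simp only [← act_apply]
  obtain ⟨a0, a1, a2⟩ := momentum_eq_jacobi hm hz
  obtain ⟨b0, b1, b2⟩ := momentum_eq_jacobi hm hz'
  obtain ⟨c1, c2⟩ := position_eq_jacobi hm z
  obtain ⟨d1, d2⟩ := position_eq_jacobi hm z'
  intro i
  fin_cases i
  · exact ⟨by simp, by simp [a0, b0, h4]⟩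
  · exact ⟨by simp [c1, d1, h1, h2]; abel, by simp [a1, b1, h3, h4]⟩
  · exact ⟨by simp [c2, d2, h1, h2]; abel, by simp [a2, b2, h3, h4]⟩

lemma SameOrbit.jacobi {Λ : Matrix (Fin 4) (Fin 4) ℝ} {z z' : Phase}
    (hm : ∀ i, 0 < m i) (h : SameOrbit Λ z z') :
    ∃ R ∈ Matrix.specialOrthogonalGroup (Fin 4) ℝ, R * Λ * Rᵀ = Λ ∧
      jacobiX1 z' = act R (jacobiX1 z) ∧ jacobiX2 m z' = act R (jacobiX2 m z) ∧
      jacobiY1 m z' = act R (jacobiY1 m z) ∧ jacobiY2 m z' = act R (jacobiY2 m z) := by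
  obtain ⟨R, hR, hRΛ, c, h⟩ := h
  simp only [← act_apply] at h
  refine ⟨R, hR, hRΛ, ?_, ?_, ?_, ?_⟩
  · simp [jacobiX1, h]
  · have h1 := hm 1
    have h2 := hm 2
    -- The weights of the centre of mass add up to one, so the translation cancels in `x₂`.
    have e : c = (m 1 + m 2)⁻¹ • (m 1 • c + m 2 • c) := by
      rw [← add_smul, smul_smul, inv_mul_cancel₀ (by positivity), one_smul]
    simp only [jacobiX2, h, map_sub, map_smul, map_add, smul_add]
    nth_rewrite 1 [e]
    simp only [smul_add]
    abel
  · simp [jacobiY1, h]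
  · simp [jacobiY2, h]

end ThreeBody

end

/-! ### Body frames, signs, energy and orbits. -/

noncomputable section

namespace ThreeBody

variable {m : Fin 3 → ℝ} {Λ N M : Matrix (Fin 4) (Fin 4) ℝ} {c a b : ℝ} {z : Phase} {w : Coord}

/-- The columns of `M` are an orthonormal frame, oriented like `N`, in which `Λ` has body form. -/
structure IsBodyFrame (Λ N M : Matrix (Fin 4) (Fin 4) ℝ) (c a b : ℝ) : Prop where
  orth : Mᵀ * M = 1
  det : (Nᵀ * M).det = 1
  form : Mᵀ * Λ * M = bodyForm c a b

/-- The frame `M` gives the state `z` the coordinates `w`. -/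
structure ReadsCoord (m : Fin 3 → ℝ) (M : Matrix (Fin 4) (Fin 4) ℝ) (z : Phase) (w : Coord) :
    Prop where
  x₁ : Mᵀ *ᵥ (jacobiX1 z).ofLp = ![w.1 0, w.1 1, 0, 0]
  x₂ : Mᵀ *ᵥ (jacobiX2 m z).ofLp = ![w.1 2, w.1 3, 0, 0]
  y₁₀ : (Mᵀ *ᵥ (jacobiY1 m z).ofLp) 0 = w.2 0
  y₁₁ : (Mᵀ *ᵥ (jacobiY1 m z).ofLp) 1 = w.2 1
  y₂₀ : (Mᵀ *ᵥ (jacobiY2 m z).ofLp) 0 = w.2 2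
  y₂₁ : (Mᵀ *ᵥ (jacobiY2 m z).ofLp) 1 = w.2 3

lemma conj_eq_of_normalForm {L₀ : Matrix (Fin 4) (Fin 4) ℝ} (hN : Nᵀ * N = 1)
    (hNΛ : Nᵀ * Λ * N = L₀) (M : Matrix (Fin 4) (Fin 4) ℝ) :
    Mᵀ * Λ * M = (Nᵀ * M)ᵀ * L₀ * (Nᵀ * M) := by
  have hN' : N * Nᵀ = 1 := mul_eq_one_comm.mp hN
  have : Λ = N * L₀ * Nᵀ := by
    rw [← hNΛ]
    simp only [Matrix.mul_assoc, hN', Matrix.mul_one]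
    rw [← Matrix.mul_assoc, hN', Matrix.one_mul]
  rw [this]
  simp only [Matrix.transpose_mul, Matrix.transpose_transpose, Matrix.mul_assoc]

lemma frame_relative_orth (hN : Nᵀ * N = 1) (hM : Mᵀ * M = 1) :
    (Nᵀ * M)ᵀ * (Nᵀ * M) = 1 := by
  have hN' : N * Nᵀ = 1 := mul_eq_one_comm.mp hN
  rw [Matrix.transpose_mul, Matrix.transpose_transpose, Matrix.mul_assoc, ← Matrix.mul_assoc N,
    hN', Matrix.one_mul, hM]

lemma mulVec_transpose_cancel (hM : Mᵀ * M = 1) (x : Fin 4 → ℝ) : M *ᵥ (Mᵀ *ᵥ x) = x := by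
  rw [Matrix.mulVec_mulVec, mul_eq_one_comm.mp hM, Matrix.one_mulVec]

lemma transpose_mulVec_cancel (hM : Mᵀ * M = 1) (x : Fin 4 → ℝ) : Mᵀ *ᵥ (M *ᵥ x) = x := by
  rw [Matrix.mulVec_mulVec, hM, Matrix.one_mulVec]

lemma vec_eta (x : Fin 4 → ℝ) : x = ![x 0, x 1, x 2, x 3] := by
  ext i; fin_cases i <;> rfl

lemma IsBodyFrame.hasCoord {μ₁ μ₂ : ℝ} (hμ₂ : 0 ≤ μ₂) (hμ : μ₂ < μ₁) (hN : Nᵀ * N = 1)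
    (hNΛ : Nᵀ * Λ * N = normalForm μ₁ μ₂) (hM : IsBodyFrame Λ N M c a b)
    (hz : ReadsCoord m M z w) : HasCoord m N z w := by
  obtain ⟨θ₁, θ₂, ψ₁, ψ₂, h⟩ := exists_angles hμ₂ hμ (frame_relative_orth hN hM.orth) hM.det
    (by rw [← conj_eq_of_normalForm hN hNΛ, hM.form])
  have e : N * rotM θ₁ θ₂ ψ₁ ψ₂ = M := by
    rw [← h, ← Matrix.mul_assoc, mul_eq_one_comm.mp hN, Matrix.one_mul]
  refine ⟨θ₁, θ₂, ψ₁, ψ₂, (Mᵀ *ᵥ (jacobiY1 m z).ofLp) 2, (Mᵀ *ᵥ (jacobiY1 m z).ofLp) 3,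
    (Mᵀ *ᵥ (jacobiY2 m z).ofLp) 2, (Mᵀ *ᵥ (jacobiY2 m z).ofLp) 3, ?_⟩
  rw [e, ← hz.x₁, ← hz.x₂, ← hz.y₁₀, ← hz.y₁₁, ← hz.y₂₀, ← hz.y₂₁, ← vec_eta, ← vec_eta]
  simp only [mulVec_transpose_cancel hM.orth, and_self]

lemma rotM_orth (θ₁ θ₂ ψ₁ ψ₂ : ℝ) :
    (rotM θ₁ θ₂ ψ₁ ψ₂)ᵀ * rotM θ₁ θ₂ ψ₁ ψ₂ = 1 ∧ (rotM θ₁ θ₂ ψ₁ ψ₂).det = 1 := by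
  have h1 := Real.cos_sq_add_sin_sq θ₁
  have h2 := Real.cos_sq_add_sin_sq θ₂
  rw [rotM_eq]
  constructor
  · rw [Matrix.transpose_mul, Matrix.mul_assoc, ← Matrix.mul_assoc _ _ (tiltRot ψ₁ ψ₂),
      torusRot_transpose_mul h1 h2, Matrix.one_mul, tiltRot_transpose_mul]
  · rw [Matrix.det_mul, det_torusRot h1 h2, det_tiltRot, one_mul]

lemma conj_wedge (M : Matrix (Fin 4) (Fin 4) ℝ) (x y : E4) (i j : Fin 4) :
    (Mᵀ * wedge x y * M) i j = (Mᵀ *ᵥ x.ofLp) i * (Mᵀ *ᵥ y.ofLp) j -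
      (Mᵀ *ᵥ y.ofLp) i * (Mᵀ *ᵥ x.ofLp) j := by
  simp only [wedge, Matrix.mul_sub, Matrix.sub_mul, Matrix.mul_vecMulVec, Matrix.vecMulVec_mul,
    Matrix.sub_apply, Matrix.vecMulVec_apply, ← Matrix.mulVec_transpose]

lemma conj_level (hm : ∀ i, 0 < m i) (hz : z ∈ level Λ) (M : Matrix (Fin 4) (Fin 4) ℝ)
    (i j : Fin 4) : (Mᵀ * Λ * M) i j =
      (Mᵀ *ᵥ (jacobiX1 z).ofLp) i * (Mᵀ *ᵥ (jacobiY1 m z).ofLp) j -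
      (Mᵀ *ᵥ (jacobiY1 m z).ofLp) i * (Mᵀ *ᵥ (jacobiX1 z).ofLp) j +
      ((Mᵀ *ᵥ (jacobiX2 m z).ofLp) i * (Mᵀ *ᵥ (jacobiY2 m z).ofLp) j -
      (Mᵀ *ᵥ (jacobiY2 m z).ofLp) i * (Mᵀ *ᵥ (jacobiX2 m z).ofLp) j) := by
  rw [← hz.2, angularMomentum_eq_jacobi hm hz.1, Matrix.mul_add, Matrix.add_mul, Matrix.add_apply,
    conj_wedge, conj_wedge]

/-- The momenta normal to the plane of the bodies. -/
structure NormalMomenta (m : Fin 3 → ℝ) (M : Matrix (Fin 4) (Fin 4) ℝ) (z : Phase) (w : Coord)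
    (a b : ℝ) : Prop where
  y₁₂ : 2 * area w * (Mᵀ *ᵥ (jacobiY1 m z).ofLp) 2 = -w.1 2 * b
  y₁₃ : 2 * area w * (Mᵀ *ᵥ (jacobiY1 m z).ofLp) 3 = w.1 3 * a
  y₂₂ : 2 * area w * (Mᵀ *ᵥ (jacobiY2 m z).ofLp) 2 = w.1 0 * b
  y₂₃ : 2 * area w * (Mᵀ *ᵥ (jacobiY2 m z).ofLp) 3 = -w.1 1 * a

/-- Comparison of the entries of `Mᵀ Λ M`, using that the positions have no normal components. The
last four equations form two linear systems, one for each normal direction, with the same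
coefficients. -/
lemma IsBodyFrame.level_eqs (hm : ∀ i, 0 < m i) (hz : z ∈ level Λ)
    (hM : IsBodyFrame Λ N M c a b) (h : ReadsCoord m M z w) :
    c = L3 w ∧
    w.1 0 * (Mᵀ *ᵥ (jacobiY1 m z).ofLp) 2 + w.1 2 * (Mᵀ *ᵥ (jacobiY2 m z).ofLp) 2 = 0 ∧
    w.1 1 * (Mᵀ *ᵥ (jacobiY1 m z).ofLp) 2 + w.1 3 * (Mᵀ *ᵥ (jacobiY2 m z).ofLp) 2 = b ∧
    w.1 0 * (Mᵀ *ᵥ (jacobiY1 m z).ofLp) 3 + w.1 2 * (Mᵀ *ᵥ (jacobiY2 m z).ofLp) 3 = a ∧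
    w.1 1 * (Mᵀ *ᵥ (jacobiY1 m z).ofLp) 3 + w.1 3 * (Mᵀ *ᵥ (jacobiY2 m z).ofLp) 3 = 0 := by
  have e := fun i j => conj_level hm hz M i j
  rw [hM.form, h.x₁, h.x₂] at e
  have e01 := e 0 1
  have e02 := e 0 2
  have e03 := e 0 3
  have e12 := e 1 2
  have e13 := e 1 3
  simp only [h.y₁₀, h.y₁₁, h.y₂₀, h.y₂₁] at e01
  simp [bodyForm] at e01 e02 e03 e12 e13
  exact ⟨by rw [e01, L3]; ring, e02.symm, e12.symm, e03.symm, e13.symm⟩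

/-- Cramer's rule; the determinant of both systems is `2A`. -/
lemma IsBodyFrame.normalMomenta (hm : ∀ i, 0 < m i) (hz : z ∈ level Λ)
    (hM : IsBodyFrame Λ N M c a b) (h : ReadsCoord m M z w) : NormalMomenta m M z w a b := by
  obtain ⟨-, e1, e2, e3, e4⟩ := hM.level_eqs hm hz h
  constructor <;> simp only [area]
  · linear_combination w.1 3 * e1 - w.1 2 * e2
  · linear_combination w.1 3 * e3 - w.1 2 * e4
  · linear_combination -w.1 1 * e1 + w.1 0 * e2
  · linear_combination -w.1 1 * e3 + w.1 0 * e4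

/-- Coordinates of a state of the level set come from a body frame. -/
lemma HasCoord.exists_bodyFrame {μ₁ μ₂ : ℝ} (hm : ∀ i, 0 < m i) (hN : Nᵀ * N = 1)
    (hNΛ : Nᵀ * Λ * N = normalForm μ₁ μ₂) (hz : z ∈ level Λ) (h : HasCoord m N z w) :
    ∃ M c a b, IsBodyFrame Λ N M c a b ∧ ReadsCoord m M z w := by
  obtain ⟨θ₁, θ₂, ψ₁, ψ₂, α₁, α₂, α₃, α₄, h1, h2, h3, h4⟩ := h
  set M := N * rotM θ₁ θ₂ ψ₁ ψ₂ with hM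
  have hr := rotM_orth θ₁ θ₂ ψ₁ ψ₂
  have hMM : Mᵀ * M = 1 := by
    rw [hM, Matrix.transpose_mul, Matrix.mul_assoc, ← Matrix.mul_assoc Nᵀ, hN, Matrix.one_mul, hr.1]
  have hNM : Nᵀ * M = rotM θ₁ θ₂ ψ₁ ψ₂ := by rw [hM, ← Matrix.mul_assoc, hN, Matrix.one_mul]
  have hrd : ReadsCoord m M z w := by
    constructor <;> simp only [h1, h2, h3, h4, transpose_mulVec_cancel hMM] <;> rfl
  have hconj : Mᵀ * Λ * M = (tiltRot ψ₁ ψ₂)ᵀ * normalForm μ₁ μ₂ * tiltRot ψ₁ ψ₂ := by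
    rw [conj_eq_of_normalForm hN hNΛ, hNM, rotM_eq, Matrix.transpose_mul]
    conv_rhs => rw [← torusRot_conj_normalForm μ₁ μ₂ (Real.cos_sq_add_sin_sq θ₁)
      (Real.cos_sq_add_sin_sq θ₂)]
    simp only [Matrix.mul_assoc]
  -- The positions lie in the plane, so this entry is zero: the one relation on the tilt angles
  -- needed to reach body form.
  have e23 := conj_level hm hz M 2 3
  rw [hrd.x₁, hrd.x₂, hconj, tiltRot_conj_normalForm] at e23
  simp at e23
  refine ⟨M, μ₁ * (Real.cos ψ₁ * Real.cos ψ₂) + μ₂ * (Real.sin ψ₁ * Real.sin ψ₂),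
    μ₁ * (Real.cos ψ₁ * Real.sin ψ₂) - μ₂ * (Real.sin ψ₁ * Real.cos ψ₂),
    μ₂ * (Real.cos ψ₁ * Real.sin ψ₂) - μ₁ * (Real.sin ψ₁ * Real.cos ψ₂),
    ⟨hMM, by rw [hNM, hr.2], ?_⟩, hrd⟩
  rw [hconj, tiltRot_conj_normalForm, e23, neg_zero, bodyForm]

lemma IsBodyFrame.invariants {μ₁ μ₂ : ℝ} (hN : Nᵀ * N = 1)
    (hNΛ : Nᵀ * Λ * N = normalForm μ₁ μ₂) (hM : IsBodyFrame Λ N M c a b) :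
    (b - a) ^ 2 = (μ₁ - μ₂) ^ 2 - c ^ 2 ∧ (b + a) ^ 2 = (μ₁ + μ₂) ^ 2 - c ^ 2 := by
  obtain ⟨h1, h2⟩ := bodyForm_invariants (frame_relative_orth hN hM.orth) hM.det
    (by rw [← conj_eq_of_normalForm hN hNΛ, hM.form])
  exact ⟨by linear_combination h1 - 2 * h2, by linear_combination h1 + 2 * h2⟩

lemma IsBodyFrame.mul {g : Matrix (Fin 4) (Fin 4) ℝ} {c' a' b' : ℝ}
    (hM : IsBodyFrame Λ N M c a b) (hg : gᵀ * g = 1) (hd : g.det = 1)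
    (h : gᵀ * bodyForm c a b * g = bodyForm c' a' b') : IsBodyFrame Λ N (M * g) c' a' b' := by
  refine ⟨?_, ?_, ?_⟩
  · rw [Matrix.transpose_mul, Matrix.mul_assoc, ← Matrix.mul_assoc Mᵀ, hM.orth, Matrix.one_mul, hg]
  · rw [← Matrix.mul_assoc, Matrix.det_mul, hM.det, hd, one_mul]
  · rw [← h, ← hM.form, Matrix.transpose_mul]; simp only [Matrix.mul_assoc]

/-- Rotation of the normal plane by `π`. -/
def flipRot : Matrix (Fin 4) (Fin 4) ℝ := !![1, 0, 0, 0; 0, 1, 0, 0; 0, 0, -1, 0; 0, 0, 0, -1]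

/-- Simultaneous quarter turns of the plane of the bodies and of the normal plane. -/
def quarterRot : Matrix (Fin 4) (Fin 4) ℝ := !![0, -1, 0, 0; 1, 0, 0, 0; 0, 0, 0, -1; 0, 0, 1, 0]

/-- The coordinates after a quarter turn of the frame. -/
def quarterTurn (w : Coord) : Coord :=
  (![w.1 1, -w.1 0, w.1 3, -w.1 2], ![w.2 1, -w.2 0, w.2 3, -w.2 2])

lemma IsBodyFrame.flip (hM : IsBodyFrame Λ N M c a b) :
    IsBodyFrame Λ N (M * flipRot) c (-a) (-b) := by
  refine hM.mul ?_ ?_ ?_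
  · ext i j; fin_cases i <;> fin_cases j <;> simp [flipRot, Matrix.mul_apply, Fin.sum_univ_four]
  · rw [det_four]; simp [flipRot]
  · ext i j; fin_cases i <;> fin_cases j <;>
      simp [flipRot, bodyForm, Matrix.mul_apply, Fin.sum_univ_four]

lemma IsBodyFrame.quarter (hM : IsBodyFrame Λ N M c a b) :
    IsBodyFrame Λ N (M * quarterRot) c (-b) (-a) := by
  refine hM.mul ?_ ?_ ?_
  · ext i j; fin_cases i <;> fin_cases j <;> simp [quarterRot, Matrix.mul_apply, Fin.sum_univ_four]
  · rw [det_four]; simp [quarterRot]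
  · ext i j; fin_cases i <;> fin_cases j <;>
      simp [quarterRot, bodyForm, Matrix.mul_apply, Fin.sum_univ_four]

lemma flipRot_transpose_mulVec (x : Fin 4 → ℝ) : flipRotᵀ *ᵥ x = ![x 0, x 1, -x 2, -x 3] := by
  ext i; fin_cases i <;> simp [flipRot, Matrix.mulVec, dotProduct, Fin.sum_univ_four]

lemma quarterRot_transpose_mulVec (x : Fin 4 → ℝ) :
    quarterRotᵀ *ᵥ x = ![x 1, -x 0, x 3, -x 2] := by
  ext i; fin_cases i <;> simp [quarterRot, Matrix.mulVec, dotProduct, Fin.sum_univ_four]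

lemma ReadsCoord.flip (h : ReadsCoord m M z w) : ReadsCoord m (M * flipRot) z w := by
  constructor <;> rw [Matrix.transpose_mul, ← Matrix.mulVec_mulVec, flipRot_transpose_mulVec]
  · simp [h.x₁]
  · simp [h.x₂]
  · simp [h.y₁₀]
  · simp [h.y₁₁]
  · simp [h.y₂₀]
  · simp [h.y₂₁]

lemma ReadsCoord.quarter (h : ReadsCoord m M z w) :
    ReadsCoord m (M * quarterRot) z (quarterTurn w) := by
  constructor <;>
    rw [Matrix.transpose_mul, ← Matrix.mulVec_mulVec, quarterRot_transpose_mulVec]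
  · simp [h.x₁, quarterTurn]
  · simp [h.x₂, quarterTurn]
  · simp [h.y₁₁, quarterTurn]
  · simp [h.y₁₀, quarterTurn]
  · simp [h.y₂₁, quarterTurn]
  · simp [h.y₂₀, quarterTurn]

lemma area_quarterTurn (w : Coord) : area (quarterTurn w) = area w := by
  simp [area, quarterTurn]; ring

lemma L3_quarterTurn (w : Coord) : L3 (quarterTurn w) = L3 w := by
  simp [L3, quarterTurn]; ring

/-- A body frame in which the components of the angular momentum between the plane of the bodies
and the normal plane are given by the square roots `L_d` and `L_s` with the chosen signs. -/
def IsSignedFrame (μ₁ μ₂ εd εs : ℝ) (Λ N M : Matrix (Fin 4) (Fin 4) ℝ) (w : Coord) : Prop :=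
  IsBodyFrame Λ N M (L3 w) ((Ls μ₁ μ₂ εs w - Ld μ₁ μ₂ εd w) / 2)
    ((Ls μ₁ μ₂ εs w + Ld μ₁ μ₂ εd w) / 2)

lemma sign_mul_sqrt_sq {ε x : ℝ} (hε : ε = 1 ∨ ε = -1) (hx : 0 ≤ x) : (ε * √x) ^ 2 = x := by
  rw [mul_pow, Real.sq_sqrt hx]
  rcases hε with rfl | rfl <;> ring

/-- Every pair of signs is realized. -/
lemma IsBodyFrame.exists_signed {μ₁ μ₂ εd εs : ℝ} (hm : ∀ i, 0 < m i) (hN : Nᵀ * N = 1)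
    (hNΛ : Nᵀ * Λ * N = normalForm μ₁ μ₂) (hεd : εd = 1 ∨ εd = -1) (hεs : εs = 1 ∨ εs = -1)
    (hz : z ∈ level Λ) (hM : IsBodyFrame Λ N M c a b) (h : ReadsCoord m M z w) :
    ∃ M' w', IsSignedFrame μ₁ μ₂ εd εs Λ N M' w' ∧ ReadsCoord m M' z w' ∧ L3 w' = c ∧
      area w' = area w := by
  obtain ⟨i1, i2⟩ := hM.invariants hN hNΛ
  obtain ⟨rfl, -⟩ := hM.level_eqs hm hz h
  have hd : (b - a) ^ 2 = Ld μ₁ μ₂ εd w ^ 2 := by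
    rw [Ld, sign_mul_sqrt_sq hεd (by rw [← i1]; positivity), i1]
  have hs : (b + a) ^ 2 = Ls μ₁ μ₂ εs w ^ 2 := by
    rw [Ls, sign_mul_sqrt_sq hεs (by rw [← i2]; positivity), i2]
  have hq1 : Ld μ₁ μ₂ εd (quarterTurn w) = Ld μ₁ μ₂ εd w := by rw [Ld, Ld, L3_quarterTurn]
  have hq2 : Ls μ₁ μ₂ εs (quarterTurn w) = Ls μ₁ μ₂ εs w := by rw [Ls, Ls, L3_quarterTurn]
  -- `quarterRot` sends `(a, b)` to `(-b, -a)`, which keeps `b - a` and negates `b + a`; `flipRot`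
  -- negates both. Neither changes `L₃` or the area, so each of the four cases is corrected by a
  -- product of the two.
  rcases sq_eq_sq_iff_eq_or_eq_neg.mp hd with hd | hd <;>
    rcases sq_eq_sq_iff_eq_or_eq_neg.mp hs with hs | hs
  · refine ⟨M, w, ?_, h, rfl, rfl⟩
    rw [IsSignedFrame, ← hd, ← hs]
    convert hM using 1 <;> ring
  · refine ⟨M * quarterRot, quarterTurn w, ?_, h.quarter, L3_quarterTurn w, area_quarterTurn w⟩
    rw [IsSignedFrame, hq1, hq2, ← hd, L3_quarterTurn, ← neg_eq_iff_eq_neg.mpr hs]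
    convert hM.quarter using 1 <;> ring
  · refine ⟨M * quarterRot * flipRot, quarterTurn w, ?_, h.quarter.flip, L3_quarterTurn w,
      area_quarterTurn w⟩
    rw [IsSignedFrame, hq1, hq2, ← hs, L3_quarterTurn, ← neg_eq_iff_eq_neg.mpr hd]
    convert hM.quarter.flip using 1 <;> ring
  · refine ⟨M * flipRot, w, ?_, h.flip, rfl, rfl⟩
    rw [IsSignedFrame, ← neg_eq_iff_eq_neg.mpr hd, ← neg_eq_iff_eq_neg.mpr hs]
    convert hM.flip using 1 <;> ring

lemma inner_eq_frame (hM : Mᵀ * M = 1) (x y : E4) : inner ℝ x y =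
    (Mᵀ *ᵥ x.ofLp) 0 * (Mᵀ *ᵥ y.ofLp) 0 + (Mᵀ *ᵥ x.ofLp) 1 * (Mᵀ *ᵥ y.ofLp) 1 +
    (Mᵀ *ᵥ x.ofLp) 2 * (Mᵀ *ᵥ y.ofLp) 2 + (Mᵀ *ᵥ x.ofLp) 3 * (Mᵀ *ᵥ y.ofLp) 3 := by
  have h : (Mᵀ *ᵥ x.ofLp) ⬝ᵥ (Mᵀ *ᵥ y.ofLp) = x.ofLp ⬝ᵥ y.ofLp := by
    rw [Matrix.dotProduct_mulVec, Matrix.vecMul_transpose, mulVec_transpose_cancel hM]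
  rw [E4.inner_eq]
  simp only [dotProduct, Fin.sum_univ_four] at h
  exact h.symm

lemma norm_sq_eq_frame (hM : Mᵀ * M = 1) (x : E4) : ‖x‖ ^ 2 =
    (Mᵀ *ᵥ x.ofLp) 0 ^ 2 + (Mᵀ *ᵥ x.ofLp) 1 ^ 2 + (Mᵀ *ᵥ x.ofLp) 2 ^ 2 +
    (Mᵀ *ᵥ x.ofLp) 3 ^ 2 := by
  rw [← real_inner_self_eq_norm_sq, inner_eq_frame hM]; ring

/-- The energy in reduced coordinates. -/
lemma IsSignedFrame.energy {μ₁ μ₂ εd εs : ℝ} (hm : ∀ i, 0 < m i) (W : ℝ × ℝ × ℝ → ℝ)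
    (hz : z ∈ level Λ) (hM : IsSignedFrame μ₁ μ₂ εd εs Λ N M w) (h : ReadsCoord m M z w)
    (hA : area w ≠ 0) :
    hamiltonian m W z = reducedHamiltonian m W μ₁ μ₂ εd εs w := by
  have hn := hM.normalMomenta hm hz h
  have hM' : Mᵀ * M = 1 := hM.orth
  have n1 : ‖jacobiY1 m z‖ ^ 2 = w.2 0 ^ 2 + w.2 1 ^ 2 + fRed μ₁ μ₂ εd εs 2 3 w := by
    -- Squares of the Cramer formulas, with `2b = L_s + L_d` and `2a = L_s - L_d`.
    have e : fRed μ₁ μ₂ εd εs 2 3 w = (Mᵀ *ᵥ (jacobiY1 m z).ofLp) 2 ^ 2 +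
        (Mᵀ *ᵥ (jacobiY1 m z).ofLp) 3 ^ 2 := by
      rw [fRed, div_eq_iff (by positivity)]
      linear_combination -4 * (2 * area w * (Mᵀ *ᵥ (jacobiY1 m z).ofLp) 2 + -w.1 2 *
        ((Ls μ₁ μ₂ εs w + Ld μ₁ μ₂ εd w) / 2)) * hn.y₁₂ -
        4 * (2 * area w * (Mᵀ *ᵥ (jacobiY1 m z).ofLp) 3 + w.1 3 *
        ((Ls μ₁ μ₂ εs w - Ld μ₁ μ₂ εd w) / 2)) * hn.y₁₃
    rw [norm_sq_eq_frame hM', h.y₁₀, h.y₁₁, e]; ring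
  have n2 : ‖jacobiY2 m z‖ ^ 2 = w.2 2 ^ 2 + w.2 3 ^ 2 + fRed μ₁ μ₂ εd εs 0 1 w := by
    have e : fRed μ₁ μ₂ εd εs 0 1 w = (Mᵀ *ᵥ (jacobiY2 m z).ofLp) 2 ^ 2 +
        (Mᵀ *ᵥ (jacobiY2 m z).ofLp) 3 ^ 2 := by
      rw [fRed, div_eq_iff (by positivity)]
      linear_combination -4 * (2 * area w * (Mᵀ *ᵥ (jacobiY2 m z).ofLp) 2 + w.1 0 *
        ((Ls μ₁ μ₂ εs w + Ld μ₁ μ₂ εd w) / 2)) * hn.y₂₂ -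
        4 * (2 * area w * (Mᵀ *ᵥ (jacobiY2 m z).ofLp) 3 + -w.1 1 *
        ((Ls μ₁ μ₂ εs w - Ld μ₁ μ₂ εd w) / 2)) * hn.y₂₃
    rw [norm_sq_eq_frame hM', h.y₂₀, h.y₂₁, e]; ring
  have n3 : ‖jacobiX1 z‖ ^ 2 = w.1 0 ^ 2 + w.1 1 ^ 2 := by
    rw [norm_sq_eq_frame hM', h.x₁]; simp
  have n4 : ‖jacobiX2 m z‖ ^ 2 = w.1 2 ^ 2 + w.1 3 ^ 2 := by
    rw [norm_sq_eq_frame hM', h.x₂]; simp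
  have n5 : inner ℝ (jacobiX1 z) (jacobiX2 m z) = w.1 0 * w.1 2 + w.1 1 * w.1 3 := by
    rw [inner_eq_frame hM', h.x₁, h.x₂]; simp
  rw [hamiltonian, kinetic_eq_jacobi hm hz.1, potential_eq_jacobi hm, n1, n2, n3, n4, n5,
    reducedHamiltonian]

lemma eq_act_of_frames {M M' : Matrix (Fin 4) (Fin 4) ℝ} (hM' : M'ᵀ * M' = 1)
    {x x' : E4} (h : M'ᵀ *ᵥ x'.ofLp = Mᵀ *ᵥ x.ofLp) : x' = act (M' * Mᵀ) x := by
  rw [act_apply, ← Matrix.mulVec_mulVec, ← h, mulVec_transpose_cancel hM']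

/-- The signed coordinates determine the orbit. -/
lemma IsSignedFrame.sameOrbit {μ₁ μ₂ εd εs : ℝ} {M' : Matrix (Fin 4) (Fin 4) ℝ} {z' : Phase}
    (hm : ∀ i, 0 < m i) (hN : Nᵀ * N = 1) (hz : z ∈ level Λ) (hz' : z' ∈ level Λ)
    (hM : IsSignedFrame μ₁ μ₂ εd εs Λ N M w) (h : ReadsCoord m M z w)
    (hM' : IsSignedFrame μ₁ μ₂ εd εs Λ N M' w) (h' : ReadsCoord m M' z' w)
    (hA : area w ≠ 0) : SameOrbit Λ z z' := by
  have o : Mᵀ * M = 1 := hM.orth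
  have o' : M'ᵀ * M' = 1 := hM'.orth
  have o2 : M * Mᵀ = 1 := mul_eq_one_comm.mp o
  have o2' : M' * M'ᵀ = 1 := mul_eq_one_comm.mp o'
  have hn := hM.normalMomenta hm hz h
  have hn' := hM'.normalMomenta hm hz' h'
  have h2A : 2 * area w ≠ 0 := mul_ne_zero two_ne_zero hA
  -- The rotation carrying one frame to the other; it fixes `Λ` because `Λ` has the same matrix in
  -- both frames.
  refine sameOrbit_of_jacobi hm (R := M' * Mᵀ) hz.1 hz'.1 ?_ ?_ ?_ ?_ ?_ ?_
  · rw [Matrix.mem_specialOrthogonalGroup_iff, Matrix.mem_orthogonalGroup_iff]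
    constructor
    · rw [Matrix.transpose_mul, Matrix.transpose_transpose, Matrix.mul_assoc,
        ← Matrix.mul_assoc Mᵀ, o, Matrix.one_mul, o2']
    · have d1 := hM.det
      have d2 := hM'.det
      rw [Matrix.det_mul, Matrix.det_transpose] at d1 d2 ⊢
      -- `N` may reverse orientation; only the orientations of `M` and `M'` relative to `N` are
      -- known, and `det N` enters squared.
      have d3 : N.det * N.det = 1 := by
        rw [← Matrix.det_one (n := Fin 4) (R := ℝ), ← hN, Matrix.det_mul, Matrix.det_transpose]
      calc M'.det * M.det = (N.det * N.det) * (M'.det * M.det) := by rw [d3, one_mul]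
        _ = (N.det * M.det) * (N.det * M'.det) := by ring
        _ = 1 := by rw [d1, d2, one_mul]
  · rw [Matrix.transpose_mul, Matrix.transpose_transpose]
    calc M' * Mᵀ * Λ * (M * M'ᵀ) = M' * (Mᵀ * Λ * M) * M'ᵀ := by simp only [Matrix.mul_assoc]
      _ = M' * (M'ᵀ * Λ * M') * M'ᵀ := by rw [hM.form, hM'.form]
      _ = (M' * M'ᵀ) * Λ * (M' * M'ᵀ) := by simp only [Matrix.mul_assoc]
      _ = Λ := by rw [o2', Matrix.one_mul, Matrix.mul_one]
  · exact eq_act_of_frames o' (by rw [h.x₁, h'.x₁])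
  · exact eq_act_of_frames o' (by rw [h.x₂, h'.x₂])
  · refine eq_act_of_frames o' ?_
    rw [vec_eta (M'ᵀ *ᵥ _), vec_eta (Mᵀ *ᵥ _), h.y₁₀, h'.y₁₀, h.y₁₁, h'.y₁₁,
      mul_left_cancel₀ h2A (hn.y₁₂.trans hn'.y₁₂.symm),
      mul_left_cancel₀ h2A (hn.y₁₃.trans hn'.y₁₃.symm)]
  · refine eq_act_of_frames o' ?_
    rw [vec_eta (M'ᵀ *ᵥ _), vec_eta (Mᵀ *ᵥ _), h.y₂₀, h'.y₂₀, h.y₂₁, h'.y₂₁,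
      mul_left_cancel₀ h2A (hn.y₂₂.trans hn'.y₂₂.symm),
      mul_left_cancel₀ h2A (hn.y₂₃.trans hn'.y₂₃.symm)]

end ThreeBody

end

/-! ### Existence of body frames. -/

noncomputable section

namespace ThreeBody

variable {m : Fin 3 → ℝ} {Λ N M : Matrix (Fin 4) (Fin 4) ℝ} {c a b : ℝ} {z : Phase} {w : Coord}

lemma exists_orth_extension {e₁ e₂ : E4} (h1 : inner ℝ e₁ e₁ = 1) (h2 : inner ℝ e₂ e₂ = 1)
    (h12 : inner ℝ e₁ e₂ = 0) : ∃ M : Matrix (Fin 4) (Fin 4) ℝ, Mᵀ * M = 1 ∧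
      (∀ i, M i 0 = e₁ i) ∧ ∀ i, M i 1 = e₂ i := by
  obtain ⟨B, hB⟩ := Orthonormal.exists_orthonormalBasis_extension_of_card_eq (𝕜 := ℝ) (E := E4)
    (ι := Fin 4) (by simp) (v := ![e₁, e₂, 0, 0]) (s := {0, 1}) (by
      rw [orthonormal_iff_ite]
      rintro ⟨i, hi⟩ ⟨j, hj⟩
      simp only [Set.mem_insert_iff, Set.mem_singleton_iff] at hi hj
      rcases hi with rfl | rfl <;> rcases hj with rfl | rfl <;>
        simp only [Set.domRestrict_apply, Matrix.cons_val_zero, Matrix.cons_val_one, h1, h2, h12,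
          real_inner_comm e₁ e₂] <;> simp)
  refine ⟨Matrix.of fun i j => B j i, ?_, fun i => ?_, fun i => ?_⟩
  · ext i j
    have := orthonormal_iff_ite.mp B.orthonormal i j
    rw [E4.inner_eq] at this
    simp [Matrix.mul_apply, Fin.sum_univ_four, this, Matrix.one_apply]
  · simp [hB 0]
  · simp [hB 1]

lemma det_sq_of_orth (hM : Mᵀ * M = 1) : M.det = 1 ∨ M.det = -1 := by
  have : M.det * M.det = 1 := by
    rw [← Matrix.det_one (n := Fin 4) (R := ℝ), ← hM, Matrix.det_mul, Matrix.det_transpose]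
  exact mul_self_eq_one_iff.mp this

lemma act_inner_eq_sum (hM : Mᵀ * M = 1) (R : Matrix (Fin 4) (Fin 4) ℝ) (x : E4) :
    Mᵀ *ᵥ (act R x).ofLp = (Mᵀ * R * M) *ᵥ (Mᵀ *ᵥ x.ofLp) := by
  rw [ofLp_act, Matrix.mulVec_mulVec, Matrix.mulVec_mulVec, Matrix.mul_assoc (Mᵀ * R),
    mul_eq_one_comm.mp hM, Matrix.mul_one]

/-- The rows of the block are orthogonal, so a rotation aligning the first row with the second axis
puts the second row on the first axis. If the first row vanishes, the second one is aligned instead.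
-/
lemma exists_rotation_antidiag {k₁ k₂ l₁ l₂ : ℝ} (h : k₁ * l₁ + k₂ * l₂ = 0) :
    ∃ x y : ℝ, x ^ 2 + y ^ 2 = 1 ∧ k₁ * x - k₂ * y = 0 ∧ l₁ * y + l₂ * x = 0 := by
  by_cases hk : k₁ ^ 2 + k₂ ^ 2 = 0
  · have h1 : k₁ = 0 := by nlinarith
    have h2 : k₂ = 0 := by nlinarith
    by_cases hl : l₁ ^ 2 + l₂ ^ 2 = 0
    · have h3 : l₁ = 0 := by nlinarith
      have h4 : l₂ = 0 := by nlinarith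
      exact ⟨1, 0, by norm_num, by simp [h1], by simp [h4]⟩
    · have hp : 0 < l₁ ^ 2 + l₂ ^ 2 := lt_of_le_of_ne (by positivity) (Ne.symm hl)
      have hs := Real.sq_sqrt hp.le
      have hs0 := Real.sqrt_pos.mpr hp
      refine ⟨l₁ / √(l₁ ^ 2 + l₂ ^ 2), -l₂ / √(l₁ ^ 2 + l₂ ^ 2), ?_, by simp [h1, h2], ?_⟩
      · field_simp; linarith
      · field_simp; ring
  · have hp : 0 < k₁ ^ 2 + k₂ ^ 2 := lt_of_le_of_ne (by positivity) (Ne.symm hk)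
    have hs := Real.sq_sqrt hp.le
    have hs0 := Real.sqrt_pos.mpr hp
    refine ⟨k₂ / √(k₁ ^ 2 + k₂ ^ 2), k₁ / √(k₁ ^ 2 + k₂ ^ 2), ?_, ?_, ?_⟩
    · field_simp; linarith
    · field_simp; ring
    · field_simp; linarith

/-- The coordinates of a state with respect to two vectors in four-space. -/
def frameCoord (m : Fin 3 → ℝ) (e₁ e₂ : E4) (z : Phase) : Coord :=
  (![inner ℝ e₁ (jacobiX1 z), inner ℝ e₂ (jacobiX1 z), inner ℝ e₁ (jacobiX2 m z),
      inner ℝ e₂ (jacobiX2 m z)],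
   ![inner ℝ e₁ (jacobiY1 m z), inner ℝ e₂ (jacobiY1 m z), inner ℝ e₁ (jacobiY2 m z),
      inner ℝ e₂ (jacobiY2 m z)])

/-- The vectors `e₁`, `e₂` are orthonormal principal directions of `Λ` on the plane they span. -/
structure IsPrincipal (Λ : Matrix (Fin 4) (Fin 4) ℝ) (e₁ e₂ : E4) : Prop where
  one_one : inner ℝ e₁ e₁ = 1
  two_two : inner ℝ e₂ e₂ = 1
  one_two : inner ℝ e₁ e₂ = 0
  principal : inner ℝ (act Λ e₁) (act Λ e₂) = 0

/-- The vector `v` lies in the plane of the orthonormal vectors `e₁`, `e₂`. -/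
def InPlane (e₁ e₂ v : E4) : Prop := v = (inner ℝ e₁ v : ℝ) • e₁ + (inner ℝ e₂ v : ℝ) • e₂

/-- Rotation of the normal plane. -/
def normalRot (x y : ℝ) : Matrix (Fin 4) (Fin 4) ℝ := torusRot 1 0 x y

lemma normalRot_transpose_mulVec (x y : ℝ) (v : Fin 4 → ℝ) :
    (normalRot x y)ᵀ *ᵥ v = ![v 0, v 1, x * v 2 - y * v 3, y * v 2 + x * v 3] := by
  ext i; fin_cases i <;>
    simp [normalRot, torusRot, Matrix.mulVec, dotProduct, Fin.sum_univ_four]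
  ring

lemma vec_frame {e₁ e₂ : E4} (hM : Mᵀ * M = 1) (h1 : Mᵀ *ᵥ e₁.ofLp = ![1, 0, 0, 0])
    (h2 : Mᵀ *ᵥ e₂.ofLp = ![0, 1, 0, 0]) (v : E4) :
    (Mᵀ *ᵥ v.ofLp) 0 = inner ℝ e₁ v ∧ (Mᵀ *ᵥ v.ofLp) 1 = inner ℝ e₂ v := by
  rw [inner_eq_frame hM, inner_eq_frame hM, h1, h2]
  simp

lemma InPlane.vec_frame {e₁ e₂ v : E4} (hv : InPlane e₁ e₂ v)
    (h1 : Mᵀ *ᵥ e₁.ofLp = ![1, 0, 0, 0]) (h2 : Mᵀ *ᵥ e₂.ofLp = ![0, 1, 0, 0]) :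
    Mᵀ *ᵥ v.ofLp = ![inner ℝ e₁ v, inner ℝ e₂ v, 0, 0] := by
  have e : v.ofLp = (inner ℝ e₁ v : ℝ) • e₁.ofLp + (inner ℝ e₂ v : ℝ) • e₂.ofLp :=
    congrArg WithLp.ofLp hv
  rw [e, Matrix.mulVec_add, Matrix.mulVec_smul, Matrix.mulVec_smul, h1, h2]
  ext i; fin_cases i <;> simp

lemma readsCoord_frameCoord {e₁ e₂ : E4} (hM : Mᵀ * M = 1)
    (h1 : Mᵀ *ᵥ e₁.ofLp = ![1, 0, 0, 0]) (h2 : Mᵀ *ᵥ e₂.ofLp = ![0, 1, 0, 0])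
    (hx₁ : InPlane e₁ e₂ (jacobiX1 z)) (hx₂ : InPlane e₁ e₂ (jacobiX2 m z)) :
    ReadsCoord m M z (frameCoord m e₁ e₂ z) :=
  ⟨hx₁.vec_frame h1 h2, hx₂.vec_frame h1 h2, (vec_frame hM h1 h2 _).1, (vec_frame hM h1 h2 _).2,
    (vec_frame hM h1 h2 _).1, (vec_frame hM h1 h2 _).2⟩

lemma conj_skew (hskew : Λᵀ = -Λ) (M : Matrix (Fin 4) (Fin 4) ℝ) (i j : Fin 4) :
    (Mᵀ * Λ * M) i j = -(Mᵀ * Λ * M) j i := by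
  have : (Mᵀ * Λ * M)ᵀ = -(Mᵀ * Λ * M) := by
    rw [Matrix.transpose_mul, Matrix.transpose_mul, hskew, Matrix.transpose_transpose]
    simp [Matrix.mul_assoc]
  exact congrFun (congrFun this j) i

/-- Principal directions of the plane of the bodies extend to a body frame. -/
lemma IsPrincipal.exists_bodyFrame {e₁ e₂ : E4} (hm : ∀ i, 0 < m i) (hN : Nᵀ * N = 1)
    (hskew : Λᵀ = -Λ) (hz : z ∈ level Λ) (he : IsPrincipal Λ e₁ e₂)
    (hx₁ : InPlane e₁ e₂ (jacobiX1 z)) (hx₂ : InPlane e₁ e₂ (jacobiX2 m z)) :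
    ∃ M c a b, IsBodyFrame Λ N M c a b ∧ Mᵀ *ᵥ e₁.ofLp = ![1, 0, 0, 0] ∧
      Mᵀ *ᵥ e₂.ofLp = ![0, 1, 0, 0] := by
  obtain ⟨M, hM, hd, h1, h2⟩ : ∃ M : Matrix (Fin 4) (Fin 4) ℝ, Mᵀ * M = 1 ∧ (Nᵀ * M).det = 1 ∧
      Mᵀ *ᵥ e₁.ofLp = ![1, 0, 0, 0] ∧ Mᵀ *ᵥ e₂.ofLp = ![0, 1, 0, 0] := by
    obtain ⟨M, hM, hc1, hc2⟩ := exists_orth_extension he.one_one he.two_two he.one_two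
    have aux : ∀ v : E4, ∀ j, (∀ i, M i j = v i) → Mᵀ *ᵥ v.ofLp = Pi.single j 1 := by
      intro v j h
      have : v.ofLp = M *ᵥ Pi.single j 1 := by ext i; simp [h]
      rw [this, transpose_mulVec_cancel hM]
    have e1 : Mᵀ *ᵥ e₁.ofLp = ![1, 0, 0, 0] := by
      rw [aux e₁ 0 hc1]; ext i; fin_cases i <;> simp
    have e2 : Mᵀ *ᵥ e₂.ofLp = ![0, 1, 0, 0] := by
      rw [aux e₂ 1 hc2]; ext i; fin_cases i <;> simp
    rcases det_sq_of_orth (frame_relative_orth hN hM) with hd | hd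
    · exact ⟨M, hM, hd, e1, e2⟩
    -- Reflecting the last axis corrects the orientation without moving `e₁`, `e₂`.
    · let g : Matrix (Fin 4) (Fin 4) ℝ := !![1, 0, 0, 0; 0, 1, 0, 0; 0, 0, 1, 0; 0, 0, 0, -1]
      have hg : gᵀ * g = 1 := by
        ext i j; fin_cases i <;> fin_cases j <;> simp [g, Matrix.mul_apply, Fin.sum_univ_four]
      have hgd : g.det = -1 := by rw [det_four]; simp [g]
      refine ⟨M * g, ?_, ?_, ?_, ?_⟩
      · rw [Matrix.transpose_mul, Matrix.mul_assoc, ← Matrix.mul_assoc Mᵀ, hM, Matrix.one_mul, hg]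
      · rw [← Matrix.mul_assoc, Matrix.det_mul, hd, hgd]; norm_num
      · rw [Matrix.transpose_mul, ← Matrix.mulVec_mulVec, e1]
        ext i; fin_cases i <;> simp [g, Matrix.mulVec, dotProduct, Fin.sum_univ_four]
      · rw [Matrix.transpose_mul, ← Matrix.mulVec_mulVec, e2]
        ext i; fin_cases i <;> simp [g, Matrix.mulVec, dotProduct, Fin.sum_univ_four]
  have hsk := conj_skew hskew M
  -- Membership in the level set enters here: the entry between the normal vectors vanishes.
  have h23 := conj_level hm hz M 2 3
  rw [hx₁.vec_frame h1 h2, hx₂.vec_frame h1 h2] at h23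
  have hp := he.principal
  rw [inner_eq_frame hM, act_inner_eq_sum hM, act_inner_eq_sum hM, h1, h2] at hp
  generalize hL : Mᵀ * Λ * M = L at *
  simp [Matrix.mulVec, dotProduct, Fin.sum_univ_four] at hp h23
  have d0 : L 0 0 = 0 := by linarith [hsk 0 0]
  have d1 : L 1 1 = 0 := by linarith [hsk 1 1]
  have d2 : L 2 2 = 0 := by linarith [hsk 2 2]
  have d3 : L 3 3 = 0 := by linarith [hsk 3 3]
  -- With zero diagonal, orthogonality of `Λ e₁` and `Λ e₂` reduces to orthogonality of the rows of
  -- the block.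
  obtain ⟨x, y, hxy, k1, k2⟩ := exists_rotation_antidiag (k₁ := L 0 2) (k₂ := L 0 3)
    (l₁ := L 1 2) (l₂ := L 1 3) (by
      rw [hsk 2 0, hsk 3 0, hsk 2 1, hsk 3 1, d0, d1] at hp; linarith)
  refine ⟨M * normalRot x y, L 0 1, L 0 2 * y + L 0 3 * x, L 1 2 * x - L 1 3 * y,
    ⟨?_, ?_, ?_⟩, ?_, ?_⟩
  · rw [Matrix.transpose_mul, Matrix.mul_assoc, ← Matrix.mul_assoc Mᵀ, hM, Matrix.one_mul,
      normalRot, torusRot_transpose_mul (by norm_num) hxy]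
  · rw [← Matrix.mul_assoc, Matrix.det_mul, hd, normalRot, det_torusRot (by norm_num) hxy, one_mul]
  · have : (M * normalRot x y)ᵀ * Λ * (M * normalRot x y) =
        (normalRot x y)ᵀ * L * normalRot x y := by
      rw [← hL, Matrix.transpose_mul]; simp only [Matrix.mul_assoc]
    rw [this]
    have s10 := hsk 1 0
    have s20 := hsk 2 0
    have s30 := hsk 3 0
    have s21 := hsk 2 1
    have s31 := hsk 3 1
    have s32 := hsk 3 2
    rw [h23] at s32
    ext i j; fin_cases i <;> fin_cases j <;>
      simp [normalRot, torusRot, bodyForm, Matrix.mul_apply, Fin.sum_univ_four, d0, d1, d2, d3,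
        s10, s20, s30, s21, s31, s32, h23] <;> linarith
  · rw [Matrix.transpose_mul, ← Matrix.mulVec_mulVec, h1, normalRot_transpose_mulVec]; simp
  · rw [Matrix.transpose_mul, ← Matrix.mulVec_mulVec, h2, normalRot_transpose_mulVec]; simp

lemma IsBodyFrame.norm_act {e₁ e₂ : E4} (hM : IsBodyFrame Λ N M c a b)
    (h1 : Mᵀ *ᵥ e₁.ofLp = ![1, 0, 0, 0]) (h2 : Mᵀ *ᵥ e₂.ofLp = ![0, 1, 0, 0]) :
    ‖act Λ e₁‖ ^ 2 = c ^ 2 + a ^ 2 ∧ ‖act Λ e₂‖ ^ 2 = c ^ 2 + b ^ 2 ∧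
      inner ℝ (act Λ e₁) (act Λ e₂) = 0 := by
  rw [norm_sq_eq_frame hM.orth, norm_sq_eq_frame hM.orth, inner_eq_frame hM.orth,
    act_inner_eq_sum hM.orth, act_inner_eq_sum hM.orth, h1, h2, hM.form]
  simp [bodyForm, Matrix.mulVec, dotProduct, Fin.sum_univ_four]

/-- Principal directions in the right order give a signed frame. -/
lemma IsPrincipal.exists_signedFrame {μ₁ μ₂ εd εs : ℝ} {e₁ e₂ : E4} (hm : ∀ i, 0 < m i)
    (hN : Nᵀ * N = 1) (hNΛ : Nᵀ * Λ * N = normalForm μ₁ μ₂) (hμ : μ₂ < μ₁)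
    (hskew : Λᵀ = -Λ) (hεd : εd = 1 ∨ εd = -1) (hεs : εs = 1 ∨ εs = -1)
    (hz : z ∈ level Λ) (he : IsPrincipal Λ e₁ e₂)
    (hx₁ : InPlane e₁ e₂ (jacobiX1 z)) (hx₂ : InPlane e₁ e₂ (jacobiX2 m z))
    (hlt : 0 < εd * εs * (‖act Λ e₂‖ ^ 2 - ‖act Λ e₁‖ ^ 2)) :
    |L3 (frameCoord m e₁ e₂ z)| < μ₁ - μ₂ ∧
    ∃ M, IsSignedFrame μ₁ μ₂ εd εs Λ N M (frameCoord m e₁ e₂ z) ∧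
      ReadsCoord m M z (frameCoord m e₁ e₂ z) := by
  obtain ⟨M, c, a, b, hM, h1, h2⟩ := he.exists_bodyFrame (N := N) hm hN hskew hz hx₁ hx₂
  have h := readsCoord_frameCoord hM.orth h1 h2 hx₁ hx₂
  obtain ⟨n1, n2, -⟩ := hM.norm_act h1 h2
  rw [n1, n2] at hlt
  obtain ⟨i1, i2⟩ := hM.invariants hN hNΛ
  obtain ⟨rfl, -⟩ := hM.level_eqs hm hz h
  generalize frameCoord m e₁ e₂ z = w at *
  have hd : (b - a) ^ 2 = Ld μ₁ μ₂ εd w ^ 2 := by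
    rw [Ld, sign_mul_sqrt_sq hεd (by rw [← i1]; positivity), i1]
  have hs : (b + a) ^ 2 = Ls μ₁ μ₂ εs w ^ 2 := by
    rw [Ls, sign_mul_sqrt_sq hεs (by rw [← i2]; positivity), i2]
  have hne : b - a ≠ 0 := by
    intro h0
    have : b = a := by linarith
    rw [this] at hlt
    simp at hlt
  -- The order condition reads `εd εs (b - a)(b + a) > 0`, whereas `εd εs L_d L_s ≥ 0`. So `b - a`
  -- and `b + a` agree with `L_d` and `L_s` either both directly or both up to sign; the second case
  -- is repaired by `flipRot`.
  have hprod : 0 ≤ εd * εs * (Ld μ₁ μ₂ εd w * Ls μ₁ μ₂ εs w) := by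
    have e1 : εd * εd = 1 := by rcases hεd with rfl | rfl <;> norm_num
    have e2 : εs * εs = 1 := by rcases hεs with rfl | rfl <;> norm_num
    have : εd * εs * (Ld μ₁ μ₂ εd w * Ls μ₁ μ₂ εs w) =
      (εd * εd) * (εs * εs) * (√((μ₁ - μ₂) ^ 2 - L3 w ^ 2) * √((μ₁ + μ₂) ^ 2 - L3 w ^ 2)) := by
      rw [Ld, Ls]; ring
    rw [this, e1, e2]
    positivity
  refine ⟨?_, ?_⟩
  · have : 0 < (b - a) ^ 2 := by positivity
    exact abs_lt_of_sq_lt_sq (by linarith) (by linarith)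
  · rcases sq_eq_sq_iff_eq_or_eq_neg.mp hd with hd | hd <;>
      rcases sq_eq_sq_iff_eq_or_eq_neg.mp hs with hs | hs
    · refine ⟨M, ?_, h⟩
      rw [IsSignedFrame, ← hd, ← hs]
      convert hM using 1 <;> ring
    · exfalso
      rw [← hd, ← neg_eq_iff_eq_neg.mpr hs] at hprod
      linarith
    · exfalso
      rw [← hs, ← neg_eq_iff_eq_neg.mpr hd] at hprod
      linarith
    · refine ⟨M * flipRot, ?_, h.flip⟩
      rw [IsSignedFrame, ← neg_eq_iff_eq_neg.mpr hd, ← neg_eq_iff_eq_neg.mpr hs]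
      convert hM.flip using 1 <;> ring

/-! ### Principal directions -/

section Plane

variable (ξ η : E4)

/-- A multiple of the component of `η` orthogonal to `ξ`. -/
def orthPart : E4 := ‖ξ‖ ^ 2 • η - (inner ℝ ξ η : ℝ) • ξ

/-- The first Gram-Schmidt vector. -/
def gs₁ : E4 := ‖ξ‖⁻¹ • ξ

/-- The second Gram-Schmidt vector. -/
def gs₂ : E4 := ‖orthPart ξ η‖⁻¹ • orthPart ξ η

/-- The first vector of the Gram-Schmidt frame turned by the angle `φ`. -/
def turned₁ (φ : ℝ) : E4 := Real.cos φ • gs₁ ξ + Real.sin φ • gs₂ ξ η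

/-- The second vector of the Gram-Schmidt frame turned by the angle `φ`. -/
def turned₂ (φ : ℝ) : E4 := -Real.sin φ • gs₁ ξ + Real.cos φ • gs₂ ξ η

variable {ξ η}

lemma inner_orthPart : inner ℝ ξ (orthPart ξ η) = 0 := by
  simp only [orthPart, inner_sub_right, inner_smul_right, real_inner_self_eq_norm_sq]; ring

lemma gs_orthonormal (h : orthPart ξ η ≠ 0) : ξ ≠ 0 ∧ inner ℝ (gs₁ ξ) (gs₁ ξ) = 1 ∧
    inner ℝ (gs₂ ξ η) (gs₂ ξ η) = 1 ∧ inner ℝ (gs₁ ξ) (gs₂ ξ η) = 0 := by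
  have hξ : ξ ≠ 0 := by rintro rfl; simp [orthPart] at h
  have h1 : ‖ξ‖ ≠ 0 := norm_ne_zero_iff.mpr hξ
  have h2 : ‖orthPart ξ η‖ ≠ 0 := norm_ne_zero_iff.mpr h
  refine ⟨hξ, ?_, ?_, ?_⟩
  · rw [real_inner_self_eq_norm_sq, gs₁, norm_smul, norm_inv, norm_norm, inv_mul_cancel₀ h1,
      one_pow]
  · rw [real_inner_self_eq_norm_sq, gs₂, norm_smul, norm_inv, norm_norm, inv_mul_cancel₀ h2,
      one_pow]
  · simp only [gs₁, gs₂, real_inner_smul_left, real_inner_smul_right, inner_orthPart, mul_zero]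

lemma eq_gs (h : orthPart ξ η ≠ 0) : ξ = ‖ξ‖ • gs₁ ξ ∧
    η = (inner ℝ ξ η / ‖ξ‖) • gs₁ ξ + (‖orthPart ξ η‖ / ‖ξ‖ ^ 2) • gs₂ ξ η := by
  obtain ⟨hξ, -⟩ := gs_orthonormal h
  have h1 : ‖ξ‖ ≠ 0 := norm_ne_zero_iff.mpr hξ
  have h2 : ‖orthPart ξ η‖ ≠ 0 := norm_ne_zero_iff.mpr h
  constructor
  · rw [gs₁, smul_smul, mul_inv_cancel₀ h1, one_smul]
  · rw [gs₁, gs₂, smul_smul, smul_smul]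
    have e1 : ‖orthPart ξ η‖ / ‖ξ‖ ^ 2 * ‖orthPart ξ η‖⁻¹ = (‖ξ‖ ^ 2)⁻¹ := by field_simp
    have e2 : inner ℝ ξ η / ‖ξ‖ * ‖ξ‖⁻¹ = (‖ξ‖ ^ 2)⁻¹ * inner ℝ ξ η := by field_simp
    rw [e1, e2]
    have e3 : orthPart ξ η = ‖ξ‖ ^ 2 • η - (inner ℝ ξ η : ℝ) • ξ := rfl
    rw [e3, smul_sub, smul_smul, smul_smul, inv_mul_cancel₀ (by positivity), one_smul]
    abel

lemma turned_orthonormal (h : orthPart ξ η ≠ 0) (φ : ℝ) :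
    inner ℝ (turned₁ ξ η φ) (turned₁ ξ η φ) = 1 ∧
    inner ℝ (turned₂ ξ η φ) (turned₂ ξ η φ) = 1 ∧
    inner ℝ (turned₁ ξ η φ) (turned₂ ξ η φ) = 0 := by
  obtain ⟨-, h1, h2, h12⟩ := gs_orthonormal h
  have h21 : inner ℝ (gs₂ ξ η) (gs₁ ξ) = 0 := by rw [real_inner_comm]; exact h12
  have := Real.sin_sq_add_cos_sq φ
  simp only [turned₁, turned₂, inner_add_left, inner_add_right, real_inner_smul_left,
    real_inner_smul_right, h1, h2, h12, h21]
  refine ⟨by linarith, by linarith, by ring⟩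

lemma gs_eq_turned (ξ η : E4) (φ : ℝ) :
    gs₁ ξ = Real.cos φ • turned₁ ξ η φ - Real.sin φ • turned₂ ξ η φ ∧
    gs₂ ξ η = Real.sin φ • turned₁ ξ η φ + Real.cos φ • turned₂ ξ η φ := by
  have e := Real.cos_sq_add_sin_sq φ
  constructor
  · have : gs₁ ξ = (Real.cos φ ^ 2 + Real.sin φ ^ 2) • gs₁ ξ := by rw [e, one_smul]
    nth_rewrite 1 [this]
    rw [turned₁, turned₂]; module
  · have : gs₂ ξ η = (Real.cos φ ^ 2 + Real.sin φ ^ 2) • gs₂ ξ η := by rw [e, one_smul]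
    nth_rewrite 1 [this]
    rw [turned₁, turned₂]; module

lemma inPlane_of_eq {e₁ e₂ v : E4} (h1 : inner ℝ e₁ e₁ = 1) (h2 : inner ℝ e₂ e₂ = 1)
    (h12 : inner ℝ e₁ e₂ = 0) (s t : ℝ) (h : v = s • e₁ + t • e₂) : InPlane e₁ e₂ v := by
  have h21 : inner ℝ e₂ e₁ = 0 := by rw [real_inner_comm]; exact h12
  simp only [InPlane, h, inner_add_right, real_inner_smul_right, h1, h2, h12, h21]
  simp

lemma turned_coeffs (h : orthPart ξ η ≠ 0) (φ : ℝ) :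
    ξ = (‖ξ‖ * Real.cos φ) • turned₁ ξ η φ + (-‖ξ‖ * Real.sin φ) • turned₂ ξ η φ ∧
    η = (inner ℝ ξ η / ‖ξ‖ * Real.cos φ + ‖orthPart ξ η‖ / ‖ξ‖ ^ 2 * Real.sin φ) •
        turned₁ ξ η φ +
      (-(inner ℝ ξ η / ‖ξ‖) * Real.sin φ + ‖orthPart ξ η‖ / ‖ξ‖ ^ 2 * Real.cos φ) •
        turned₂ ξ η φ := by
  obtain ⟨h1, h2⟩ := eq_gs h
  obtain ⟨g1, g2⟩ := gs_eq_turned ξ η φ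
  constructor
  · nth_rewrite 1 [h1]
    rw [g1]; module
  · nth_rewrite 1 [h2]
    rw [g2]
    nth_rewrite 1 [g1]; module

/-- Twice the left side is `(C - A) sin 2φ + 2B cos 2φ`, which is zero when `(cos 2φ, sin 2φ)` is
proportional to `(C - A, -2B)`. -/
lemma exists_angle_diag (A B C : ℝ) : ∃ φ : ℝ,
    Real.cos φ * Real.sin φ * (C - A) + (Real.cos φ ^ 2 - Real.sin φ ^ 2) * B = 0 := by
  by_cases h : (C - A) ^ 2 + (2 * B) ^ 2 = 0
  · refine ⟨0, ?_⟩
    have : B = 0 := by nlinarith [sq_nonneg (C - A)]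
    simp [this]
  · have hp : 0 < (C - A) ^ 2 + (2 * B) ^ 2 := lt_of_le_of_ne (by positivity) (Ne.symm h)
    have hs := Real.sq_sqrt hp.le
    have hs0 := Real.sqrt_pos.mpr hp
    set r := √((C - A) ^ 2 + (2 * B) ^ 2)
    obtain ⟨θ, h1, h2⟩ := exists_angle (x := (C - A) / r) (y := -(2 * B) / r) (by
      field_simp; linarith)
    refine ⟨θ / 2, ?_⟩
    have e : θ = 2 * (θ / 2) := by ring
    rw [e, Real.cos_two_mul'] at h1
    rw [e, Real.sin_two_mul] at h2
    rw [h1]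
    have : Real.cos (θ / 2) * Real.sin (θ / 2) = -B / r := by
      field_simp at h2 ⊢; linarith
    rw [this]; field_simp; ring

lemma inner_act_turned (Λ : Matrix (Fin 4) (Fin 4) ℝ) (φ : ℝ) :
    inner ℝ (act Λ (turned₁ ξ η φ)) (act Λ (turned₂ ξ η φ)) =
      Real.cos φ * Real.sin φ * (‖act Λ (gs₂ ξ η)‖ ^ 2 - ‖act Λ (gs₁ ξ)‖ ^ 2) +
      (Real.cos φ ^ 2 - Real.sin φ ^ 2) * inner ℝ (act Λ (gs₁ ξ)) (act Λ (gs₂ ξ η)) := by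
  simp only [turned₁, turned₂, map_add, map_smul, inner_add_left, inner_add_right,
    real_inner_smul_left, real_inner_smul_right, real_inner_self_eq_norm_sq,
    real_inner_comm (act Λ (gs₁ ξ)) (act Λ (gs₂ ξ η))]
  ring

lemma orthPart_ne_zero (h : LinearIndependent ℝ ![ξ, η]) : orthPart ξ η ≠ 0 := by
  rw [LinearIndependent.pair_iff] at h
  intro h0
  have := (h (-inner ℝ ξ η) (‖ξ‖ ^ 2) (by rw [← h0, orthPart]; module)).2
  have hξ : ξ = 0 := by simpa using this
  have := (h 1 0 (by simp [hξ])).1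
  norm_num at this

lemma exists_principal (Λ : Matrix (Fin 4) (Fin 4) ℝ) (h : LinearIndependent ℝ ![ξ, η]) :
    ∃ e₁ e₂, IsPrincipal Λ e₁ e₂ ∧ InPlane e₁ e₂ ξ ∧ InPlane e₁ e₂ η := by
  have h0 := orthPart_ne_zero h
  obtain ⟨φ, hφ⟩ := exists_angle_diag (‖act Λ (gs₁ ξ)‖ ^ 2)
    (inner ℝ (act Λ (gs₁ ξ)) (act Λ (gs₂ ξ η))) (‖act Λ (gs₂ ξ η)‖ ^ 2)
  obtain ⟨h1, h2, h12⟩ := turned_orthonormal h0 φ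
  obtain ⟨k1, k2⟩ := turned_coeffs h0 φ
  exact ⟨turned₁ ξ η φ, turned₂ ξ η φ, ⟨h1, h2, h12, by rw [inner_act_turned, hφ]⟩,
    inPlane_of_eq h1 h2 h12 _ _ k1, inPlane_of_eq h1 h2 h12 _ _ k2⟩

end Plane

/-- If the area were zero, `q₄ x₁ - q₂ x₂` and `q₁ x₂ - q₃ x₁` would vanish; independence then gives
`q₁ = q₂ = 0`, hence `x₁ = 0`, a contradiction. -/
lemma area_frameCoord_ne_zero {e₁ e₂ : E4} (h : LinearIndependent ℝ ![jacobiX1 z, jacobiX2 m z])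
    (hx₁ : InPlane e₁ e₂ (jacobiX1 z)) (hx₂ : InPlane e₁ e₂ (jacobiX2 m z)) :
    area (frameCoord m e₁ e₂ z) ≠ 0 := by
  rw [LinearIndependent.pair_iff] at h
  intro h0
  simp only [area, frameCoord, Matrix.cons_val] at h0
  rw [div_eq_zero_iff, or_iff_left two_ne_zero] at h0
  rw [InPlane] at hx₁ hx₂
  generalize inner ℝ e₁ (jacobiX1 z) = q₁ at *
  generalize inner ℝ e₂ (jacobiX1 z) = q₂ at *
  generalize inner ℝ e₁ (jacobiX2 m z) = q₃ at *
  generalize inner ℝ e₂ (jacobiX2 m z) = q₄ at *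
  rw [hx₁, hx₂] at h
  obtain ⟨-, k2⟩ := h q₄ (-q₂) (by
    calc _ = (q₁ * q₄ - q₂ * q₃) • e₁ := by module
      _ = 0 := by rw [h0, zero_smul])
  obtain ⟨-, k4⟩ := h (-q₃) q₁ (by
    calc _ = (q₁ * q₄ - q₂ * q₃) • e₂ := by module
      _ = 0 := by rw [h0, zero_smul])
  have := (h 1 0 (by rw [k4, neg_eq_zero.mp k2]; simp)).1
  norm_num at this

/-- Every state of the level set that spans a plane has coordinates. -/
theorem exists_coord {μ₁ μ₂ εd εs : ℝ} (hm : ∀ i, 0 < m i) (W : ℝ × ℝ × ℝ → ℝ)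
    (hμ₂ : 0 ≤ μ₂) (hμ : μ₂ < μ₁) (hskew : Λᵀ = -Λ) (hN : Nᵀ * N = 1)
    (hNΛ : Nᵀ * Λ * N = normalForm μ₁ μ₂) (hεd : εd = 1 ∨ εd = -1) (hεs : εs = 1 ∨ εs = -1)
    (hz : z ∈ level Λ) (h : LinearIndependent ℝ ![jacobiX1 z, jacobiX2 m z]) :
    ∃ w, HasCoord m N z w ∧ area w ≠ 0 ∧ |L3 w| ≤ μ₁ - μ₂ ∧
      hamiltonian m W z = reducedHamiltonian m W μ₁ μ₂ εd εs w := by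
  obtain ⟨e₁, e₂, he, hx₁, hx₂⟩ := exists_principal Λ h
  obtain ⟨M, c, a, b, hM, h1, h2⟩ := he.exists_bodyFrame (N := N) hm hN hskew hz hx₁ hx₂
  have hA := area_frameCoord_ne_zero h hx₁ hx₂
  obtain ⟨M', w', hM', h', -, hA'⟩ := hM.exists_signed hm hN hNΛ hεd hεs hz
    (readsCoord_frameCoord hM.orth h1 h2 hx₁ hx₂)
  rw [← hA'] at hA
  refine ⟨w', IsBodyFrame.hasCoord hμ₂ hμ hN hNΛ hM' h', hA, ?_, hM'.energy hm W hz h' hA⟩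
  -- The bound is the nonnegativity of `(b - a)² = (μ₁ - μ₂)² - L₃²`.
  have := (IsBodyFrame.invariants hN hNΛ hM').1
  exact abs_le_of_sq_le_sq (by nlinarith [sq_nonneg ((Ls μ₁ μ₂ εs w' + Ld μ₁ μ₂ εd w') / 2 -
    (Ls μ₁ μ₂ εs w' - Ld μ₁ μ₂ εd w') / 2)]) (by linarith)

end ThreeBody

end

/-! ### Normal form of skew-symmetric matrices. -/

noncomputable section

namespace ThreeBody

variable {Λ : Matrix (Fin 4) (Fin 4) ℝ}

lemma inner_act_skew (hskew : Λᵀ = -Λ) (x y : E4) : inner ℝ (act Λ x) y = -inner ℝ x (act Λ y) := by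
  have h := fun i j => congrFun (congrFun hskew i) j
  simp only [Matrix.transpose_apply, Matrix.neg_apply] at h
  simp only [E4.inner_eq, ofLp_act, Matrix.mulVec, dotProduct, Fin.sum_univ_four]
  rw [h 0 1, h 0 2, h 0 3, h 1 2, h 1 3, h 2 3]
  linear_combination x 0 * y 0 * h 0 0 + x 1 * y 1 * h 1 1 + x 2 * y 2 * h 2 2 + x 3 * y 3 * h 3 3

open Polynomial in
-- The factor of the characteristic polynomial provides a complex eigenvector for `iμ`. Its real and
-- imaginary parts span an invariant plane, and skewness makes them orthogonal and of equal length.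
lemma exists_rotation_plane (hskew : Λᵀ = -Λ) {μ : ℝ} (hμ : μ ≠ 0) {f : ℝ[X]}
    (hΛ : Λ.charpoly = (X ^ 2 + C (μ ^ 2)) * f) : ∃ e₁ e₂ : E4, inner ℝ e₁ e₁ = 1 ∧
      inner ℝ e₂ e₂ = 1 ∧ inner ℝ e₁ e₂ = 0 ∧ act Λ e₁ = -μ • e₂ ∧ act Λ e₂ = μ • e₁ := by
  set A : Matrix (Fin 4) (Fin 4) ℂ := Λ.map (algebraMap ℝ ℂ) with hA
  have hroot : (A.charpoly).eval (Complex.I * μ) = 0 := by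
    rw [hA, Matrix.charpoly_map, hΛ]
    simp [mul_pow]
  rw [Matrix.eval_charpoly, ← Matrix.exists_mulVec_eq_zero_iff] at hroot
  obtain ⟨v, hv0, hv⟩ := hroot
  rw [Matrix.sub_mulVec, sub_eq_zero] at hv
  let u : E4 := WithLp.toLp 2 fun k => (v k).re
  let t : E4 := WithLp.toLp 2 fun k => (v k).im
  have hk : ∀ k, Complex.I * μ * v k = ∑ j, (Λ k j : ℂ) * v j := by
    intro k
    have := congrFun hv k
    simpa [Matrix.mulVec, dotProduct, hA, Matrix.diagonal_apply, ite_mul] using this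
  have hu : act Λ u = -μ • t := by
    ext k
    have := congrArg Complex.re (hk k)
    simp [u, t, Matrix.mulVec, dotProduct] at this ⊢
    linarith
  have ht : act Λ t = μ • u := by
    ext k
    have := congrArg Complex.im (hk k)
    simp [u, t, Matrix.mulVec, dotProduct] at this ⊢
    linarith
  have hut : inner ℝ u t = 0 := by
    have := inner_act_skew hskew u u
    rw [hu, inner_smul_left, inner_smul_right, real_inner_comm] at this
    simp only [conj_trivial] at this
    have h2 : μ * inner ℝ u t = 0 := by linarith
    exact (mul_eq_zero.mp h2).resolve_left hμ
  have hnorm : inner ℝ t t = inner ℝ u u := by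
    have := inner_act_skew hskew u t
    rw [hu, ht, inner_smul_left, inner_smul_right] at this
    simp only [conj_trivial] at this
    exact mul_left_cancel₀ hμ (by linarith)
  have hu0 : u ≠ 0 := by
    intro h0
    have ht0 : t = 0 := by rw [h0, inner_zero_left, inner_self_eq_zero] at hnorm; exact hnorm
    apply hv0
    ext k
    exact Complex.ext (congrArg (fun x : E4 => x k) h0) (congrArg (fun x : E4 => x k) ht0)
  have hn : ‖u‖ ≠ 0 := norm_ne_zero_iff.mpr hu0
  rw [real_inner_self_eq_norm_sq u] at hnorm
  refine ⟨‖u‖⁻¹ • u, ‖u‖⁻¹ • t, ?_, ?_, ?_, ?_, ?_⟩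
  · rw [inner_smul_left, inner_smul_right, real_inner_self_eq_norm_sq, conj_trivial]; field
  · rw [inner_smul_left, inner_smul_right, hnorm, conj_trivial]; field
  · rw [inner_smul_left, inner_smul_right, hut]; simp
  · rw [map_smul, hu, smul_comm]
  · rw [map_smul, ht, smul_comm]

open Polynomial in
/-- Normal form of a skew-symmetric matrix under orthogonal conjugation. -/
theorem exists_normalForm (hskew : Λᵀ = -Λ) {μ₁ μ₂ : ℝ} (hμ₁ : μ₁ ≠ 0)
    (hΛ : Λ.charpoly = (X ^ 2 + C (μ₁ ^ 2)) * (X ^ 2 + C (μ₂ ^ 2))) :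
    ∃ N : Matrix (Fin 4) (Fin 4) ℝ, Nᵀ * N = 1 ∧ Nᵀ * Λ * N = normalForm μ₁ μ₂ := by
  obtain ⟨e₁, e₂, h1, h2, h12, k1, k2⟩ := exists_rotation_plane hskew hμ₁ hΛ
  obtain ⟨M, hM, c1, c2⟩ := exists_orth_extension h1 h2 h12
  have hsk := conj_skew hskew M
  have hcol : ∀ v : E4, ∀ j, (∀ i, M i j = v i) → Mᵀ *ᵥ v.ofLp = Pi.single j 1 := by
    intro v j h
    have : v.ofLp = M *ᵥ Pi.single j 1 := by ext i; simp [h]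
    rw [this, transpose_mulVec_cancel hM]
  have b1 := hcol e₁ 0 c1
  have b2 := hcol e₂ 1 c2
  have l1 := act_inner_eq_sum hM Λ e₁
  have l2 := act_inner_eq_sum hM Λ e₂
  rw [k1, b1, WithLp.ofLp_smul, Matrix.mulVec_smul, b2, Matrix.mulVec_single_one] at l1
  rw [k2, b2, WithLp.ofLp_smul, Matrix.mulVec_smul, b1, Matrix.mulVec_single_one] at l2
  -- The determinant is the constant term of the characteristic polynomial; on the complement of the
  -- first plane it determines the remaining entry up to sign.
  have hdet : (Mᵀ * Λ * M).det = μ₁ ^ 2 * μ₂ ^ 2 := by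
    have e : Λ.charpoly.eval 0 = Λ.det := by
      rw [Matrix.eval_charpoly]
      simp [Matrix.det_neg, show ((-1 : ℝ)) ^ 4 = 1 by norm_num]
    have d : M.det * M.det = 1 := by
      rw [← Matrix.det_one (n := Fin 4) (R := ℝ), ← hM, Matrix.det_mul, Matrix.det_transpose]
    rw [Matrix.det_mul, Matrix.det_mul, Matrix.det_transpose, ← e, hΛ]
    simp only [eval_mul, eval_add, eval_pow, eval_X, eval_C]
    linear_combination μ₁ ^ 2 * μ₂ ^ 2 * d
  generalize hL : Mᵀ * Λ * M = L at *
  have l1' := fun i => congrFun l1 i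
  have l2' := fun i => congrFun l2 i
  have L00 := l1' 0
  have L10 := l1' 1
  have L20 := l1' 2
  have L30 := l1' 3
  have L01 := l2' 0
  have L11 := l2' 1
  have L21 := l2' 2
  have L31 := l2' 3
  simp at L00 L10 L20 L30 L01 L11 L21 L31
  have L22 : L 2 2 = 0 := by linarith [hsk 2 2]
  have L33 : L 3 3 = 0 := by linarith [hsk 3 3]
  have L02 : L 0 2 = 0 := by rw [hsk, ← L20, neg_zero]
  have L03 : L 0 3 = 0 := by rw [hsk, ← L30, neg_zero]
  have L12 : L 1 2 = 0 := by rw [hsk, ← L21, neg_zero]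
  have L13 : L 1 3 = 0 := by rw [hsk, ← L31, neg_zero]
  have L32 : L 3 2 = -L 2 3 := hsk 3 2
  have hform : L = normalForm μ₁ (L 2 3) := by
    rw [normalForm_eq]
    ext i j; fin_cases i <;> fin_cases j <;>
      simp [← L00, ← L10, ← L20, ← L30, ← L01, ← L11, ← L21, ← L31, L22, L33, L02, L03, L12, L13,
        L32]
  have hν : L 2 3 ^ 2 = μ₂ ^ 2 := by
    rw [hform, det_four, normalForm_eq] at hdet
    simp at hdet
    have : μ₁ ^ 2 ≠ 0 := by positivity
    exact mul_left_cancel₀ this (by linarith)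
  rcases sq_eq_sq_iff_eq_or_eq_neg.mp hν with h | h
  · exact ⟨M, hM, by rw [hL, hform, h]⟩
  -- A reflection of the last axis repairs the sign of `μ₂`; `N` is only required to be orthogonal.
  · let g : Matrix (Fin 4) (Fin 4) ℝ := !![1, 0, 0, 0; 0, 1, 0, 0; 0, 0, 1, 0; 0, 0, 0, -1]
    refine ⟨M * g, ?_, ?_⟩
    · rw [Matrix.transpose_mul, Matrix.mul_assoc, ← Matrix.mul_assoc Mᵀ, hM, Matrix.one_mul]
      ext i j; fin_cases i <;> fin_cases j <;> simp [g, Matrix.mul_apply, Fin.sum_univ_four]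
    · have : (M * g)ᵀ * Λ * (M * g) = gᵀ * L * g := by
        rw [← hL, Matrix.transpose_mul]; simp only [Matrix.mul_assoc]
      rw [this, hform, h, normalForm_eq, normalForm_eq]
      ext i j; fin_cases i <;> fin_cases j <;> simp [g, Matrix.mul_apply, Fin.sum_univ_four]

end ThreeBody

end

/-! ### A smooth equivariant choice of principal directions. -/

noncomputable section

namespace ThreeBody

variable {Λ : Matrix (Fin 4) (Fin 4) ℝ} {ξ η e₁ e₂ : E4} {ε : ℝ}

/-- The angle from the Gram-Schmidt frame of `ξ`, `η` to the principal directions. -/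
def turnAngle (Λ : Matrix (Fin 4) (Fin 4) ℝ) (ξ η : E4) : ℝ :=
  Real.arctan (-(2 * inner ℝ (act Λ (gs₁ ξ)) (act Λ (gs₂ ξ η))) /
    (‖act Λ (gs₂ ξ η)‖ ^ 2 - ‖act Λ (gs₁ ξ)‖ ^ 2)) / 2

/-- The first principal direction near `ξ`. -/
def prin₁ (Λ : Matrix (Fin 4) (Fin 4) ℝ) (ξ η : E4) : E4 := turned₁ ξ η (turnAngle Λ ξ η)

/-- The second principal direction. -/
def prin₂ (Λ : Matrix (Fin 4) (Fin 4) ℝ) (ξ η : E4) : E4 := turned₂ ξ η (turnAngle Λ ξ η)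

/-- Up to a positive factor, the difference of the values of `‖Λ ·‖²` on the two vectors of the
Gram-Schmidt frame of `ξ`, `η`. -/
def gap (Λ : Matrix (Fin 4) (Fin 4) ℝ) (ξ η : E4) : ℝ :=
  ‖ξ‖ ^ 2 * ‖act Λ (orthPart ξ η)‖ ^ 2 - ‖orthPart ξ η‖ ^ 2 * ‖act Λ ξ‖ ^ 2

/-- A vanishing `orthPart` annihilates both terms of `gap`. Thus the sign condition, which involves
no division, already contains the independence of `ξ` and `η`. -/
lemma orthPart_ne_zero_of_gap (h : 0 < ε * gap Λ ξ η) : orthPart ξ η ≠ 0 := by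
  intro h0
  simp [gap, h0] at h

lemma gap_eq (h : orthPart ξ η ≠ 0) : gap Λ ξ η = ‖ξ‖ ^ 2 * ‖orthPart ξ η‖ ^ 2 *
    (‖act Λ (gs₂ ξ η)‖ ^ 2 - ‖act Λ (gs₁ ξ)‖ ^ 2) := by
  obtain ⟨hξ, -⟩ := gs_orthonormal h
  have h1 : ‖ξ‖ ≠ 0 := norm_ne_zero_iff.mpr hξ
  have h2 : ‖orthPart ξ η‖ ≠ 0 := norm_ne_zero_iff.mpr h
  rw [gap, gs₁, gs₂, map_smul, map_smul, norm_smul, norm_smul, norm_inv, norm_inv, norm_norm,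
    norm_norm]
  field_simp

lemma gs_gap_pos (h : 0 < ε * gap Λ ξ η) :
    0 < ε * (‖act Λ (gs₂ ξ η)‖ ^ 2 - ‖act Λ (gs₁ ξ)‖ ^ 2) := by
  have h0 := orthPart_ne_zero_of_gap h
  obtain ⟨hξ, -⟩ := gs_orthonormal h0
  have h1 : 0 < ‖ξ‖ := norm_pos_iff.mpr hξ
  have h2 : 0 < ‖orthPart ξ η‖ := norm_pos_iff.mpr h0
  rw [gap_eq h0] at h
  have : 0 < ‖ξ‖ ^ 2 * ‖orthPart ξ η‖ ^ 2 := by positivity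
  by_contra! hn
  nlinarith

/-- Half an arctangent lies strictly between `-π/4` and `π/4`. Positivity keeps the first direction
within a right angle of `ξ`, which later fixes its sign. -/
lemma cos_turnAngle_pos (Λ : Matrix (Fin 4) (Fin 4) ℝ) (ξ η : E4) :
    0 < Real.cos (turnAngle Λ ξ η) := by
  have h1 := Real.arctan_lt_pi_div_two (-(2 * inner ℝ (act Λ (gs₁ ξ)) (act Λ (gs₂ ξ η))) /
    (‖act Λ (gs₂ ξ η)‖ ^ 2 - ‖act Λ (gs₁ ξ)‖ ^ 2))
  have h2 := Real.neg_pi_div_two_lt_arctan (-(2 * inner ℝ (act Λ (gs₁ ξ)) (act Λ (gs₂ ξ η))) /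
    (‖act Λ (gs₂ ξ η)‖ ^ 2 - ‖act Λ (gs₁ ξ)‖ ^ 2))
  have := Real.pi_pos
  exact Real.cos_pos_of_mem_Ioo ⟨by rw [turnAngle]; linarith, by rw [turnAngle]; linarith⟩

lemma turnAngle_spec (h : ‖act Λ (gs₂ ξ η)‖ ^ 2 - ‖act Λ (gs₁ ξ)‖ ^ 2 ≠ 0) :
    0 < Real.cos (2 * turnAngle Λ ξ η) ∧
    (‖act Λ (gs₂ ξ η)‖ ^ 2 - ‖act Λ (gs₁ ξ)‖ ^ 2) * Real.sin (2 * turnAngle Λ ξ η) =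
      -(2 * inner ℝ (act Λ (gs₁ ξ)) (act Λ (gs₂ ξ η))) * Real.cos (2 * turnAngle Λ ξ η) := by
  set τ := -(2 * inner ℝ (act Λ (gs₁ ξ)) (act Λ (gs₂ ξ η))) /
    (‖act Λ (gs₂ ξ η)‖ ^ 2 - ‖act Λ (gs₁ ξ)‖ ^ 2) with hτ
  have e : 2 * turnAngle Λ ξ η = Real.arctan τ := by rw [turnAngle]; ring
  have hc : 0 < Real.cos (Real.arctan τ) := Real.cos_arctan_pos τ
  have ht : Real.sin (Real.arctan τ) = τ * Real.cos (Real.arctan τ) := by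
    have := Real.tan_arctan τ
    rw [Real.tan_eq_sin_div_cos, div_eq_iff hc.ne'] at this
    exact this
  rw [e]
  refine ⟨hc, ?_⟩
  rw [ht, hτ]
  field_simp

lemma norm_act_turned (Λ : Matrix (Fin 4) (Fin 4) ℝ) (φ : ℝ) :
    ‖act Λ (turned₂ ξ η φ)‖ ^ 2 - ‖act Λ (turned₁ ξ η φ)‖ ^ 2 =
      (‖act Λ (gs₂ ξ η)‖ ^ 2 - ‖act Λ (gs₁ ξ)‖ ^ 2) * Real.cos (2 * φ) -
      2 * inner ℝ (act Λ (gs₁ ξ)) (act Λ (gs₂ ξ η)) * Real.sin (2 * φ) := by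
  simp only [← real_inner_self_eq_norm_sq, turned₁, turned₂, map_add, map_smul, inner_add_left,
    inner_add_right, real_inner_smul_left, real_inner_smul_right,
    real_inner_comm (act Λ (gs₁ ξ)) (act Λ (gs₂ ξ η)), Real.cos_two_mul', Real.sin_two_mul]
  ring

lemma isPrincipal_prin (h : 0 < ε * gap Λ ξ η) : IsPrincipal Λ (prin₁ Λ ξ η) (prin₂ Λ ξ η) := by
  have h0 := orthPart_ne_zero_of_gap h
  obtain ⟨h1, h2, h12⟩ := turned_orthonormal h0 (turnAngle Λ ξ η)
  refine ⟨h1, h2, h12, ?_⟩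
  obtain ⟨-, hs⟩ := turnAngle_spec (right_ne_zero_of_mul (gs_gap_pos h).ne')
  rw [prin₁, prin₂, inner_act_turned]
  rw [Real.cos_two_mul', Real.sin_two_mul] at hs
  linear_combination hs / 2

/-- With `d` the difference of the values of `‖Λ ·‖²` before turning, the difference after turning,
multiplied by `cos 2φ`, is `d (cos² 2φ + sin² 2φ)`. Since `cos 2φ > 0`, the order of the values is
preserved. -/
lemma prin_order (h : 0 < ε * gap Λ ξ η) :
    0 < ε * (‖act Λ (prin₂ Λ ξ η)‖ ^ 2 - ‖act Λ (prin₁ Λ ξ η)‖ ^ 2) := by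
  have hg := gs_gap_pos h
  have hne := right_ne_zero_of_mul hg.ne'
  obtain ⟨hc, hs⟩ := turnAngle_spec hne
  rw [prin₁, prin₂, norm_act_turned]
  set d := ‖act Λ (gs₂ ξ η)‖ ^ 2 - ‖act Λ (gs₁ ξ)‖ ^ 2
  set B := inner ℝ (act Λ (gs₁ ξ)) (act Λ (gs₂ ξ η))
  set C := Real.cos (2 * turnAngle Λ ξ η)
  set S := Real.sin (2 * turnAngle Λ ξ η)
  have key : (ε * (d * C - 2 * B * S)) * C = (ε * d) * (C ^ 2 + S ^ 2) := by
    linear_combination -ε * S * hs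
  have : 0 < (ε * (d * C - 2 * B * S)) * C := by rw [key]; positivity
  exact pos_of_mul_pos_left this hc.le

lemma InPlane.comb {v w : E4} (hv : InPlane e₁ e₂ v) (hw : InPlane e₁ e₂ w) (s t : ℝ) :
    InPlane e₁ e₂ (s • v + t • w) := by
  rw [InPlane] at *
  nth_rewrite 1 [hv, hw]
  simp only [inner_add_right, real_inner_smul_right]
  module

/-- In the Gram-Schmidt frame `ξ` is a positive multiple of the first vector, and `η` has a positive
second component. Turning multiplies the first component of `ξ` by `cos φ > 0` and preserves the
determinant. -/
lemma prin_coeffs (h : 0 < ε * gap Λ ξ η) : InPlane (prin₁ Λ ξ η) (prin₂ Λ ξ η) ξ ∧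
    InPlane (prin₁ Λ ξ η) (prin₂ Λ ξ η) η ∧ 0 < inner ℝ (prin₁ Λ ξ η) ξ ∧
    0 < inner ℝ (prin₁ Λ ξ η) ξ * inner ℝ (prin₂ Λ ξ η) η -
      inner ℝ (prin₂ Λ ξ η) ξ * inner ℝ (prin₁ Λ ξ η) η := by
  have h0 := orthPart_ne_zero_of_gap h
  have hp := isPrincipal_prin h
  obtain ⟨k1, k2⟩ := turned_coeffs h0 (turnAngle Λ ξ η)
  have hc := cos_turnAngle_pos Λ ξ η
  have hcs := Real.cos_sq_add_sin_sq (turnAngle Λ ξ η)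
  have hn : 0 < ‖ξ‖ := norm_pos_iff.mpr (gs_orthonormal h0).1
  have hn' : 0 < ‖orthPart ξ η‖ := norm_pos_iff.mpr h0
  rw [← prin₁, ← prin₂] at k1 k2
  have h21 : inner ℝ (prin₂ Λ ξ η) (prin₁ Λ ξ η) = 0 := by rw [real_inner_comm]; exact hp.one_two
  generalize turnAngle Λ ξ η = φ at *
  have i11 : inner ℝ (prin₁ Λ ξ η) ξ = ‖ξ‖ * Real.cos φ := by
    nth_rewrite 2 [k1]
    rw [inner_add_right, inner_smul_right, inner_smul_right, hp.one_one, hp.one_two]; ring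
  have i21 : inner ℝ (prin₂ Λ ξ η) ξ = -‖ξ‖ * Real.sin φ := by
    nth_rewrite 2 [k1]
    rw [inner_add_right, inner_smul_right, inner_smul_right, h21, hp.two_two]; ring
  have i12 : inner ℝ (prin₁ Λ ξ η) η =
      inner ℝ ξ η / ‖ξ‖ * Real.cos φ + ‖orthPart ξ η‖ / ‖ξ‖ ^ 2 * Real.sin φ := by
    nth_rewrite 2 [k2]
    rw [inner_add_right, inner_smul_right, inner_smul_right, hp.one_one, hp.one_two]; ring
  have i22 : inner ℝ (prin₂ Λ ξ η) η =
      -(inner ℝ ξ η / ‖ξ‖) * Real.sin φ + ‖orthPart ξ η‖ / ‖ξ‖ ^ 2 * Real.cos φ := by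
    nth_rewrite 2 [k2]
    rw [inner_add_right, inner_smul_right, inner_smul_right, h21, hp.two_two]; ring
  refine ⟨inPlane_of_eq hp.one_one hp.two_two hp.one_two _ _ k1,
    inPlane_of_eq hp.one_one hp.two_two hp.one_two _ _ k2, by rw [i11]; positivity, ?_⟩
  have : inner ℝ (prin₁ Λ ξ η) ξ * inner ℝ (prin₂ Λ ξ η) η -
      inner ℝ (prin₂ Λ ξ η) ξ * inner ℝ (prin₁ Λ ξ η) η =
      ‖orthPart ξ η‖ / ‖ξ‖ * (Real.cos φ ^ 2 + Real.sin φ ^ 2) := by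
    rw [i11, i21, i12, i22]; field_simp; ring
  rw [this, hcs]
  positivity

/-- The constructed directions are combinations of `ξ` and `η`; for uniqueness they are expanded in
the competing pair `e₁`, `e₂`. -/
lemma InPlane.prin (h1 : InPlane e₁ e₂ ξ) (h2 : InPlane e₁ e₂ η) :
    InPlane e₁ e₂ (prin₁ Λ ξ η) ∧ InPlane e₁ e₂ (prin₂ Λ ξ η) := by
  have ho : InPlane e₁ e₂ (orthPart ξ η) := by
    have := h2.comb h1 (‖ξ‖ ^ 2) (-inner ℝ ξ η)
    rwa [neg_smul, ← sub_eq_add_neg] at this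
  have g1 : InPlane e₁ e₂ (gs₁ ξ) := by
    have := h1.comb h1 ‖ξ‖⁻¹ 0
    rwa [zero_smul, add_zero] at this
  have g2 : InPlane e₁ e₂ (gs₂ ξ η) := by
    have := ho.comb ho ‖orthPart ξ η‖⁻¹ 0
    rwa [zero_smul, add_zero] at this
  exact ⟨g1.comb g2 _ _, g1.comb g2 _ _⟩

/-- Uniqueness of the principal directions. -/
lemma prin_unique (h : 0 < ε * gap Λ ξ η) (he : IsPrincipal Λ e₁ e₂)
    (ho : 0 < ε * (‖act Λ e₂‖ ^ 2 - ‖act Λ e₁‖ ^ 2))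
    (h1 : InPlane e₁ e₂ ξ) (h2 : InPlane e₁ e₂ η) (hpos : 0 < inner ℝ e₁ ξ)
    (hdet : 0 < inner ℝ e₁ ξ * inner ℝ e₂ η - inner ℝ e₂ ξ * inner ℝ e₁ η) :
    prin₁ Λ ξ η = e₁ ∧ prin₂ Λ ξ η = e₂ := by
  obtain ⟨p1, p2⟩ := InPlane.prin (Λ := Λ) h1 h2
  obtain ⟨-, -, c1, c2⟩ := prin_coeffs h
  have o := prin_order h
  obtain ⟨q1, q2, q12, q⟩ := isPrincipal_prin h
  generalize prin₁ Λ ξ η = f₁ at *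
  generalize prin₂ Λ ξ η = f₂ at *
  have h21 : inner ℝ e₂ e₁ = 0 := by rw [real_inner_comm]; exact he.one_two
  have hp' : inner ℝ (act Λ e₂) (act Λ e₁) = 0 := by rw [real_inner_comm]; exact he.principal
  rw [InPlane] at p1 p2
  generalize inner ℝ e₁ f₁ = s at *
  generalize inner ℝ e₂ f₁ = t at *
  generalize inner ℝ e₁ f₂ = s' at *
  generalize inner ℝ e₂ f₂ = t' at *
  subst p1 p2
  simp only [← real_inner_self_eq_norm_sq] at o ho
  simp only [map_add, map_smul, inner_add_left, inner_add_right, real_inner_smul_left,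
    real_inner_smul_right, he.one_one, he.two_two, he.one_two, he.principal, h21, hp'] at *
  generalize inner ℝ (act Λ e₁) (act Λ e₁) = A at *
  generalize inner ℝ (act Λ e₂) (act Λ e₂) = C at *
  have hAC : C - A ≠ 0 := right_ne_zero_of_mul ho.ne'
  -- Orthogonality and principality read `s s' + t t' = 0` and `A s s' + C t t' = 0`, with `A ≠ C`.
  have hss : s * s' = 0 := (mul_eq_zero.mp (show (C - A) * (s * s') = 0 by
    linear_combination C * q12 - q)).resolve_left hAC
  have htt : t * t' = 0 := by linarith
  -- Otherwise the two directions would be exchanged and the order of the values reversed.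
  have hs : s ≠ 0 := by
    rintro rfl
    have ht : t ^ 2 = 1 := by linarith
    have ht0 : t ≠ 0 := by rintro rfl; norm_num at ht
    have ht' : t' = 0 := (mul_eq_zero.mp htt).resolve_left ht0
    subst ht'
    have hs' : s' ^ 2 = 1 := by linarith
    have e : ε * (s' * (s' * A) - t * (t * C)) = ε * (A - C) := by
      linear_combination ε * A * hs' - ε * C * ht
    simp only [zero_mul, mul_zero, add_zero, zero_add] at o
    linarith
  have hs' : s' = 0 := (mul_eq_zero.mp hss).resolve_left hs
  subst hs'
  have ht' : t' ^ 2 = 1 := by linarith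
  have ht0 : t' ≠ 0 := by rintro rfl; norm_num at ht'
  have ht : t = 0 := (mul_eq_zero.mp htt).resolve_right ht0
  subst ht
  have hs2 : s ^ 2 = 1 := by linarith
  -- The signs that remain are fixed by positivity on `ξ` and, for the second vector, by the
  -- orientation.
  have hs1 : s = 1 := by
    rcases mul_self_eq_one_iff.mp ((sq s).symm.trans hs2) with h | h
    · exact h
    · subst h; linarith
  subst hs1
  have ht1 : t' = 1 := by
    rcases mul_self_eq_one_iff.mp ((sq t').symm.trans ht') with h | h
    · exact h
    · subst h; linarith
  subst ht1
  simp

lemma act_isometry {R : Matrix (Fin 4) (Fin 4) ℝ} (hR : Rᵀ * R = 1) (x y : E4) :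
    inner ℝ (act R x) (act R y) = inner ℝ x y := by
  rw [inner_eq_frame (M := Rᵀ) (by rw [Matrix.transpose_transpose]; exact mul_eq_one_comm.mp hR) x,
    Matrix.transpose_transpose, E4.inner_eq]
  rfl

lemma act_norm {R : Matrix (Fin 4) (Fin 4) ℝ} (hR : Rᵀ * R = 1) (x : E4) : ‖act R x‖ = ‖x‖ := by
  rw [norm_eq_sqrt_real_inner, norm_eq_sqrt_real_inner, act_isometry hR]

section Equivariance

variable {R : Matrix (Fin 4) (Fin 4) ℝ}

lemma orthPart_act (hR : Rᵀ * R = 1) (ξ η : E4) :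
    orthPart (act R ξ) (act R η) = act R (orthPart ξ η) := by
  simp [orthPart, act_norm hR, act_isometry hR]

lemma gs₁_act (hR : Rᵀ * R = 1) (ξ : E4) : gs₁ (act R ξ) = act R (gs₁ ξ) := by
  simp [gs₁, act_norm hR]

lemma gs₂_act (hR : Rᵀ * R = 1) (ξ η : E4) : gs₂ (act R ξ) (act R η) = act R (gs₂ ξ η) := by
  simp [gs₂, orthPart_act hR, act_norm hR]

lemma act_commute (hR : Rᵀ * R = 1) (hRΛ : R * Λ * Rᵀ = Λ) (x : E4) :
    act Λ (act R x) = act R (act Λ x) := by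
  rw [← act_mul, ← act_mul]
  congr 2
  nth_rewrite 1 [← hRΛ]
  rw [Matrix.mul_assoc, hR, Matrix.mul_one]

lemma gap_act (hR : Rᵀ * R = 1) (hRΛ : R * Λ * Rᵀ = Λ) (ξ η : E4) :
    gap Λ (act R ξ) (act R η) = gap Λ ξ η := by
  simp only [gap, orthPart_act hR, act_commute hR hRΛ, act_norm hR]

/-- The construction uses only inner products and `Λ`, so it commutes with every isometry commuting
with `Λ`. This makes the chart invariant. -/
lemma prin_act (hR : Rᵀ * R = 1) (hRΛ : R * Λ * Rᵀ = Λ) (ξ η : E4) :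
    prin₁ Λ (act R ξ) (act R η) = act R (prin₁ Λ ξ η) ∧
    prin₂ Λ (act R ξ) (act R η) = act R (prin₂ Λ ξ η) := by
  simp only [prin₁, prin₂, turned₁, turned₂, turnAngle, gs₁_act hR, gs₂_act hR,
    act_commute hR hRΛ, act_norm hR, act_isometry hR, map_add, map_smul, and_self]

end Equivariance

/-! ### Smoothness -/

section Smooth

variable {F : Type*} [NormedAddCommGroup F] [NormedSpace ℝ F] {f g : F → E4} {x : F}

lemma contDiffAt_orthPart (hf : ContDiffAt ℝ ∞ f x) (hg : ContDiffAt ℝ ∞ g x) :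
    ContDiffAt ℝ ∞ (fun y => orthPart (f y) (g y)) x :=
  ((hf.norm_sq ℝ).smul hg).sub ((hf.inner ℝ hg).smul hf)

lemma contDiffAt_act (Λ : Matrix (Fin 4) (Fin 4) ℝ) (hf : ContDiffAt ℝ ∞ f x) :
    ContDiffAt ℝ ∞ (fun y => act Λ (f y)) x := (act Λ).contDiff.contDiffAt.comp x hf

lemma contDiffAt_gap (Λ : Matrix (Fin 4) (Fin 4) ℝ) (hf : ContDiffAt ℝ ∞ f x)
    (hg : ContDiffAt ℝ ∞ g x) : ContDiffAt ℝ ∞ (fun y => gap Λ (f y) (g y)) x :=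
  ((hf.norm_sq ℝ).mul ((contDiffAt_act Λ (contDiffAt_orthPart hf hg)).norm_sq ℝ)).sub
    (((contDiffAt_orthPart hf hg).norm_sq ℝ).mul ((contDiffAt_act Λ hf).norm_sq ℝ))

/-- A nonzero gap keeps all denominators and all normalized vectors away from zero, and the
arctangent is smooth everywhere. -/
lemma contDiffAt_prin (hf : ContDiffAt ℝ ∞ f x) (hg : ContDiffAt ℝ ∞ g x)
    (h : 0 < ε * gap Λ (f x) (g x)) :
    ContDiffAt ℝ ∞ (fun y => prin₁ Λ (f y) (g y)) x ∧
    ContDiffAt ℝ ∞ (fun y => prin₂ Λ (f y) (g y)) x := by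
  have h0 := orthPart_ne_zero_of_gap h
  have hξ := (gs_orthonormal h0).1
  have hne := right_ne_zero_of_mul (gs_gap_pos h).ne'
  have g1 : ContDiffAt ℝ ∞ (fun y => gs₁ (f y)) x :=
    ((hf.norm ℝ hξ).inv (norm_ne_zero_iff.mpr hξ)).smul hf
  have ho := contDiffAt_orthPart hf hg
  have g2 : ContDiffAt ℝ ∞ (fun y => gs₂ (f y) (g y)) x :=
    ((ho.norm ℝ h0).inv (norm_ne_zero_iff.mpr h0)).smul ho
  have a1 := contDiffAt_act Λ g1
  have a2 := contDiffAt_act Λ g2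
  have hφ : ContDiffAt ℝ ∞ (fun y => turnAngle Λ (f y) (g y)) x :=
    (((contDiffAt_const.mul (a1.inner ℝ a2)).neg.div
      ((a2.norm_sq ℝ).sub (a1.norm_sq ℝ)) hne).arctan).div_const 2
  exact ⟨(hφ.cos.smul g1).add (hφ.sin.smul g2), (hφ.sin.neg.smul g1).add (hφ.cos.smul g2)⟩

end Smooth

end ThreeBody

end

/-! ### The symplectic form in a moving frame: algebra. -/

noncomputable section

namespace ThreeBody

/-- A tangent vector of the level set in a body frame: `X`, `Y` are the variations of the Jacobi
vectors `x`, `y`, `dq`, `dp` those of the coordinates, and `s`, `A₃`, `A₄`, `B₃`, `B₄` describe the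
variation of the first two vectors of the frame. -/
structure BodyVariation (c a b : ℝ) (x₁ x₂ y₁ y₂ X₁ X₂ Y₁ Y₂ dq dp : Fin 4 → ℝ)
    (s A₃ A₄ B₃ B₄ : ℝ) : Prop where
  X₁₀ : X₁ 0 = dq 0 - s * x₁ 1
  X₁₁ : X₁ 1 = dq 1 + s * x₁ 0
  X₁₂ : X₁ 2 = x₁ 0 * A₃ + x₁ 1 * B₃
  X₁₃ : X₁ 3 = x₁ 0 * A₄ + x₁ 1 * B₄
  X₂₀ : X₂ 0 = dq 2 - s * x₂ 1
  X₂₁ : X₂ 1 = dq 3 + s * x₂ 0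
  X₂₂ : X₂ 2 = x₂ 0 * A₃ + x₂ 1 * B₃
  X₂₃ : X₂ 3 = x₂ 0 * A₄ + x₂ 1 * B₄
  Y₁₀ : Y₁ 0 = dp 0 - s * y₁ 1 - y₁ 2 * A₃ - y₁ 3 * A₄
  Y₁₁ : Y₁ 1 = dp 1 + s * y₁ 0 - y₁ 2 * B₃ - y₁ 3 * B₄
  Y₂₀ : Y₂ 0 = dp 2 - s * y₂ 1 - y₂ 2 * A₃ - y₂ 3 * A₄
  Y₂₁ : Y₂ 1 = dp 3 + s * y₂ 0 - y₂ 2 * B₃ - y₂ 3 * B₄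
  tangent : ∀ j k, X₁ j * y₁ k - y₁ j * X₁ k + (x₁ j * Y₁ k - Y₁ j * x₁ k) +
    (X₂ j * y₂ k - y₂ j * X₂ k + (x₂ j * Y₂ k - Y₂ j * x₂ k)) = 0
  principal : c * (a * A₄ - b * B₃) + s * (b ^ 2 - a ^ 2) = 0

section Algebra

variable {c a b : ℝ} {x₁ x₂ y₁ y₂ X₁ X₂ Y₁ Y₂ dq dp X₁' X₂' Y₁' Y₂' dq' dp' : Fin 4 → ℝ}
  {s A₃ A₄ B₃ B₄ s' A₃' A₄' B₃' B₄' : ℝ}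

/-- The tangency equation between the two normal directions reduces to `a A₃ = b B₄`, and `a`, `b`
are not both zero. -/
lemma BodyVariation.normal (h : BodyVariation c a b x₁ x₂ y₁ y₂ X₁ X₂ Y₁ Y₂ dq dp s A₃ A₄ B₃ B₄)
    (hab : a ^ 2 ≠ b ^ 2) (h12 : x₁ 2 = 0) (h13 : x₁ 3 = 0) (h22 : x₂ 2 = 0) (h23 : x₂ 3 = 0)
    (l1 : x₁ 0 * y₁ 2 + x₂ 0 * y₂ 2 = 0) (l2 : x₁ 1 * y₁ 2 + x₂ 1 * y₂ 2 = b)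
    (l3 : x₁ 0 * y₁ 3 + x₂ 0 * y₂ 3 = a) (l4 : x₁ 1 * y₁ 3 + x₂ 1 * y₂ 3 = 0) :
    ∃ t, A₃ = t * b ∧ B₄ = t * a := by
  have e := h.tangent 2 3
  rw [h.X₁₂, h.X₁₃, h.X₂₂, h.X₂₃, h12, h13, h22, h23] at e
  have e' : a * A₃ = b * B₄ := by
    linear_combination e - A₃ * l3 - B₃ * l4 + A₄ * l1 + B₄ * l2
  by_cases ha : a = 0
  · have hb : b ≠ 0 := by rintro rfl; exact hab (by rw [ha])
    refine ⟨A₃ / b, by field_simp, ?_⟩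
    rw [ha, zero_mul] at e'
    rw [ha, mul_zero]
    exact (mul_eq_zero.mp e'.symm).resolve_left hb
  · refine ⟨B₄ / a, ?_, by field_simp⟩
    field_simp
    linarith

/-- Expanding in the frame gives `∑ dq ∧ dp` and terms containing the infinitesimal motions of the
frame. Modulo tangency, these terms combine into the pairing of the angular momentum with the
commutator of the two motions, which is zero for principal frames. -/
lemma BodyVariation.symplectic
    (h : BodyVariation c a b x₁ x₂ y₁ y₂ X₁ X₂ Y₁ Y₂ dq dp s A₃ A₄ B₃ B₄)
    (h' : BodyVariation c a b x₁ x₂ y₁ y₂ X₁' X₂' Y₁' Y₂' dq' dp' s' A₃' A₄' B₃' B₄')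
    (hab : a ^ 2 ≠ b ^ 2) (h12 : x₁ 2 = 0) (h13 : x₁ 3 = 0) (h22 : x₂ 2 = 0) (h23 : x₂ 3 = 0)
    (l0 : x₁ 0 * y₁ 1 - x₁ 1 * y₁ 0 + x₂ 0 * y₂ 1 - x₂ 1 * y₂ 0 = c)
    (l1 : x₁ 0 * y₁ 2 + x₂ 0 * y₂ 2 = 0) (l2 : x₁ 1 * y₁ 2 + x₂ 1 * y₂ 2 = b)
    (l3 : x₁ 0 * y₁ 3 + x₂ 0 * y₂ 3 = a) (l4 : x₁ 1 * y₁ 3 + x₂ 1 * y₂ 3 = 0) :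
    (X₁ 0 * Y₁' 0 + X₁ 1 * Y₁' 1 + X₁ 2 * Y₁' 2 + X₁ 3 * Y₁' 3) -
    (X₁' 0 * Y₁ 0 + X₁' 1 * Y₁ 1 + X₁' 2 * Y₁ 2 + X₁' 3 * Y₁ 3) +
    ((X₂ 0 * Y₂' 0 + X₂ 1 * Y₂' 1 + X₂ 2 * Y₂' 2 + X₂ 3 * Y₂' 3) -
    (X₂' 0 * Y₂ 0 + X₂' 1 * Y₂ 1 + X₂' 2 * Y₂ 2 + X₂' 3 * Y₂ 3)) =
    ∑ k, (dq k * dp' k - dp k * dq' k) := by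
  obtain ⟨t, rfl, rfl⟩ := h.normal hab h12 h13 h22 h23 l1 l2 l3 l4
  obtain ⟨t', rfl, rfl⟩ := h'.normal hab h12 h13 h22 h23 l1 l2 l3 l4
  have T01 := h.tangent 0 1
  have T02 := h.tangent 0 2
  have T03 := h.tangent 0 3
  have T12 := h.tangent 1 2
  have T13 := h.tangent 1 3
  have T01' := h'.tangent 0 1
  have T02' := h'.tangent 0 2
  have T03' := h'.tangent 0 3
  have T12' := h'.tangent 1 2
  have T13' := h'.tangent 1 3
  have p := h.principal
  have p' := h'.principal
  simp only [h12, h13, h22, h23, h.X₁₀, h.X₁₁, h.X₁₂, h.X₁₃, h.X₂₀, h.X₂₁, h.X₂₂, h.X₂₃,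
    h.Y₁₀, h.Y₁₁, h.Y₂₀, h.Y₂₁, h'.X₁₀, h'.X₁₁, h'.X₁₂, h'.X₁₃, h'.X₂₀, h'.X₂₁, h'.X₂₂, h'.X₂₃,
    h'.Y₁₀, h'.Y₁₁, h'.Y₂₀, h'.Y₂₁, Fin.sum_univ_four] at *
  clear h h' h12 h13 h22 h23
  -- The coefficients of `c`, `a`, `b` are the entries 01, 03, 12 of the commutator of the two
  -- infinitesimal motions, taken without rotation of the normal plane. They pair to zero by the
  -- differentiated principal conditions.
  have key : c * (-(t * b) * B₃' - A₄ * (t' * a) + t' * b * B₃ + A₄' * (t * a)) +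
      a * (s * (t' * a) - s' * (t * a)) + b * (s' * (t * b) - s * (t' * b)) = 0 := by
    linear_combination t * p' - t' * p
  -- The tangency equations of each vector are weighted by the infinitesimal motion of the other;
  -- the level equations then replace bilinear expressions by `c`, `a`, `b`, 0.
  linear_combination key +
    (-s') * T01 - t' * b * T02 - A₄' * T03 - B₃' * T12 - t' * a * T13 -
    ((-s) * T01' - t * b * T02' - A₄ * T03' - B₃ * T12' - t * a * T13') +
    (-(t * b) * B₃' - A₄ * (t' * a) + t' * b * B₃ + A₄' * (t * a)) * l0 +
    (s * (t' * a) - s' * (t * a)) * l3 + (s' * (t * b) - s * (t' * b)) * l2 +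
    (s * B₃' - s' * B₃) * l1 + (s' * A₄ - s * A₄') * l4

end Algebra

end ThreeBody

end

/-! ### Tangent vectors and derivatives of frames. -/

noncomputable section

namespace ThreeBody

variable {m : Fin 3 → ℝ} {Λ N M : Matrix (Fin 4) (Fin 4) ℝ} {c a b : ℝ} {z u v : Phase}

/-- The position of body `i` as a linear map. -/
def posL (i : Fin 3) : Phase →L[ℝ] E4 :=
  (ContinuousLinearMap.proj (R := ℝ) (φ := fun _ : Fin 3 => E4) i).comp
    (ContinuousLinearMap.fst ℝ (Fin 3 → E4) (Fin 3 → E4))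

/-- The momentum of body `i` as a linear map. -/
def momL (i : Fin 3) : Phase →L[ℝ] E4 :=
  (ContinuousLinearMap.proj (R := ℝ) (φ := fun _ : Fin 3 => E4) i).comp
    (ContinuousLinearMap.snd ℝ (Fin 3 → E4) (Fin 3 → E4))

/-- The Jacobi vector `x₁` as a linear map. -/
def jacobiX1L : Phase →L[ℝ] E4 := posL 1 - posL 2

/-- The Jacobi vector `x₂` as a linear map. -/
def jacobiX2L (m : Fin 3 → ℝ) : Phase →L[ℝ] E4 :=
  posL 0 - (m 1 + m 2)⁻¹ • (m 1 • posL 1 + m 2 • posL 2)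

/-- The Jacobi momentum `y₁` as a linear map. -/
def jacobiY1L (m : Fin 3 → ℝ) : Phase →L[ℝ] E4 :=
  (m 1 + m 2)⁻¹ • (m 2 • momL 1 - m 1 • momL 2)

/-- The Jacobi momentum `y₂` as a linear map. -/
def jacobiY2L (m : Fin 3 → ℝ) : Phase →L[ℝ] E4 :=
  (m 0 + m 1 + m 2)⁻¹ • ((m 1 + m 2) • momL 0 - m 0 • (momL 1 + momL 2))

lemma jacobiX1L_eq : ⇑jacobiX1L = jacobiX1 := rfl
lemma jacobiX2L_eq (m : Fin 3 → ℝ) : ⇑(jacobiX2L m) = jacobiX2 m := rfl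

lemma fderiv_angularMomentum (z u : Phase) (j k : Fin 4) :
    fderiv ℝ (fun z' : Phase => angularMomentum z' j k) z u =
      (∑ i, wedge (u.1 i) (z.2 i) + ∑ i, wedge (z.1 i) (u.2 i)) j k := by
  have hp : ∀ i l, HasFDerivAt (fun z' : Phase => z'.1 i l)
      ((EuclideanSpace.proj (𝕜 := ℝ) l).comp (posL i)) z := fun i l =>
    ((EuclideanSpace.proj (𝕜 := ℝ) l).comp (posL i)).hasFDerivAt
  have hq : ∀ i l, HasFDerivAt (fun z' : Phase => z'.2 i l)
      ((EuclideanSpace.proj (𝕜 := ℝ) l).comp (momL i)) z := fun i l =>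
    ((EuclideanSpace.proj (𝕜 := ℝ) l).comp (momL i)).hasFDerivAt
  have h := HasFDerivAt.fun_sum fun i (_ : i ∈ Finset.univ) =>
    ((hp i j).mul (hq i k)).sub ((hq i j).mul (hp i k))
  have e : (fun z' : Phase => angularMomentum z' j k) = fun z' : Phase =>
      ∑ i, (z'.1 i j * z'.2 i k - z'.2 i j * z'.1 i k) := by
    ext z'
    simp [angularMomentum, wedge, Matrix.sum_apply, Matrix.vecMulVec_apply]
  have h' : fderiv ℝ (fun z' : Phase => ∑ i, (z'.1 i j * z'.2 i k - z'.2 i j * z'.1 i k)) z = _ :=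
    h.fderiv
  rw [e, h']
  simp [wedge, Matrix.vecMulVec_apply, posL, momL, Fin.sum_univ_three]
  ring

lemma TangentToLevel.wedge_eq_zero (hm : ∀ i, 0 < m i) (hz : ∑ i, z.2 i = 0)
    (hu : TangentToLevel z u) :
    wedge (jacobiX1 u) (jacobiY1 m z) + wedge (jacobiX2 m u) (jacobiY2 m z) +
      (wedge (jacobiX1 z) (jacobiY1 m u) + wedge (jacobiX2 m z) (jacobiY2 m u)) = 0 := by
  rw [← sum_wedge_eq_jacobi hm hz, ← sum_wedge_eq_jacobi hm hu.1]
  ext j k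
  rw [← fderiv_angularMomentum]
  exact hu.2 j k

lemma TangentToLevel.body (hm : ∀ i, 0 < m i) (hz : ∑ i, z.2 i = 0) (hu : TangentToLevel z u)
    (M : Matrix (Fin 4) (Fin 4) ℝ) (j k : Fin 4) :
    (Mᵀ *ᵥ (jacobiX1 u).ofLp) j * (Mᵀ *ᵥ (jacobiY1 m z).ofLp) k -
      (Mᵀ *ᵥ (jacobiY1 m z).ofLp) j * (Mᵀ *ᵥ (jacobiX1 u).ofLp) k +
    ((Mᵀ *ᵥ (jacobiX1 z).ofLp) j * (Mᵀ *ᵥ (jacobiY1 m u).ofLp) k -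
      (Mᵀ *ᵥ (jacobiY1 m u).ofLp) j * (Mᵀ *ᵥ (jacobiX1 z).ofLp) k) +
    ((Mᵀ *ᵥ (jacobiX2 m u).ofLp) j * (Mᵀ *ᵥ (jacobiY2 m z).ofLp) k -
      (Mᵀ *ᵥ (jacobiY2 m z).ofLp) j * (Mᵀ *ᵥ (jacobiX2 m u).ofLp) k +
    ((Mᵀ *ᵥ (jacobiX2 m z).ofLp) j * (Mᵀ *ᵥ (jacobiY2 m u).ofLp) k -
      (Mᵀ *ᵥ (jacobiY2 m u).ofLp) j * (Mᵀ *ᵥ (jacobiX2 m z).ofLp) k)) = 0 := by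
  have h := congrArg (fun A => (Mᵀ * A * M) j k) (hu.wedge_eq_zero hm hz)
  simp only [Matrix.mul_add, Matrix.add_mul, Matrix.add_apply, conj_wedge, Matrix.mul_zero,
    Matrix.zero_mul, Matrix.zero_apply] at h
  linarith

section Frame

variable {e₁ e₂ : Phase → E4}

lemma fderiv_frameCoord (m : Fin 3 → ℝ) (d₁ : DifferentiableAt ℝ e₁ z)
    (d₂ : DifferentiableAt ℝ e₂ z) (u : Phase) :
    fderiv ℝ (fun z => frameCoord m (e₁ z) (e₂ z) z) z u =
    (![inner ℝ (e₁ z) (jacobiX1 u) + inner ℝ (fderiv ℝ e₁ z u) (jacobiX1 z),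
       inner ℝ (e₂ z) (jacobiX1 u) + inner ℝ (fderiv ℝ e₂ z u) (jacobiX1 z),
       inner ℝ (e₁ z) (jacobiX2 m u) + inner ℝ (fderiv ℝ e₁ z u) (jacobiX2 m z),
       inner ℝ (e₂ z) (jacobiX2 m u) + inner ℝ (fderiv ℝ e₂ z u) (jacobiX2 m z)],
     ![inner ℝ (e₁ z) (jacobiY1 m u) + inner ℝ (fderiv ℝ e₁ z u) (jacobiY1 m z),
       inner ℝ (e₂ z) (jacobiY1 m u) + inner ℝ (fderiv ℝ e₂ z u) (jacobiY1 m z),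
       inner ℝ (e₁ z) (jacobiY2 m u) + inner ℝ (fderiv ℝ e₁ z u) (jacobiY2 m z),
       inner ℝ (e₂ z) (jacobiY2 m u) + inner ℝ (fderiv ℝ e₂ z u) (jacobiY2 m z)]) := by
  have key : ∀ (e : Phase → E4), DifferentiableAt ℝ e z → ∀ L : Phase →L[ℝ] E4,
      DifferentiableAt ℝ (fun z => inner ℝ (e z) (L z)) z ∧
      fderiv ℝ (fun z => inner ℝ (e z) (L z)) z u =
      inner ℝ (e z) (L u) + inner ℝ (fderiv ℝ e z u) (L z) := by
    intro e d L
    refine ⟨d.inner ℝ L.differentiableAt, ?_⟩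
    rw [fderiv_inner_apply ℝ d L.differentiableAt, L.fderiv]
  have hq : ∀ k, DifferentiableAt ℝ (fun z => (frameCoord m (e₁ z) (e₂ z) z).1 k) z := by
    intro k
    fin_cases k
    · exact (key e₁ d₁ jacobiX1L).1
    · exact (key e₂ d₂ jacobiX1L).1
    · exact (key e₁ d₁ (jacobiX2L m)).1
    · exact (key e₂ d₂ (jacobiX2L m)).1
  have hp : ∀ k, DifferentiableAt ℝ (fun z => (frameCoord m (e₁ z) (e₂ z) z).2 k) z := by
    intro k
    fin_cases k
    · exact (key e₁ d₁ (jacobiY1L m)).1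
    · exact (key e₂ d₂ (jacobiY1L m)).1
    · exact (key e₁ d₁ (jacobiY2L m)).1
    · exact (key e₂ d₂ (jacobiY2L m)).1
  have hd := (differentiableAt_pi.mpr hq).fderiv_prodMk (differentiableAt_pi.mpr hp)
  have h1 := fderiv_pi hq
  have h2 := fderiv_pi hp
  have e : fderiv ℝ (fun z => frameCoord m (e₁ z) (e₂ z) z) z u =
      (fun k => fderiv ℝ (fun z => (frameCoord m (e₁ z) (e₂ z) z).1 k) z u,
       fun k => fderiv ℝ (fun z => (frameCoord m (e₁ z) (e₂ z) z).2 k) z u) := by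
    have := congrArg (fun f => f u) hd
    simp only [ContinuousLinearMap.prod_apply] at this
    rw [h1, h2] at this
    exact this
  rw [e]
  ext k
  · fin_cases k
    · exact (key e₁ d₁ jacobiX1L).2
    · exact (key e₂ d₂ jacobiX1L).2
    · exact (key e₁ d₁ (jacobiX2L m)).2
    · exact (key e₂ d₂ (jacobiX2L m)).2
  · fin_cases k
    · exact (key e₁ d₁ (jacobiY1L m)).2
    · exact (key e₂ d₂ (jacobiY1L m)).2
    · exact (key e₁ d₁ (jacobiY2L m)).2
    · exact (key e₂ d₂ (jacobiY2L m)).2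

/-- Product rule for the expansion of `L` in the moving frame. It expresses the normal components of
`L u` through the derivative of the frame. -/
lemma fderiv_of_inPlane {L : Phase →L[ℝ] E4} (d₁ : DifferentiableAt ℝ e₁ z)
    (d₂ : DifferentiableAt ℝ e₂ z) (h : ∀ᶠ z' in 𝓝 z, InPlane (e₁ z') (e₂ z') (L z')) (u : Phase) :
    L u = (inner ℝ (e₁ z) (L u) + inner ℝ (fderiv ℝ e₁ z u) (L z) : ℝ) • e₁ z +
      (inner ℝ (e₁ z) (L z) : ℝ) • fderiv ℝ e₁ z u +
      ((inner ℝ (e₂ z) (L u) + inner ℝ (fderiv ℝ e₂ z u) (L z) : ℝ) • e₂ z +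
      (inner ℝ (e₂ z) (L z) : ℝ) • fderiv ℝ e₂ z u) := by
  have i1 : DifferentiableAt ℝ (fun z => inner ℝ (e₁ z) (L z)) z :=
    d₁.inner ℝ L.differentiableAt
  have i2 : DifferentiableAt ℝ (fun z => inner ℝ (e₂ z) (L z)) z :=
    d₂.inner ℝ L.differentiableAt
  have hE : (fun z' => L z') =ᶠ[𝓝 z] fun z' => (inner ℝ (e₁ z') (L z') : ℝ) • e₁ z' +
      (inner ℝ (e₂ z') (L z') : ℝ) • e₂ z' := h
  have hd := (i1.hasFDerivAt.smul d₁.hasFDerivAt).add (i2.hasFDerivAt.smul d₂.hasFDerivAt)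
  have := congrArg (fun f => f u) ((L.hasFDerivAt.congr_of_eventuallyEq hE.symm).unique hd)
  simp only [add_apply, smul_apply,
    ContinuousLinearMap.smulRight_apply,
    fderiv_inner_apply ℝ d₁ L.differentiableAt, fderiv_inner_apply ℝ d₂ L.differentiableAt,
    L.fderiv] at this
  exact this.trans (by abel)

lemma bodyForm_mulVec (c a b : ℝ) (v : Fin 4 → ℝ) : bodyForm c a b *ᵥ v =
    ![c * v 1 + a * v 3, -c * v 0 + b * v 2, -b * v 1, -a * v 0] := by
  ext i; fin_cases i <;> simp [bodyForm, Matrix.mulVec, dotProduct, Fin.sum_univ_four]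

/-- A smooth family of principal frames yields a variation in the body frame. -/
lemma TangentToLevel.bodyVariation (hm : ∀ i, 0 < m i) (hz : z ∈ level Λ)
    (d₁ : DifferentiableAt ℝ e₁ z) (d₂ : DifferentiableAt ℝ e₂ z)
    (hev : ∀ᶠ z' in 𝓝 z, IsPrincipal Λ (e₁ z') (e₂ z') ∧
      InPlane (e₁ z') (e₂ z') (jacobiX1 z') ∧ InPlane (e₁ z') (e₂ z') (jacobiX2 m z'))
    (hM : IsBodyFrame Λ N M c a b) (h1 : Mᵀ *ᵥ (e₁ z).ofLp = ![1, 0, 0, 0])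
    (h2 : Mᵀ *ᵥ (e₂ z).ofLp = ![0, 1, 0, 0]) (hu : TangentToLevel z u) :
    ∃ s A₃ A₄ B₃ B₄, BodyVariation c a b (Mᵀ *ᵥ (jacobiX1 z).ofLp) (Mᵀ *ᵥ (jacobiX2 m z).ofLp)
      (Mᵀ *ᵥ (jacobiY1 m z).ofLp) (Mᵀ *ᵥ (jacobiY2 m z).ofLp)
      (Mᵀ *ᵥ (jacobiX1 u).ofLp) (Mᵀ *ᵥ (jacobiX2 m u).ofLp)
      (Mᵀ *ᵥ (jacobiY1 m u).ofLp) (Mᵀ *ᵥ (jacobiY2 m u).ofLp)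
      (fderiv ℝ (fun z => frameCoord m (e₁ z) (e₂ z) z) z u).1
      (fderiv ℝ (fun z => frameCoord m (e₁ z) (e₂ z) z) z u).2 s A₃ A₄ B₃ B₄ := by
  obtain ⟨-, px1, px2⟩ := hev.self_of_nhds
  have hx1 := px1.vec_frame h1 h2
  have hx2 := px2.vec_frame h1 h2
  have f1 := fderiv_of_inPlane (L := jacobiX1L) d₁ d₂ (hev.mono fun z' h => h.2.1) u
  have f2 := fderiv_of_inPlane (L := jacobiX2L m) d₁ d₂ (hev.mono fun z' h => h.2.2) u
  -- Constant inner products make the motion of the frame infinitesimally orthogonal, and applied to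
  -- `Λ e₁`, `Λ e₂` they give the field `principal`. The matrix `M` stays fixed at its value for
  -- `z`; no smoothness of the normal vectors is needed.
  have const : ∀ (f g : Phase → E4) (r : ℝ), DifferentiableAt ℝ f z → DifferentiableAt ℝ g z →
      (∀ᶠ z' in 𝓝 z, inner ℝ (f z') (g z') = r) →
      inner ℝ (f z) (fderiv ℝ g z u) + inner ℝ (fderiv ℝ f z u) (g z) = 0 := by
    intro f g r hf hg h
    have hE : (fun z' => inner ℝ (f z') (g z')) =ᶠ[𝓝 z] fun _ => r := h
    rw [← fderiv_inner_apply ℝ hf hg, hE.fderiv_eq]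
    simp
  have c11 := const e₁ e₁ 1 d₁ d₁ (hev.mono fun z' h => h.1.one_one)
  have c22 := const e₂ e₂ 1 d₂ d₂ (hev.mono fun z' h => h.1.two_two)
  have c12 := const e₁ e₂ 0 d₁ d₂ (hev.mono fun z' h => h.1.one_two)
  have a1 : HasFDerivAt (fun z => act Λ (e₁ z)) ((act Λ).comp (fderiv ℝ e₁ z)) z :=
    (act Λ).hasFDerivAt.comp z d₁.hasFDerivAt
  have a2 : HasFDerivAt (fun z => act Λ (e₂ z)) ((act Λ).comp (fderiv ℝ e₂ z)) z :=
    (act Λ).hasFDerivAt.comp z d₂.hasFDerivAt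
  have cp := const _ _ 0 a1.differentiableAt a2.differentiableAt
    (hev.mono fun z' h => h.1.principal)
  rw [a1.fderiv, a2.fderiv] at cp
  simp only [ContinuousLinearMap.comp_apply] at cp
  rw [jacobiX1L_eq] at f1
  rw [jacobiX2L_eq] at f2
  rw [fderiv_frameCoord m d₁ d₂]
  generalize fderiv ℝ e₁ z u = E₁ at *
  generalize fderiv ℝ e₂ z u = E₂ at *
  have v1 := vec_frame hM.orth h1 h2
  have E10 : (Mᵀ *ᵥ E₁.ofLp) 0 = 0 := by
    rw [(v1 E₁).1]; linarith [real_inner_comm E₁ (e₁ z)]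
  have E21 : (Mᵀ *ᵥ E₂.ofLp) 1 = 0 := by
    rw [(v1 E₂).2]; linarith [real_inner_comm E₂ (e₂ z)]
  have E20 : (Mᵀ *ᵥ E₂.ofLp) 0 = -(Mᵀ *ᵥ E₁.ofLp) 1 := by
    rw [(v1 E₂).1, (v1 E₁).2]; linarith [real_inner_comm E₁ (e₂ z)]
  have hi := inner_eq_frame hM.orth
  have g1 := fun k => congrArg (fun x : E4 => (Mᵀ *ᵥ x.ofLp) k) f1
  have g2 := fun k => congrArg (fun x : E4 => (Mᵀ *ᵥ x.ofLp) k) f2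
  simp only [WithLp.ofLp_add, WithLp.ofLp_smul, Matrix.mulVec_add, Matrix.mulVec_smul, h1, h2,
    Pi.add_apply, Pi.smul_apply, smul_eq_mul] at g1 g2
  refine ⟨(Mᵀ *ᵥ E₁.ofLp) 1, (Mᵀ *ᵥ E₁.ofLp) 2, (Mᵀ *ᵥ E₁.ofLp) 3, (Mᵀ *ᵥ E₂.ofLp) 2,
    (Mᵀ *ᵥ E₂.ofLp) 3, ?_⟩
  constructor
  · rw [(v1 _).1]; simp [hi E₁, hx1, E10]
  · rw [(v1 _).2]; simp [hi E₂, hx1, E20, E21]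
  · rw [g1 2, hx1]; simp
  · rw [g1 3, hx1]; simp
  · rw [(v1 _).1]; simp [hi E₁, hx2, E10]
  · rw [(v1 _).2]; simp [hi E₂, hx2, E20, E21]
  · rw [g2 2, hx2]; simp
  · rw [g2 3, hx2]; simp
  · rw [(v1 _).1]; simp [hi E₁, E10]; ring
  · rw [(v1 _).2]; simp [hi E₂, E20, E21]; ring
  · rw [(v1 _).1]; simp [hi E₁, E10]; ring
  · rw [(v1 _).2]; simp [hi E₂, E20, E21]; ring
  · exact hu.body hm hz.1 M
  · simp only [hi, act_inner_eq_sum hM.orth, h1, h2, hM.form, bodyForm_mulVec, E10, E20, E21] at cp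
    simp at cp
    linear_combination cp

/-- The canonical form is invariant under rotations, so it may be computed in the frame `M`, where
the algebra of body variations applies. -/
theorem symplectic_of_frame (hm : ∀ i, 0 < m i) (hz : z ∈ level Λ)
    (d₁ : DifferentiableAt ℝ e₁ z) (d₂ : DifferentiableAt ℝ e₂ z)
    (hev : ∀ᶠ z' in 𝓝 z, IsPrincipal Λ (e₁ z') (e₂ z') ∧
      InPlane (e₁ z') (e₂ z') (jacobiX1 z') ∧ InPlane (e₁ z') (e₂ z') (jacobiX2 m z'))
    (hM : IsBodyFrame Λ N M c a b) (h1 : Mᵀ *ᵥ (e₁ z).ofLp = ![1, 0, 0, 0])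
    (h2 : Mᵀ *ᵥ (e₂ z).ofLp = ![0, 1, 0, 0]) (hab : a ^ 2 ≠ b ^ 2)
    (hu : TangentToLevel z u) (hv : TangentToLevel z v) :
    omega u v = omegaRed (fderiv ℝ (fun z => frameCoord m (e₁ z) (e₂ z) z) z u)
      (fderiv ℝ (fun z => frameCoord m (e₁ z) (e₂ z) z) z v) := by
  obtain ⟨-, px1, px2⟩ := hev.self_of_nhds
  have hx1 := px1.vec_frame h1 h2
  have hx2 := px2.vec_frame h1 h2
  obtain ⟨s, A₃, A₄, B₃, B₄, hU⟩ := hu.bodyVariation hm hz d₁ d₂ hev hM h1 h2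
  obtain ⟨s', A₃', A₄', B₃', B₄', hV⟩ := hv.bodyVariation hm hz d₁ d₂ hev hM h1 h2
  have hr := readsCoord_frameCoord hM.orth h1 h2 px1 px2
  obtain ⟨l0, l1, l2, l3, l4⟩ := hM.level_eqs hm hz hr
  rw [omega_eq_jacobi hm hu.1 hv.1, omegaRed]
  simp only [inner_eq_frame hM.orth]
  refine hU.symplectic hV hab ?_ ?_ ?_ ?_ ?_ ?_ ?_ ?_ ?_
  · rw [hx1]; rfl
  · rw [hx1]; rfl
  · rw [hx2]; rfl
  · rw [hx2]; rfl
  · rw [l0, L3, hr.x₁, hr.x₂, hr.y₁₀, hr.y₁₁, hr.y₂₀, hr.y₂₁]; rfl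
  · rw [← l1, hr.x₁, hr.x₂]; rfl
  · rw [← l2, hr.x₁, hr.x₂]; rfl
  · rw [← l3, hr.x₁, hr.x₂]; rfl
  · rw [← l4, hr.x₁, hr.x₂]; rfl

end Frame

end ThreeBody

end

/-! ### The smooth section. -/

noncomputable section

namespace ThreeBody

variable {m : Fin 3 → ℝ} {Λ N M : Matrix (Fin 4) (Fin 4) ℝ} {μ₁ μ₂ εd εs : ℝ} {w : Coord}

/-- The coordinates for which `A ≠ 0` and `|L₃| < μ₁ - μ₂`. -/
def regular (μ₁ μ₂ : ℝ) : Set Coord := {w | area w ≠ 0 ∧ |L3 w| < μ₁ - μ₂}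

lemma contDiff_coord_fst (k : Fin 4) : ContDiff ℝ ∞ fun w : Coord => w.1 k := by fun_prop

lemma contDiff_coord_snd (k : Fin 4) : ContDiff ℝ ∞ fun w : Coord => w.2 k := by fun_prop

lemma contDiff_area : ContDiff ℝ ∞ area := by
  unfold area
  fun_prop

lemma contDiff_L3 : ContDiff ℝ ∞ L3 := by
  unfold L3
  fun_prop

lemma isOpen_regular (μ₁ μ₂ : ℝ) : IsOpen (regular μ₁ μ₂) :=
  (isOpen_ne_fun contDiff_area.continuous continuous_const).inter
    (isOpen_lt contDiff_L3.continuous.abs continuous_const)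

/-- The frame of the section. -/
def sectionFrame (N : Matrix (Fin 4) (Fin 4) ℝ) (μ₁ μ₂ εd εs : ℝ) (w : Coord) :
    Matrix (Fin 4) (Fin 4) ℝ :=
  N * tiltRot
    ((-εd * Real.arccos (L3 w / (μ₁ - μ₂)) + -εs * Real.arccos (L3 w / (μ₁ + μ₂))) / 2)
    ((-εd * Real.arccos (L3 w / (μ₁ - μ₂)) - -εs * Real.arccos (L3 w / (μ₁ + μ₂))) / 2)

/-- An arccosine has nonnegative sine; the factor `-ε` gives the angle whose sine has the sign
opposite to that of the chosen root. -/
lemma arccos_signed {ε r x : ℝ} (hε : ε = 1 ∨ ε = -1) (hr : 0 < r) (hx : |x| ≤ r) :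
    r * Real.cos (-ε * Real.arccos (x / r)) = x ∧
    r * Real.sin (-ε * Real.arccos (x / r)) = -(ε * √(r ^ 2 - x ^ 2)) := by
  obtain ⟨h1, h2⟩ := abs_le.mp hx
  have hc : Real.cos (Real.arccos (x / r)) = x / r :=
    Real.cos_arccos (by rw [le_div_iff₀ hr]; linarith) (by rw [div_le_one hr]; exact h2)
  have hs : r * Real.sin (Real.arccos (x / r)) = √(r ^ 2 - x ^ 2) := by
    rw [Real.sin_arccos]
    nth_rewrite 1 [← Real.sqrt_sq hr.le]
    rw [← Real.sqrt_mul (by positivity)]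
    congr 1
    field_simp
  rcases hε with rfl | rfl
  · rw [neg_one_mul, Real.cos_neg, Real.sin_neg, hc, mul_neg, hs]
    exact ⟨by field_simp, by ring⟩
  · rw [neg_neg, one_mul, hc, hs]
    exact ⟨by field_simp, by ring⟩

lemma isSignedFrame_sectionFrame (hμ₂ : 0 ≤ μ₂) (hμ : μ₂ < μ₁) (hN : Nᵀ * N = 1)
    (hNΛ : Nᵀ * Λ * N = normalForm μ₁ μ₂) (hεd : εd = 1 ∨ εd = -1) (hεs : εs = 1 ∨ εs = -1)
    (hw : |L3 w| ≤ μ₁ - μ₂) :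
    IsSignedFrame μ₁ μ₂ εd εs Λ N (sectionFrame N μ₁ μ₂ εd εs w) w := by
  obtain ⟨h1, h2⟩ := arccos_signed hεd (by linarith) hw
  obtain ⟨h3, h4⟩ := arccos_signed (r := μ₁ + μ₂) hεs (by linarith) (by linarith)
  rw [sectionFrame]
  set σ := -εd * Real.arccos (L3 w / (μ₁ - μ₂))
  set δ := -εs * Real.arccos (L3 w / (μ₁ + μ₂))
  have hT := tiltRot_transpose_mul ((σ + δ) / 2) ((σ - δ) / 2)
  have hNT : Nᵀ * (N * tiltRot ((σ + δ) / 2) ((σ - δ) / 2)) =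
      tiltRot ((σ + δ) / 2) ((σ - δ) / 2) := by rw [← Matrix.mul_assoc, hN, Matrix.one_mul]
  refine ⟨?_, ?_, ?_⟩
  · rw [Matrix.transpose_mul, Matrix.mul_assoc, hNT, hT]
  · rw [hNT, det_tiltRot]
  · rw [conj_eq_of_normalForm hN hNΛ, hNT]
    -- Here `a - b = -L_d` and `-(a + b) = -L_s`, which explains the minus signs in front of both
    -- arccosines.
    exact tiltRot_conj_half h1 (by rw [h2, Ld]; ring) h3 (by rw [h4, Ls]; ring)

/-- The state with coordinates `w`, for a frame `M` with off-diagonal angular momenta `a`, `b`. -/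
def stateOf (m : Fin 3 → ℝ) (M : Matrix (Fin 4) (Fin 4) ℝ) (w : Coord) (a b : ℝ) : Phase :=
  ofJacobi m (act M (WithLp.toLp 2 ![w.1 0, w.1 1, 0, 0]))
    (act M (WithLp.toLp 2 ![w.1 2, w.1 3, 0, 0]))
    (act M (WithLp.toLp 2 ![w.2 0, w.2 1, -w.1 2 * b / (2 * area w), w.1 3 * a / (2 * area w)]))
    (act M (WithLp.toLp 2 ![w.2 2, w.2 3, w.1 0 * b / (2 * area w), -w.1 1 * a / (2 * area w)]))

/-- The normal components are those forced by `NormalMomenta`. It suffices to compare the angular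
momentum with `Λ` after conjugation by `M`, where the check is entrywise. -/
lemma stateOf_spec {a b : ℝ} (hm : ∀ i, 0 < m i) (hM : IsBodyFrame Λ N M (L3 w) a b)
    (hA : area w ≠ 0) :
    stateOf m M w a b ∈ level Λ ∧ ReadsCoord m M (stateOf m M w a b) w := by
  obtain ⟨j1, j2, j3, j4, j5⟩ := jacobi_ofJacobi hm
    (act M (WithLp.toLp 2 ![w.1 0, w.1 1, 0, 0])) (act M (WithLp.toLp 2 ![w.1 2, w.1 3, 0, 0]))
    (act M (WithLp.toLp 2 ![w.2 0, w.2 1, -w.1 2 * b / (2 * area w), w.1 3 * a / (2 * area w)]))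
    (act M (WithLp.toLp 2 ![w.2 2, w.2 3, w.1 0 * b / (2 * area w), -w.1 1 * a / (2 * area w)]))
  rw [← stateOf] at j1 j2 j3 j4 j5
  have hb : ∀ v : Fin 4 → ℝ, Mᵀ *ᵥ (act M (WithLp.toLp 2 v)).ofLp = v := fun v => by
    rw [ofLp_act]; exact transpose_mulVec_cancel hM.orth v
  constructor
  · refine ⟨j5, ?_⟩
    have hMM := mul_eq_one_comm.mp hM.orth
    have key : Mᵀ * angularMomentum (stateOf m M w a b) * M = Mᵀ * Λ * M := by
      rw [hM.form, angularMomentum_eq_jacobi hm j5, j1, j2, j3, j4]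
      ext i j
      rw [Matrix.mul_add, Matrix.add_mul, Matrix.add_apply, conj_wedge, conj_wedge]
      simp only [hb]
      have hD : 2 * area w = w.1 0 * w.1 3 - w.1 1 * w.1 2 := by rw [area]; ring
      have hD0 : 2 * area w ≠ 0 := mul_ne_zero two_ne_zero hA
      generalize 2 * area w = D at hD hD0
      fin_cases i <;> fin_cases j <;> simp [bodyForm, L3] <;> field_simp <;> (try rw [hD]) <;> ring
    have := congrArg (fun A => M * A * Mᵀ) key
    simpa only [← Matrix.mul_assoc, hMM, Matrix.one_mul, Matrix.mul_assoc _ M Mᵀ,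
      Matrix.mul_one] using this
  · constructor <;> simp only [j1, j2, j3, j4, hb] <;> rfl

/-- The section of the chart. -/
def sectionMap (m : Fin 3 → ℝ) (N : Matrix (Fin 4) (Fin 4) ℝ) (μ₁ μ₂ εd εs : ℝ) (w : Coord) :
    Phase :=
  stateOf m (sectionFrame N μ₁ μ₂ εd εs w) w ((Ls μ₁ μ₂ εs w - Ld μ₁ μ₂ εd w) / 2)
    ((Ls μ₁ μ₂ εs w + Ld μ₁ μ₂ εd w) / 2)

lemma contDiffAt_signed_sqrt {ε r : ℝ} (h : |L3 w| < r) :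
    ContDiffAt ℝ ∞ (fun w => ε * √(r ^ 2 - L3 w ^ 2)) w := by
  have : r ^ 2 - L3 w ^ 2 ≠ 0 := by
    have := sq_lt_sq' (neg_lt_of_abs_lt h) (lt_of_abs_lt h)
    linarith
  exact contDiffAt_const.mul ((contDiffAt_const.sub (contDiff_L3.contDiffAt.pow 2)).sqrt this)

lemma contDiffAt_arccos_L3 {r : ℝ} (h : |L3 w| < r) :
    ContDiffAt ℝ ∞ (fun w => Real.arccos (L3 w / r)) w := by
  have hr : 0 < r := (abs_nonneg _).trans_lt h
  obtain ⟨h1, h2⟩ := abs_lt.mp h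
  have e1 : L3 w / r ≠ -1 := by
    intro e; rw [div_eq_iff hr.ne'] at e; linarith
  have e2 : L3 w / r ≠ 1 := by
    intro e; rw [div_eq_iff hr.ne'] at e; linarith
  exact ContDiffAt.comp (g := Real.arccos) w (Real.contDiffAt_arccos e1 e2)
    (contDiff_L3.contDiffAt.div_const r)

lemma contDiffAt_sectionFrame (hμ₂ : 0 ≤ μ₂) (hw : |L3 w| < μ₁ - μ₂) (i j : Fin 4) :
    ContDiffAt ℝ ∞ (fun w => sectionFrame N μ₁ μ₂ εd εs w i j) w := by
  have h1 := contDiffAt_arccos_L3 hw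
  have h2 := contDiffAt_arccos_L3 (r := μ₁ + μ₂) (w := w) (by linarith)
  have s : ContDiffAt ℝ ∞ (fun w => (-εd * Real.arccos (L3 w / (μ₁ - μ₂)) +
      -εs * Real.arccos (L3 w / (μ₁ + μ₂))) / 2) w :=
    ((contDiffAt_const.mul h1).add (contDiffAt_const.mul h2)).div_const 2
  have d : ContDiffAt ℝ ∞ (fun w => (-εd * Real.arccos (L3 w / (μ₁ - μ₂)) -
      -εs * Real.arccos (L3 w / (μ₁ + μ₂))) / 2) w :=
    ((contDiffAt_const.mul h1).sub (contDiffAt_const.mul h2)).div_const 2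
  have e : ∀ i j, ContDiffAt ℝ ∞ (fun w => tiltRot
      ((-εd * Real.arccos (L3 w / (μ₁ - μ₂)) + -εs * Real.arccos (L3 w / (μ₁ + μ₂))) / 2)
      ((-εd * Real.arccos (L3 w / (μ₁ - μ₂)) - -εs * Real.arccos (L3 w / (μ₁ + μ₂))) / 2) i j) w := by
    intro i j
    fin_cases i <;> fin_cases j
    exacts [s.cos, contDiffAt_const, s.sin, contDiffAt_const, contDiffAt_const, d.cos,
      contDiffAt_const, d.sin, s.sin.neg, contDiffAt_const, s.cos, contDiffAt_const,
      contDiffAt_const, d.sin.neg, contDiffAt_const, d.cos]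
  simp only [sectionFrame, Matrix.mul_apply]
  exact ContDiffAt.sum fun k _ => contDiffAt_const.mul (e k j)

lemma contDiffAt_act_var {F : Type*} [NormedAddCommGroup F] [NormedSpace ℝ F]
    {A : F → Matrix (Fin 4) (Fin 4) ℝ} {v : F → Fin 4 → ℝ} {x : F}
    (hA : ∀ i j, ContDiffAt ℝ ∞ (fun y => A y i j) x) (hv : ∀ j, ContDiffAt ℝ ∞ (fun y => v y j) x) :
    ContDiffAt ℝ ∞ (fun y => act (A y) (WithLp.toLp 2 (v y))) x := by
  rw [contDiffAt_euclidean]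
  intro i
  simp only [ofLp_act, Matrix.mulVec, dotProduct]
  exact ContDiffAt.sum fun k _ => (hA i k).mul (hv k)

lemma contDiffAt_ofJacobi {F : Type*} [NormedAddCommGroup F] [NormedSpace ℝ F]
    {x₁ x₂ y₁ y₂ : F → E4} {x : F} (h1 : ContDiffAt ℝ ∞ x₁ x) (h2 : ContDiffAt ℝ ∞ x₂ x)
    (h3 : ContDiffAt ℝ ∞ y₁ x) (h4 : ContDiffAt ℝ ∞ y₂ x) :
    ContDiffAt ℝ ∞ (fun y => ofJacobi m (x₁ y) (x₂ y) (y₁ y) (y₂ y)) x := by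
  refine ContDiffAt.prodMk (contDiffAt_pi.mpr fun i => ?_) (contDiffAt_pi.mpr fun i => ?_)
  · fin_cases i
    exacts [h2, h1.const_smul _, h1.const_smul _]
  · fin_cases i
    exacts [h4, h3.sub (h4.const_smul _), h3.neg.sub (h4.const_smul _)]

lemma contDiffAt_sectionMap (hμ₂ : 0 ≤ μ₂) (hw : w ∈ regular μ₁ μ₂) :
    ContDiffAt ℝ ∞ (sectionMap m N μ₁ μ₂ εd εs) w := by
  have hF := contDiffAt_sectionFrame (N := N) (εd := εd) (εs := εs) hμ₂ hw.2
  have hd : ContDiffAt ℝ ∞ (Ld μ₁ μ₂ εd) w := contDiffAt_signed_sqrt hw.2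
  have hs : ContDiffAt ℝ ∞ (Ls μ₁ μ₂ εs) w :=
    contDiffAt_signed_sqrt (hw.2.trans_le (by linarith))
  have ha := (hs.sub hd).div_const 2
  have hb := (hs.add hd).div_const 2
  have hA : ContDiffAt ℝ ∞ (fun w => 2 * area w) w := contDiffAt_const.mul contDiff_area.contDiffAt
  have hA0 : 2 * area w ≠ 0 := mul_ne_zero two_ne_zero hw.1
  have q := fun k => (contDiff_coord_fst k).contDiffAt (x := w)
  have p := fun k => (contDiff_coord_snd k).contDiffAt (x := w)
  refine contDiffAt_ofJacobi (contDiffAt_act_var hF fun j => ?_)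
    (contDiffAt_act_var hF fun j => ?_) (contDiffAt_act_var hF fun j => ?_)
    (contDiffAt_act_var hF fun j => ?_)
  · fin_cases j
    exacts [q 0, q 1, contDiffAt_const, contDiffAt_const]
  · fin_cases j
    exacts [q 2, q 3, contDiffAt_const, contDiffAt_const]
  · fin_cases j
    exacts [p 0, p 1, ((q 2).neg.mul hb).div hA hA0, ((q 3).mul ha).div hA hA0]
  · fin_cases j
    exacts [p 2, p 3, ((q 0).mul hb).div hA hA0, ((q 1).neg.mul ha).div hA hA0]

end ThreeBody

end

/-! ### Newton's equations and Hamilton's equations. -/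

noncomputable section

namespace ThreeBody

variable {m : Fin 3 → ℝ} {W : ℝ × ℝ × ℝ → ℝ} {Λ N M : Matrix (Fin 4) (Fin 4) ℝ}
  {z z' u : Phase} {w : Coord}

lemma wedge_act (R : Matrix (Fin 4) (Fin 4) ℝ) (x y : E4) :
    wedge (act R x) (act R y) = R * wedge x y * Rᵀ := by
  simp only [wedge, ofLp_act, Matrix.mul_sub, Matrix.sub_mul, Matrix.mul_vecMulVec,
    Matrix.vecMulVec_mul, Matrix.vecMul_transpose]

/-- Jacobi vectors do not see translations, and the rotation conjugates the angular momentum, hence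
fixes its value `Λ`. -/
lemma SameOrbit.mem_level (hm : ∀ i, 0 < m i) (h : SameOrbit Λ z z') (hz : z ∈ level Λ) :
    z' ∈ level Λ := by
  obtain ⟨R, hR, hRΛ, h1, h2, h3, h4⟩ := h.jacobi (m := m) hm
  have hP : ∑ i, z'.2 i = 0 := by
    obtain ⟨R, -, -, c, h⟩ := h
    simp only [← act_apply] at h
    rw [Finset.sum_congr rfl fun i _ => (h i).2, ← map_sum, hz.1, map_zero]
  refine ⟨hP, ?_⟩
  rw [angularMomentum_eq_jacobi hm hP, h1, h2, h3, h4, wedge_act, wedge_act, ← Matrix.add_mul,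
    ← Matrix.mul_add, ← angularMomentum_eq_jacobi hm hz.1, hz.2, hRΛ]

lemma differentiable_angularMomentum (j k : Fin 4) :
    Differentiable ℝ fun z : Phase => angularMomentum z j k := by
  have hp : ∀ i l, Differentiable ℝ fun z' : Phase => z'.1 i l := fun i l =>
    ((EuclideanSpace.proj (𝕜 := ℝ) l).comp (posL i)).differentiable
  have hq : ∀ i l, Differentiable ℝ fun z' : Phase => z'.2 i l := fun i l =>
    ((EuclideanSpace.proj (𝕜 := ℝ) l).comp (momL i)).differentiable
  have e : (fun z : Phase => angularMomentum z j k) = fun z : Phase =>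
      ∑ i, (z.1 i j * z.2 i k - z.2 i j * z.1 i k) := by
    ext z'
    simp [angularMomentum, wedge, Matrix.sum_apply, Matrix.vecMulVec_apply]
  rw [e]
  exact Differentiable.fun_sum fun i _ => ((hp i j).mul (hq i k)).sub ((hq i j).mul (hp i k))

/-- Derivatives of maps into the level set are tangent to it. -/
lemma tangentToLevel_fderiv {E : Type*} [NormedAddCommGroup E] [NormedSpace ℝ E] {f : E → Phase}
    {x : E} (hf : DifferentiableAt ℝ f x) (h : ∀ᶠ y in 𝓝 x, f y ∈ level Λ) (b : E) :
    TangentToLevel (f x) (fderiv ℝ f x b) := by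
  constructor
  · have h0 : (fun y => ∑ i, (f y).2 i) =ᶠ[𝓝 x] fun _ => 0 := h.mono fun y hy => hy.1
    have hd : HasFDerivAt (fun y => (∑ i, momL i) (f y)) ((∑ i, momL i).comp (fderiv ℝ f x)) x :=
      (∑ i, momL i).hasFDerivAt.comp x hf.hasFDerivAt
    have e : (fun y => (∑ i, momL i) (f y)) = fun y => ∑ i, (f y).2 i := by
      ext1 y; rw [sum_apply]; rfl
    rw [e] at hd
    have := congrArg (fun L => L b) (hd.unique ((hasFDerivAt_const 0 x).congr_of_eventuallyEq h0))
    simpa [sum_apply, momL] using this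
  · intro j k
    have h0 : (fun y => angularMomentum (f y) j k) =ᶠ[𝓝 x] fun _ => Λ j k :=
      h.mono fun y hy => by simp only [hy.2]
    have hd := (differentiable_angularMomentum j k (f x)).hasFDerivAt.comp x hf.hasFDerivAt
    exact congrArg (fun L => L b)
      (hd.unique ((hasFDerivAt_const (Λ j k) x).congr_of_eventuallyEq h0))

lemma fderiv_potential {r : Fin 3 → E4} (hd : DifferentiableAt ℝ (potential W) r)
    (v : Fin 3 → E4) : fderiv ℝ (potential W) r v =
      ∑ i, inner ℝ (gradient (fun x : E4 => potential W (Function.update r i x)) (r i)) (v i) := by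
  have hv : v = ∑ i, Pi.single i (v i) := (Finset.univ_sum_single v).symm
  nth_rewrite 1 [hv]
  rw [map_sum]
  refine Finset.sum_congr rfl fun i _ => ?_
  have hu := hasFDerivAt_update (𝕜 := ℝ) r (i := i) (r i)
  have hd' : HasFDerivAt (potential W) (fderiv ℝ (potential W) r) (Function.update r i (r i)) := by
    rw [Function.update_eq_self]; exact hd.hasFDerivAt
  have hc := hd'.comp (r i) hu
  have hg : HasGradientAt (fun x : E4 => potential W (Function.update r i x))
      (gradient (fun x : E4 => potential W (Function.update r i x)) (r i)) (r i) :=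
    hc.differentiableAt.hasGradientAt
  have := congrArg (fun L => L (v i)) (hg.hasFDerivAt.unique hc)
  simp only [InnerProductSpace.toDual_apply_apply, ContinuousLinearMap.comp_apply] at this
  rw [this]
  congr 1
  ext j
  by_cases hj : j = i
  · subst hj; simp
  · simp [hj]

lemma hasFDerivAt_hamiltonian (hd : DifferentiableAt ℝ (potential W) z.1) :
    ∃ L : Phase →L[ℝ] ℝ, HasFDerivAt (hamiltonian m W) L z ∧ ∀ v, L v =
      ∑ i, (m i)⁻¹ * inner ℝ (z.2 i) (v.2 i) + fderiv ℝ (potential W) z.1 v.1 := by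
  have hk : ∀ i : Fin 3, HasFDerivAt (fun z : Phase => ‖momL i z‖ ^ 2)
      (2 • (innerSL ℝ (momL i z)).comp (momL i)) z := fun i => (momL i).hasFDerivAt.norm_sq
  have hp : HasFDerivAt (fun z : Phase => potential W z.1) ((fderiv ℝ (potential W) z.1).comp
      (ContinuousLinearMap.fst ℝ (Fin 3 → E4) (Fin 3 → E4))) z :=
    HasFDerivAt.comp (g := potential W) z hd.hasFDerivAt hasFDerivAt_fst
  have h := (HasFDerivAt.fun_sum fun i (_ : i ∈ Finset.univ) =>
    (hk i).mul_const (2 * m i)⁻¹).add hp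
  refine ⟨_, h, fun v => ?_⟩
  simp [momL, Fin.sum_univ_three]
  ring

/-- Newton's equations in Hamiltonian form. -/
lemma SatisfiesNewtonAt.hamiltonian {γ : ℝ → Phase} {t : ℝ} (h : SatisfiesNewtonAt m W γ t)
    (hd : DifferentiableAt ℝ (potential W) (γ t).1) :
    ∃ g : Phase, HasDerivAt γ g t ∧
      ∀ v, fderiv ℝ (hamiltonian m W) (γ t) v = omega g v := by
  refine ⟨(fun i => (m i)⁻¹ • (γ t).2 i, fun i => -gradient
    (fun x : E4 => potential W (Function.update (γ t).1 i x)) ((γ t).1 i)), ?_, fun v => ?_⟩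
  · exact (hasDerivAt_pi.mpr fun i => (h i).1).prodMk (hasDerivAt_pi.mpr fun i => (h i).2)
  · obtain ⟨L, hL, hLv⟩ := hasFDerivAt_hamiltonian (m := m) hd
    rw [hL.fderiv, hLv, fderiv_potential hd, omega, ← Finset.sum_add_distrib]
    refine Finset.sum_congr rfl fun i _ => ?_
    simp only [real_inner_smul_left, inner_neg_left]
    ring

/-- The differences of positions are nontrivial combinations of `x₁`, `x₂`, which are independent
when `A ≠ 0`. Collisions are thus excluded and the potential is differentiable. -/
lemma ReadsCoord.separated (hm : ∀ i, 0 < m i) (h : ReadsCoord m M z w)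
    (hA : area w ≠ 0) : z.1 1 - z.1 2 ≠ 0 ∧ z.1 2 - z.1 0 ≠ 0 ∧ z.1 0 - z.1 1 ≠ 0 := by
  have key : ∀ s t : ℝ, (s ≠ 0 ∨ t ≠ 0) → s • jacobiX1 z + t • jacobiX2 m z ≠ 0 := by
    intro s t hst h0
    have h1 := congrArg (fun x : E4 => Mᵀ *ᵥ x.ofLp) h0
    simp only [WithLp.ofLp_add, WithLp.ofLp_smul, Matrix.mulVec_add, Matrix.mulVec_smul, h.x₁,
      h.x₂] at h1
    have e0 := congrFun h1 0
    have e1 := congrFun h1 1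
    simp at e0 e1
    have hs : 2 * s * area w = 0 := by rw [area]; linear_combination w.1 3 * e0 - w.1 2 * e1
    have ht : 2 * t * area w = 0 := by rw [area]; linear_combination w.1 0 * e1 - w.1 1 * e0
    have hs' := (mul_eq_zero.mp hs).resolve_right hA
    have ht' := (mul_eq_zero.mp ht).resolve_right hA
    rcases hst with h | h
    · exact h (by linarith)
    · exact h (by linarith)
  obtain ⟨p1, p2⟩ := position_eq_jacobi hm z
  refine ⟨?_, ?_, ?_⟩
  · have := key 1 0 (Or.inl one_ne_zero)
    rwa [one_smul, zero_smul, add_zero] at this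
  · have := key (-(m 1 / (m 1 + m 2))) (-1) (Or.inr (by norm_num))
    intro h0
    apply this
    rw [← h0, p2]
    module
  · have := key (-(m 2 / (m 1 + m 2))) 1 (Or.inr one_ne_zero)
    intro h0
    apply this
    rw [← h0, p1]
    module

lemma differentiableAt_potential
    (hW : ContDiffOn ℝ ∞ W (Set.Ioi 0 ×ˢ Set.Ioi 0 ×ˢ Set.Ioi 0)) {r : Fin 3 → E4}
    (h1 : r 1 - r 2 ≠ 0) (h2 : r 2 - r 0 ≠ 0) (h3 : r 0 - r 1 ≠ 0) :
    DifferentiableAt ℝ (potential W) r := by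
  have ho : IsOpen ((Set.Ioi 0 ×ˢ Set.Ioi 0 ×ˢ Set.Ioi 0 : Set (ℝ × ℝ × ℝ))) :=
    isOpen_Ioi.prod (isOpen_Ioi.prod isOpen_Ioi)
  have hmem : (‖r 1 - r 2‖, ‖r 2 - r 0‖, ‖r 0 - r 1‖) ∈
      (Set.Ioi 0 ×ˢ Set.Ioi 0 ×ˢ Set.Ioi 0 : Set (ℝ × ℝ × ℝ)) :=
    ⟨norm_pos_iff.mpr h1, norm_pos_iff.mpr h2, norm_pos_iff.mpr h3⟩
  have hw : DifferentiableAt ℝ W (‖r 1 - r 2‖, ‖r 2 - r 0‖, ‖r 0 - r 1‖) :=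
    (hW.contDiffAt (ho.mem_nhds hmem)).differentiableAt (by simp)
  have hp : ∀ i, DifferentiableAt ℝ (fun r : Fin 3 → E4 => r i) r := fun i =>
    differentiableAt_apply i r
  have hn : DifferentiableAt ℝ (fun r : Fin 3 → E4 =>
      (‖r 1 - r 2‖, ‖r 2 - r 0‖, ‖r 0 - r 1‖)) r :=
    (((hp 1).sub (hp 2)).norm ℝ h1).prodMk
      ((((hp 2).sub (hp 0)).norm ℝ h2).prodMk (((hp 0).sub (hp 1)).norm ℝ h3))
  exact DifferentiableAt.comp (g := W) r hw hn

/-- The energy function of a chart generates the projected motions. -/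
theorem IsReducedChart.motion {O : Set Phase} {χ : Phase → Coord} {V : Set Coord}
    {s : Coord → Phase} {h : Coord → ℝ} (hm : ∀ i, 0 < m i) (hc : IsReducedChart Λ O χ V s)
    (hE : ∀ z ∈ O ∩ level Λ, hamiltonian m W z = h (χ z))
    (hd : ∀ z ∈ O ∩ level Λ, DifferentiableAt ℝ (potential W) z.1)
    (γ : ℝ → Phase) (a b : ℝ)
    (hγ : ∀ t ∈ Set.Ioo a b, γ t ∈ O ∩ level Λ ∧ SatisfiesNewtonAt m W γ t)
    (t : ℝ) (ht : t ∈ Set.Ioo a b) : SatisfiesHamiltonAt h (fun τ => χ (γ τ)) t := by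
  obtain ⟨hz, hN⟩ := hγ t ht
  obtain ⟨g, hg, hω⟩ := hN.hamiltonian (hd _ hz)
  have hw : χ (γ t) ∈ V := hc.mapsTo _ hz
  have hVn : V ∈ 𝓝 (χ (γ t)) := hc.isOpen_target.mem_nhds hw
  have hχ : DifferentiableAt ℝ χ (γ t) :=
    (hc.smooth.contDiffAt (hc.isOpen_source.mem_nhds hz.1)).differentiableAt (by simp)
  have hs : DifferentiableAt ℝ s (χ (γ t)) :=
    (hc.smooth_section.contDiffAt hVn).differentiableAt (by simp)
  obtain ⟨R, hR, hRΛ, d, hRd⟩ := (hc.eq_iff _ (hc.section_mem _ hw) _ hz).mp (hc.right_inv _ hw)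
  simp only [← act_apply] at hRd
  -- The section moved by one fixed group element so that it passes through `γ t`. It remains a
  -- section of `χ` inside the level set.
  let σ : Coord → Phase := fun w =>
    (fun i => act R ((s w).1 i) + d, fun i => act R ((s w).2 i))
  have hσz : σ (χ (γ t)) = γ t :=
    Prod.ext (funext fun i => (hRd i).1.symm) (funext fun i => (hRd i).2.symm)
  have horb : ∀ w, SameOrbit Λ (s w) (σ w) := fun w => ⟨R, hR, hRΛ, d, fun i => ⟨rfl, rfl⟩⟩
  have hσO : ∀ w ∈ V, σ w ∈ O ∩ level Λ := fun w hw =>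
    ⟨hc.invariant _ (hc.section_mem w hw).1 _ (horb w), (horb w).mem_level hm
      (hc.section_mem w hw).2⟩
  have hσχ : ∀ w ∈ V, χ (σ w) = w := fun w hw => by
    rw [← (hc.eq_iff _ (hc.section_mem w hw) _ (hσO w hw)).mpr (horb w), hc.right_inv w hw]
  have hσ : DifferentiableAt ℝ σ (χ (γ t)) := by
    refine DifferentiableAt.prodMk (differentiableAt_pi.mpr fun i => ?_)
      (differentiableAt_pi.mpr fun i => ?_)
    · exact ((act R).differentiableAt.comp _ ((posL i).differentiableAt.comp _ hs)).add_const d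
    · exact (act R).differentiableAt.comp _ ((momL i).differentiableAt.comp _ hs)
  have tg : TangentToLevel (γ t) g := by
    have := tangentToLevel_fderiv (Λ := Λ) hg.differentiableAt
      ((isOpen_Ioo.mem_nhds ht |> Filter.eventually_of_mem) fun τ hτ => (hγ τ hτ).1.2) 1
    rwa [fderiv_apply_one_eq_deriv, hg.deriv] at this
  have hcγ : HasDerivAt (fun τ => χ (γ τ)) (fderiv ℝ χ (γ t) g) t :=
    hχ.hasFDerivAt.comp_hasDerivAt t hg
  -- With `X` the velocity of `γ`: `dh(b) = dH(σ' b) = ω(X, σ' b) = ω_red(χ' X, χ' σ' b)`, and `χ'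
  -- σ' b = b`. Both arguments of `ω` are tangent to the level set.
  have key : ∀ b, fderiv ℝ h (χ (γ t)) b = omegaRed (fderiv ℝ χ (γ t) g) b := by
    intro b
    have tv : TangentToLevel (γ t) (fderiv ℝ σ (χ (γ t)) b) := by
      have := tangentToLevel_fderiv (Λ := Λ) hσ
        (Filter.eventually_of_mem hVn fun w hw => (hσO w hw).2) b
      rwa [hσz] at this
    have e1 : fderiv ℝ χ (γ t) (fderiv ℝ σ (χ (γ t)) b) = b := by
      have hχ' : HasFDerivAt χ (fderiv ℝ χ (γ t)) (σ (χ (γ t))) := by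
        rw [hσz]; exact hχ.hasFDerivAt
      have h1 := hχ'.comp (χ (γ t)) hσ.hasFDerivAt
      have h2 : HasFDerivAt (χ ∘ σ) (ContinuousLinearMap.id ℝ Coord) (χ (γ t)) :=
        (hasFDerivAt_id _).congr_of_eventuallyEq (Filter.eventually_of_mem hVn hσχ)
      exact congrArg (fun L => L b) (h1.unique h2)
    have e2 : fderiv ℝ h (χ (γ t)) b =
        fderiv ℝ (hamiltonian m W) (γ t) (fderiv ℝ σ (χ (γ t)) b) := by
      obtain ⟨L, hL, -⟩ := hasFDerivAt_hamiltonian (m := m) (hd _ hz)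
      have hH : HasFDerivAt (hamiltonian m W) L (σ (χ (γ t))) := by rw [hσz]; exact hL
      have h1 := hH.comp (χ (γ t)) hσ.hasFDerivAt
      have h2 : h =ᶠ[𝓝 (χ (γ t))] hamiltonian m W ∘ σ :=
        Filter.eventually_of_mem hVn fun w hw => by
          rw [Function.comp_apply, hE _ (hσO w hw), hσχ w hw]
      rw [(h1.congr_of_eventuallyEq h2).fderiv, hL.fderiv]
      rfl
    rw [e2, hω, hc.symplectic _ hz _ _ tg tv, e1]
  intro k
  have hpq := fun k : Fin 4 => (hasDerivAt_pi.mp hcγ.fst k)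
  have hpp := fun k : Fin 4 => (hasDerivAt_pi.mp hcγ.snd k)
  constructor
  · have e : fderiv ℝ h (χ (γ t)) (0, Pi.single k 1) = (fderiv ℝ χ (γ t) g).1 k := by
      rw [key]; simp [omegaRed, Pi.single_apply]
    rw [e]
    exact hpq k
  · have e : -fderiv ℝ h (χ (γ t)) (Pi.single k 1, 0) = (fderiv ℝ χ (γ t) g).2 k := by
      rw [key]; simp [omegaRed, Pi.single_apply]
    rw [e]
    exact hpp k

end ThreeBody

end

/-! ### The charts. -/

noncomputable section

namespace ThreeBody

variable {m : Fin 3 → ℝ} {W : ℝ × ℝ × ℝ → ℝ} {Λ N M : Matrix (Fin 4) (Fin 4) ℝ}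
  {μ₁ μ₂ εd εs ε : ℝ} {k l : ℝ × ℝ} {z z' u v : Phase} {w : Coord}

/-- A linear combination of the Jacobi vectors `x₁`, `x₂`. -/
def jacobiComb (m : Fin 3 → ℝ) (k : ℝ × ℝ) : Phase →L[ℝ] E4 := k.1 • jacobiX1L + k.2 • jacobiX2L m

lemma jacobiComb_apply (m : Fin 3 → ℝ) (k : ℝ × ℝ) (z : Phase) :
    jacobiComb m k z = k.1 • jacobiX1 z + k.2 • jacobiX2 m z := rfl

/-- The domain of the chart: the states for which the two combinations of the Jacobi vectors are
separated by `‖Λ ·‖²`. -/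
def chartSource (m : Fin 3 → ℝ) (Λ : Matrix (Fin 4) (Fin 4) ℝ) (ε : ℝ) (k l : ℝ × ℝ) : Set Phase :=
  {z | 0 < ε * gap Λ (jacobiComb m k z) (jacobiComb m l z)}

/-- The coordinates of a state with respect to its principal directions. -/
def chartMap (m : Fin 3 → ℝ) (Λ : Matrix (Fin 4) (Fin 4) ℝ) (k l : ℝ × ℝ) (z : Phase) : Coord :=
  frameCoord m (prin₁ Λ (jacobiComb m k z) (jacobiComb m l z))
    (prin₂ Λ (jacobiComb m k z) (jacobiComb m l z)) z

/-- The coordinates for which the frame is close to the given combinations of the Jacobi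
vectors. -/
def wellTurned (k l : ℝ × ℝ) : Set Coord :=
  {w | 0 < k.1 * w.1 0 + k.2 * w.1 2 ∧
    0 < (k.1 * w.1 0 + k.2 * w.1 2) * (l.1 * w.1 1 + l.2 * w.1 3) -
      (k.1 * w.1 1 + k.2 * w.1 3) * (l.1 * w.1 0 + l.2 * w.1 2)}

/-- The image of the chart. -/
def chartTarget (m : Fin 3 → ℝ) (Λ N : Matrix (Fin 4) (Fin 4) ℝ) (μ₁ μ₂ εd εs : ℝ)
    (k l : ℝ × ℝ) : Set Coord :=
  regular μ₁ μ₂ ∩ sectionMap m N μ₁ μ₂ εd εs ⁻¹' chartSource m Λ (εd * εs) k l ∩ wellTurned k l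

lemma isOpen_chartSource : IsOpen (chartSource m Λ ε k l) := by
  refine isOpen_lt continuous_const (continuous_const.mul ?_)
  exact continuous_iff_continuousAt.mpr fun z => (contDiffAt_gap Λ
    (jacobiComb m k).contDiff.contDiffAt (jacobiComb m l).contDiff.contDiffAt).continuousAt

lemma isOpen_wellTurned : IsOpen (wellTurned k l) := by
  unfold wellTurned
  exact IsOpen.and (isOpen_lt (by fun_prop) (by fun_prop)) (isOpen_lt (by fun_prop) (by fun_prop))

/-- The section is shown to be continuous only on `regular`, so its preimage is open only after
intersection with this open set. -/
lemma isOpen_chartTarget (hμ₂ : 0 ≤ μ₂) : IsOpen (chartTarget m Λ N μ₁ μ₂ εd εs k l) := by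
  have hc : ContinuousOn (sectionMap m N μ₁ μ₂ εd εs) (regular μ₁ μ₂) := fun w hw =>
    (contDiffAt_sectionMap hμ₂ hw).continuousAt.continuousWithinAt
  exact (hc.isOpen_inter_preimage (isOpen_regular μ₁ μ₂) isOpen_chartSource).inter
    isOpen_wellTurned

lemma SameOrbit.chart (hm : ∀ i, 0 < m i) (h : SameOrbit Λ z z') :
    (z ∈ chartSource m Λ ε k l → z' ∈ chartSource m Λ ε k l) ∧
      chartMap m Λ k l z' = chartMap m Λ k l z := by
  obtain ⟨R, hR, hRΛ, h1, h2, h3, h4⟩ := h.jacobi (m := m) hm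
  have hR' : Rᵀ * R = 1 := (Matrix.mem_orthogonalGroup_iff' (Fin 4) ℝ).mp
    (Matrix.mem_specialOrthogonalGroup_iff.mp hR).1
  have e : ∀ k, jacobiComb m k z' = act R (jacobiComb m k z) := fun k => by
    rw [jacobiComb_apply, jacobiComb_apply, h1, h2, map_add, map_smul, map_smul]
  obtain ⟨p1, p2⟩ := prin_act hR' hRΛ (jacobiComb m k z) (jacobiComb m l z)
  constructor
  · intro hz
    rw [chartSource, Set.mem_ofPred_eq, e, e, gap_act hR' hRΛ]
    exact hz
  · rw [chartMap, chartMap, e, e, p1, p2, frameCoord, h1, h2, h3, h4]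
    simp only [act_isometry hR']
    rfl

lemma contDiffAt_chart_prin (hz : z ∈ chartSource m Λ ε k l) :
    ContDiffAt ℝ ∞ (fun z => prin₁ Λ (jacobiComb m k z) (jacobiComb m l z)) z ∧
    ContDiffAt ℝ ∞ (fun z => prin₂ Λ (jacobiComb m k z) (jacobiComb m l z)) z :=
  contDiffAt_prin (jacobiComb m k).contDiff.contDiffAt (jacobiComb m l).contDiff.contDiffAt hz

lemma contDiffAt_chartMap (hz : z ∈ chartSource m Λ ε k l) :
    ContDiffAt ℝ ∞ (chartMap m Λ k l) z := by
  obtain ⟨h1, h2⟩ := contDiffAt_chart_prin hz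
  have x1 : ContDiffAt ℝ ∞ jacobiX1 z := jacobiX1L.contDiff.contDiffAt
  have x2 : ContDiffAt ℝ ∞ (jacobiX2 m) z := (jacobiX2L m).contDiff.contDiffAt
  have y1 : ContDiffAt ℝ ∞ (jacobiY1 m) z := (jacobiY1L m).contDiff.contDiffAt
  have y2 : ContDiffAt ℝ ∞ (jacobiY2 m) z := (jacobiY2L m).contDiff.contDiffAt
  refine ContDiffAt.prodMk (contDiffAt_pi.mpr fun i => ?_) (contDiffAt_pi.mpr fun i => ?_)
  · fin_cases i
    exacts [h1.inner ℝ x1, h2.inner ℝ x1, h1.inner ℝ x2, h2.inner ℝ x2]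
  · fin_cases i
    exacts [h1.inner ℝ y1, h2.inner ℝ y1, h1.inner ℝ y2, h2.inner ℝ y2]

lemma inPlane_of_mem_chartSource (hkl : k.1 * l.2 - k.2 * l.1 ≠ 0)
    (hz : z ∈ chartSource m Λ ε k l) :
    InPlane (prin₁ Λ (jacobiComb m k z) (jacobiComb m l z))
      (prin₂ Λ (jacobiComb m k z) (jacobiComb m l z)) (jacobiX1 z) ∧
    InPlane (prin₁ Λ (jacobiComb m k z) (jacobiComb m l z))
      (prin₂ Λ (jacobiComb m k z) (jacobiComb m l z)) (jacobiX2 m z) := by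
  obtain ⟨c1, c2, -⟩ := prin_coeffs hz
  have e1 : (k.1 * l.2 - k.2 * l.1) • jacobiX1 z =
      l.2 • jacobiComb m k z + (-k.2) • jacobiComb m l z := by
    rw [jacobiComb_apply, jacobiComb_apply]; module
  have e2 : (k.1 * l.2 - k.2 * l.1) • jacobiX2 m z =
      (-l.1) • jacobiComb m k z + k.1 • jacobiComb m l z := by
    rw [jacobiComb_apply, jacobiComb_apply]; module
  have h1 : jacobiX1 z = ((k.1 * l.2 - k.2 * l.1)⁻¹ * l.2) • jacobiComb m k z +
      ((k.1 * l.2 - k.2 * l.1)⁻¹ * -k.2) • jacobiComb m l z := by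
    rw [mul_smul, mul_smul, ← smul_add, ← e1, inv_smul_smul₀ hkl]
  have h2 : jacobiX2 m z = ((k.1 * l.2 - k.2 * l.1)⁻¹ * -l.1) • jacobiComb m k z +
      ((k.1 * l.2 - k.2 * l.1)⁻¹ * k.1) • jacobiComb m l z := by
    rw [mul_smul, mul_smul, ← smul_add, ← e2, inv_smul_smul₀ hkl]
  rw [h1, h2]
  exact ⟨c1.comb c2 _ _, c1.comb c2 _ _⟩

lemma chartMap_mem_wellTurned (hz : z ∈ chartSource m Λ ε k l) :
    chartMap m Λ k l z ∈ wellTurned k l := by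
  obtain ⟨-, -, c1, c2⟩ := prin_coeffs hz
  have e : ∀ (x : E4) (k : ℝ × ℝ), inner ℝ x (jacobiComb m k z) =
      k.1 * inner ℝ x (jacobiX1 z) + k.2 * inner ℝ x (jacobiX2 m z) := fun x k => by
    rw [jacobiComb_apply, inner_add_right, real_inner_smul_right, real_inner_smul_right]
  rw [e] at c1
  rw [e, e, e, e] at c2
  exact ⟨c1, c2⟩

/-- The positive determinant in `wellTurned` is `2A` times the determinant of `k`, `l`. -/
lemma area_ne_zero_of_wellTurned (hw : w ∈ wellTurned k l) : area w ≠ 0 := by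
  intro h
  have := hw.2
  have e : (k.1 * w.1 0 + k.2 * w.1 2) * (l.1 * w.1 1 + l.2 * w.1 3) -
      (k.1 * w.1 1 + k.2 * w.1 3) * (l.1 * w.1 0 + l.2 * w.1 2) =
      2 * (k.1 * l.2 - k.2 * l.1) * area w := by rw [area]; ring
  rw [e, h, mul_zero] at this
  exact lt_irrefl _ this

/-- The plane of the bodies in a signed frame. -/
lemma IsSignedFrame.exists_principal (hμ₂ : 0 ≤ μ₂) (hεd : εd = 1 ∨ εd = -1)
    (hεs : εs = 1 ∨ εs = -1) (hM : IsSignedFrame μ₁ μ₂ εd εs Λ N M w) (h : ReadsCoord m M z w)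
    (hw : |L3 w| < μ₁ - μ₂) :
    ∃ e₁ e₂, IsPrincipal Λ e₁ e₂ ∧ 0 < εd * εs * (‖act Λ e₂‖ ^ 2 - ‖act Λ e₁‖ ^ 2) ∧
      jacobiX1 z = w.1 0 • e₁ + w.1 1 • e₂ ∧ jacobiX2 m z = w.1 2 • e₁ + w.1 3 • e₂ ∧
      frameCoord m e₁ e₂ z = w := by
  have o : Mᵀ * M = 1 := hM.orth
  set e₁ : E4 := act M (WithLp.toLp 2 ![1, 0, 0, 0]) with he₁
  set e₂ : E4 := act M (WithLp.toLp 2 ![0, 1, 0, 0]) with he₂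
  have h1 : Mᵀ *ᵥ e₁.ofLp = ![1, 0, 0, 0] := transpose_mulVec_cancel o _
  have h2 : Mᵀ *ᵥ e₂.ofLp = ![0, 1, 0, 0] := transpose_mulVec_cancel o _
  obtain ⟨n1, n2, n12⟩ := IsBodyFrame.norm_act hM h1 h2
  have hv : ∀ (x : E4) (s t : ℝ), Mᵀ *ᵥ x.ofLp = ![s, t, 0, 0] → x = s • e₁ + t • e₂ := by
    intro x s t hx
    have e : act M (WithLp.toLp 2 (Mᵀ *ᵥ x.ofLp)) = x := by
      rw [act_apply]
      exact congrArg (WithLp.toLp 2) (mulVec_transpose_cancel o x.ofLp)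
    rw [← e, hx, he₁, he₂, ← map_smul, ← map_smul, ← map_add]
    congr 1
    ext i; fin_cases i <;> simp
  have hd : 0 < √((μ₁ - μ₂) ^ 2 - L3 w ^ 2) := Real.sqrt_pos.mpr (by
    have := sq_lt_sq' (neg_lt_of_abs_lt hw) (lt_of_abs_lt hw)
    linarith)
  have hw' : |L3 w| < μ₁ + μ₂ := by linarith
  have hs : 0 < √((μ₁ + μ₂) ^ 2 - L3 w ^ 2) := Real.sqrt_pos.mpr (by
    have := sq_lt_sq' (neg_lt_of_abs_lt hw') (lt_of_abs_lt hw')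
    linarith)
  refine ⟨e₁, e₂, ⟨?_, ?_, ?_, n12⟩, ?_, hv _ _ _ h.x₁, hv _ _ _ h.x₂, ?_⟩
  · rw [inner_eq_frame o, h1]; simp
  · rw [inner_eq_frame o, h2]; simp
  · rw [inner_eq_frame o, h1, h2]; simp
  · have e : εd * εs * (‖act Λ e₂‖ ^ 2 - ‖act Λ e₁‖ ^ 2) = εd ^ 2 * εs ^ 2 *
        (√((μ₁ - μ₂) ^ 2 - L3 w ^ 2) * √((μ₁ + μ₂) ^ 2 - L3 w ^ 2)) := by
      rw [n1, n2, Ld, Ls]; ring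
    rw [e, sq_eq_one_iff.mpr hεd, sq_eq_one_iff.mpr hεs]
    positivity
  · have f := vec_frame o h1 h2
    rw [frameCoord]
    simp only [← (f _).1, ← (f _).2, h.x₁, h.x₂, h.y₁₀, h.y₁₁, h.y₂₀, h.y₂₁]
    exact Prod.ext (vec_eta w.1).symm (vec_eta w.2).symm

/-- By `prin_unique`, the chart recovers the first two vectors of the signed frame; `wellTurned`
supplies the sign and orientation conditions. -/
lemma IsSignedFrame.chartMap_eq (hμ₂ : 0 ≤ μ₂) (hεd : εd = 1 ∨ εd = -1)
    (hεs : εs = 1 ∨ εs = -1) (hM : IsSignedFrame μ₁ μ₂ εd εs Λ N M w) (h : ReadsCoord m M z w)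
    (hw : |L3 w| < μ₁ - μ₂) (hkl : w ∈ wellTurned k l)
    (hz : z ∈ chartSource m Λ (εd * εs) k l) : chartMap m Λ k l z = w := by
  obtain ⟨e₁, e₂, he, ho, h1, h2, hf⟩ := hM.exists_principal hμ₂ hεd hεs h hw
  have h21 : inner ℝ e₂ e₁ = 0 := by rw [real_inner_comm]; exact he.one_two
  have hc : ∀ k : ℝ × ℝ, jacobiComb m k z =
      (k.1 * w.1 0 + k.2 * w.1 2) • e₁ + (k.1 * w.1 1 + k.2 * w.1 3) • e₂ := fun k => by
    rw [jacobiComb_apply, h1, h2]; module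
  have i1 : ∀ k, inner ℝ e₁ (jacobiComb m k z) = k.1 * w.1 0 + k.2 * w.1 2 := fun k => by
    rw [hc, inner_add_right, real_inner_smul_right, real_inner_smul_right, he.one_one, he.one_two]
    ring
  have i2 : ∀ k, inner ℝ e₂ (jacobiComb m k z) = k.1 * w.1 1 + k.2 * w.1 3 := fun k => by
    rw [hc, inner_add_right, real_inner_smul_right, real_inner_smul_right, h21, he.two_two]
    ring
  have hp : ∀ k, InPlane e₁ e₂ (jacobiComb m k z) := fun k =>
    inPlane_of_eq he.one_one he.two_two he.one_two _ _ (hc k)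
  obtain ⟨p1, p2⟩ := prin_unique hz he ho (hp k) (hp l) (by rw [i1]; exact hkl.1)
    (by rw [i1, i1, i2, i2]; exact hkl.2)
  rw [chartMap, p1, p2, hf]

/-- The values of the chart carry the prescribed signs, because `chartSource` orders the principal
values by the sign of `εd εs`. -/
lemma exists_signedFrame_chartMap (hm : ∀ i, 0 < m i) (hμ : μ₂ < μ₁) (hskew : Λᵀ = -Λ)
    (hN : Nᵀ * N = 1) (hNΛ : Nᵀ * Λ * N = normalForm μ₁ μ₂) (hεd : εd = 1 ∨ εd = -1)
    (hεs : εs = 1 ∨ εs = -1) (hkl : k.1 * l.2 - k.2 * l.1 ≠ 0)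
    (hz : z ∈ chartSource m Λ (εd * εs) k l ∩ level Λ) :
    chartMap m Λ k l z ∈ regular μ₁ μ₂ ∧
    ∃ M, IsSignedFrame μ₁ μ₂ εd εs Λ N M (chartMap m Λ k l z) ∧
      ReadsCoord m M z (chartMap m Λ k l z) := by
  obtain ⟨h1, h2⟩ := inPlane_of_mem_chartSource hkl hz.1
  obtain ⟨h3, h4⟩ := (isPrincipal_prin hz.1).exists_signedFrame hm hN hNΛ hμ hskew hεd hεs hz.2
    h1 h2 (prin_order hz.1)
  exact ⟨⟨area_ne_zero_of_wellTurned (chartMap_mem_wellTurned hz.1), h3⟩, h4⟩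

lemma sectionMap_spec (hm : ∀ i, 0 < m i) (hμ₂ : 0 ≤ μ₂) (hμ : μ₂ < μ₁) (hN : Nᵀ * N = 1)
    (hNΛ : Nᵀ * Λ * N = normalForm μ₁ μ₂) (hεd : εd = 1 ∨ εd = -1) (hεs : εs = 1 ∨ εs = -1)
    (hw : w ∈ regular μ₁ μ₂) : sectionMap m N μ₁ μ₂ εd εs w ∈ level Λ ∧
      IsSignedFrame μ₁ μ₂ εd εs Λ N (sectionFrame N μ₁ μ₂ εd εs w) w ∧
      ReadsCoord m (sectionFrame N μ₁ μ₂ εd εs w) (sectionMap m N μ₁ μ₂ εd εs w) w := by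
  have h := isSignedFrame_sectionFrame hμ₂ hμ hN hNΛ hεd hεs hw.2.le
  obtain ⟨h1, h2⟩ := stateOf_spec hm h hw.1
  exact ⟨h1, h, h2⟩

/-- The symplectic chart of the reduced phase space. -/
theorem isReducedChart (hm : ∀ i, 0 < m i) (hμ₂ : 0 ≤ μ₂) (hμ : μ₂ < μ₁) (hskew : Λᵀ = -Λ)
    (hN : Nᵀ * N = 1) (hNΛ : Nᵀ * Λ * N = normalForm μ₁ μ₂) (hεd : εd = 1 ∨ εd = -1)
    (hεs : εs = 1 ∨ εs = -1) (hkl : k.1 * l.2 - k.2 * l.1 ≠ 0) :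
    IsReducedChart Λ (chartSource m Λ (εd * εs) k l) (chartMap m Λ k l)
      (chartTarget m Λ N μ₁ μ₂ εd εs k l) (sectionMap m N μ₁ μ₂ εd εs) where
  isOpen_source := isOpen_chartSource
  isOpen_target := isOpen_chartTarget hμ₂
  invariant z hz z' h := (h.chart hm).1 hz
  smooth z hz := (contDiffAt_chartMap hz).contDiffWithinAt
  smooth_section w hw := (contDiffAt_sectionMap hμ₂ hw.1.1).contDiffWithinAt
  mapsTo z hz := by
    obtain ⟨hr, M, hM, h⟩ := exists_signedFrame_chartMap hm hμ hskew hN hNΛ hεd hεs hkl hz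
    obtain ⟨s1, s2, s3⟩ := sectionMap_spec hm hμ₂ hμ hN hNΛ hεd hεs hr
    -- The section over the coordinates of `z` lies in the orbit of `z`, and the source is
    -- invariant.
    exact ⟨⟨hr, ((hM.sameOrbit hm hN hz.2 s1 h s2 s3 hr.1).chart hm).1 hz.1⟩,
      chartMap_mem_wellTurned hz.1⟩
  section_mem w hw := ⟨hw.1.2, (sectionMap_spec hm hμ₂ hμ hN hNΛ hεd hεs hw.1.1).1⟩
  right_inv w hw := by
    obtain ⟨-, s2, s3⟩ := sectionMap_spec hm hμ₂ hμ hN hNΛ hεd hεs hw.1.1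
    exact s2.chartMap_eq hμ₂ hεd hεs s3 hw.1.1.2 hw.2 hw.1.2
  eq_iff z hz z' hz' := by
    constructor
    · intro e
      obtain ⟨hr, M, hM, h⟩ := exists_signedFrame_chartMap hm hμ hskew hN hNΛ hεd hεs hkl hz
      obtain ⟨-, M', hM', h'⟩ := exists_signedFrame_chartMap hm hμ hskew hN hNΛ hεd hεs hkl hz'
      rw [← e] at hM' h'
      exact hM.sameOrbit hm hN hz.2 hz'.2 h hM' h' hr.1
    · intro h
      exact ((h.chart (ε := εd * εs) hm).2).symm
  symplectic z hz u v hu hv := by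
    obtain ⟨x1, x2⟩ := inPlane_of_mem_chartSource hkl hz.1
    have hp := isPrincipal_prin hz.1
    have ho := prin_order hz.1
    obtain ⟨d1, d2⟩ := contDiffAt_chart_prin hz.1
    obtain ⟨M, c, a, b, hM, h1, h2⟩ := hp.exists_bodyFrame hm hN hskew hz.2 x1 x2
    obtain ⟨n1, n2, -⟩ := hM.norm_act h1 h2
    refine symplectic_of_frame hm hz.2 (d1.differentiableAt (by simp))
      (d2.differentiableAt (by simp)) ?_ hM h1 h2 ?_ hu hv
    · filter_upwards [isOpen_chartSource.mem_nhds hz.1] with z' hz'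
      exact ⟨isPrincipal_prin hz', inPlane_of_mem_chartSource hkl hz'⟩
    · intro hab
      rw [n1, n2, hab, sub_self, mul_zero] at ho
      exact lt_irrefl _ ho

/-- The reduced Hamiltonian in the symplectic chart. -/
theorem isReduction (hm : ∀ i, 0 < m i)
    (hW : ContDiffOn ℝ ∞ W (Set.Ioi 0 ×ˢ Set.Ioi 0 ×ˢ Set.Ioi 0)) (hμ₂ : 0 ≤ μ₂) (hμ : μ₂ < μ₁)
    (hskew : Λᵀ = -Λ) (hN : Nᵀ * N = 1) (hNΛ : Nᵀ * Λ * N = normalForm μ₁ μ₂)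
    (hεd : εd = 1 ∨ εd = -1) (hεs : εs = 1 ∨ εs = -1) (hkl : k.1 * l.2 - k.2 * l.1 ≠ 0) :
    IsReduction m W Λ N (reducedHamiltonian m W μ₁ μ₂ εd εs) (chartSource m Λ (εd * εs) k l)
      (chartMap m Λ k l) (chartTarget m Λ N μ₁ μ₂ εd εs k l) (sectionMap m N μ₁ μ₂ εd εs) := by
  have hc := isReducedChart hm hμ₂ hμ hskew hN hNΛ hεd hεs hkl
  have hE : ∀ z ∈ chartSource m Λ (εd * εs) k l ∩ level Λ,
      hamiltonian m W z = reducedHamiltonian m W μ₁ μ₂ εd εs (chartMap m Λ k l z) := by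
    intro z hz
    obtain ⟨hr, M, hM, h⟩ := exists_signedFrame_chartMap hm hμ hskew hN hNΛ hεd hεs hkl hz
    exact hM.energy hm W hz.2 h hr.1
  have hP : ∀ z ∈ chartSource m Λ (εd * εs) k l ∩ level Λ,
      DifferentiableAt ℝ (potential W) z.1 := by
    intro z hz
    obtain ⟨hr, M, hM, h⟩ := exists_signedFrame_chartMap hm hμ hskew hN hNΛ hεd hεs hkl hz
    obtain ⟨h1, h2, h3⟩ := h.separated hm hr.1
    exact differentiableAt_potential hW h1 h2 h3
  refine { hc with hasCoord := ?_, energy := hE, differentiable := ?_, motion := ?_ }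
  · intro z hz
    obtain ⟨-, M, hM, h⟩ := exists_signedFrame_chartMap hm hμ hskew hN hNΛ hεd hεs hkl hz
    exact IsBodyFrame.hasCoord hμ₂ hμ hN hNΛ hM h
  -- Near `w` the reduced Hamiltonian is the energy along the smooth section.
  · intro w hw
    obtain ⟨L, hL, -⟩ := hasFDerivAt_hamiltonian (m := m) (hP _ (hc.section_mem w hw))
    have hs := (contDiffAt_sectionMap (m := m) (N := N) (εd := εd) (εs := εs) hμ₂
      hw.1.1).differentiableAt (by simp)
    refine (hL.comp w hs.hasFDerivAt).differentiableAt.congr_of_eventuallyEq ?_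
    filter_upwards [hc.isOpen_target.mem_nhds hw] with w' hw'
    rw [Function.comp_apply, hE _ (hc.section_mem w' hw'), hc.right_inv w' hw']
  · exact fun γ a b hγ t ht => hc.motion hm hE hP γ a b hγ t ht

/-- Around every regular point of the coordinate space there is a chart, which contains all states
with these coordinates. -/
theorem exists_chart (hm : ∀ i, 0 < m i)
    (hW : ContDiffOn ℝ ∞ W (Set.Ioi 0 ×ˢ Set.Ioi 0 ×ˢ Set.Ioi 0)) (hμ₂ : 0 ≤ μ₂) (hμ : μ₂ < μ₁)
    (hskew : Λᵀ = -Λ) (hN : Nᵀ * N = 1) (hNΛ : Nᵀ * Λ * N = normalForm μ₁ μ₂)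
    (hεd : εd = 1 ∨ εd = -1) (hεs : εs = 1 ∨ εs = -1) (hw : w ∈ regular μ₁ μ₂) :
    ∃ O χ V s, IsReduction m W Λ N (reducedHamiltonian m W μ₁ μ₂ εd εs) O χ V s ∧ w ∈ V ∧
      V ⊆ regular μ₁ μ₂ ∧ ∀ z M, IsSignedFrame μ₁ μ₂ εd εs Λ N M w → ReadsCoord m M z w →
        z ∈ O := by
  have hA : 2 * area w ≠ 0 := mul_ne_zero two_ne_zero hw.1
  have hD : w.1 0 * w.1 3 - w.1 1 * w.1 2 = 2 * area w := by rw [area]; ring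
  -- `k` and `l` are the rows of the inverse of the coefficient matrix at `w`, so at a state with
  -- coordinates `w` the two combinations of Jacobi vectors are the frame vectors `e₁`, `e₂`.
  set k : ℝ × ℝ := (w.1 3 / (2 * area w), -w.1 1 / (2 * area w)) with hk
  set l : ℝ × ℝ := (-w.1 2 / (2 * area w), w.1 0 / (2 * area w)) with hl
  have k1 : k.1 * w.1 0 + k.2 * w.1 2 = 1 := by
    rw [hk, div_mul_eq_mul_div, div_mul_eq_mul_div, ← add_div, div_eq_one_iff_eq hA]
    linear_combination hD
  have k2 : k.1 * w.1 1 + k.2 * w.1 3 = 0 := by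
    rw [hk]; field_simp; ring
  have l1 : l.1 * w.1 0 + l.2 * w.1 2 = 0 := by
    rw [hl]; field_simp; ring
  have l2 : l.1 * w.1 1 + l.2 * w.1 3 = 1 := by
    rw [hl, div_mul_eq_mul_div, div_mul_eq_mul_div, ← add_div, div_eq_one_iff_eq hA]
    linear_combination hD
  have hkl : k.1 * l.2 - k.2 * l.1 ≠ 0 := by
    have : (k.1 * l.2 - k.2 * l.1) * (2 * area w) = 1 := by
      rw [← hD]
      linear_combination (l.1 * w.1 1 + l.2 * w.1 3) * k1 - (k.1 * w.1 1 + k.2 * w.1 3) * l1 + l2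
    exact left_ne_zero_of_mul (this.trans_ne one_ne_zero)
  -- For orthonormal `e₁`, `e₂` the gap is `‖Λ e₂‖² - ‖Λ e₁‖²`, whose sign in a signed frame is that
  -- of `εd εs`.
  have hO : ∀ z M, IsSignedFrame μ₁ μ₂ εd εs Λ N M w → ReadsCoord m M z w →
      z ∈ chartSource m Λ (εd * εs) k l := by
    intro z M hM h
    obtain ⟨e₁, e₂, he, ho, h1, h2, -⟩ := hM.exists_principal hμ₂ hεd hεs h hw.2
    have hc : ∀ k : ℝ × ℝ, jacobiComb m k z =
        (k.1 * w.1 0 + k.2 * w.1 2) • e₁ + (k.1 * w.1 1 + k.2 * w.1 3) • e₂ := fun k => by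
      rw [jacobiComb_apply, h1, h2]; module
    have n1 : ‖e₁‖ ^ 2 = 1 := by rw [← real_inner_self_eq_norm_sq]; exact he.one_one
    have n2 : ‖e₂‖ ^ 2 = 1 := by rw [← real_inner_self_eq_norm_sq]; exact he.two_two
    have hor : orthPart e₁ e₂ = e₂ := by
      rw [orthPart, n1, he.one_two, one_smul, zero_smul, sub_zero]
    rw [chartSource, Set.mem_ofPred_eq, hc, hc, k1, k2, l1, l2, one_smul, one_smul, zero_smul,
      zero_smul, add_zero, zero_add, gap, hor, n1, n2, one_mul, one_mul]
    exact ho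
  obtain ⟨-, s2, s3⟩ := sectionMap_spec (m := m) hm hμ₂ hμ hN hNΛ hεd hεs hw
  exact ⟨_, _, _, _, isReduction hm hW hμ₂ hμ hskew hN hNΛ hεd hεs hkl,
    ⟨⟨hw, hO _ _ s2 s3⟩, by rw [wellTurned, Set.mem_ofPred_eq, k1, k2, l1, l2]; norm_num⟩,
    fun w' hw' => hw'.1.1, hO⟩

end ThreeBody
end

/-! ### Reduction theorem. -/

open ThreeBody Polynomial in
theorem theorem2 (m : Fin 3 → ℝ) (hm : ∀ i, 0 < m i)
    (W : ℝ × ℝ × ℝ → ℝ)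
    (hW : ContDiffOn ℝ ∞ W (Set.Ioi 0 ×ˢ Set.Ioi 0 ×ˢ Set.Ioi 0))
    (μ₁ μ₂ : ℝ) (hμ₂ : 0 ≤ μ₂) (hμ : μ₂ < μ₁)
    (Λ : Matrix (Fin 4) (Fin 4) ℝ) (hskew : Λᵀ = -Λ)
    (hΛ : Λ.charpoly = (X ^ 2 + C (μ₁ ^ 2)) * (X ^ 2 + C (μ₂ ^ 2))) :
    ∃ N ∈ Matrix.orthogonalGroup (Fin 4) ℝ, Nᵀ * Λ * N = normalForm μ₁ μ₂ ∧
      ∀ εd εs : ℝ, (εd = 1 ∨ εd = -1) → (εs = 1 ∨ εs = -1) →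
        (∀ z ∈ level Λ, LinearIndependent ℝ ![jacobiX1 z, jacobiX2 m z] →
          ∃ w, HasCoord m N z w ∧ area w ≠ 0 ∧ |L3 w| ≤ μ₁ - μ₂ ∧
            hamiltonian m W z = reducedHamiltonian m W μ₁ μ₂ εd εs w) ∧
        (∀ z ∈ level Λ, ∀ w, HasCoord m N z w → area w ≠ 0 → |L3 w| < μ₁ - μ₂ →
          ∃ O χ V s, IsReduction m W Λ N (reducedHamiltonian m W μ₁ μ₂ εd εs) O χ V s ∧
            z ∈ O ∧ ∀ w' ∈ V, area w' ≠ 0 ∧ |L3 w'| < μ₁ - μ₂) ∧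
        (∀ w, area w ≠ 0 → |L3 w| < μ₁ - μ₂ →
          ∃ O χ V s, IsReduction m W Λ N (reducedHamiltonian m W μ₁ μ₂ εd εs) O χ V s ∧
            w ∈ V ∧ ∀ w' ∈ V, area w' ≠ 0 ∧ |L3 w'| < μ₁ - μ₂) := by
  obtain ⟨N, hN, hNΛ⟩ := exists_normalForm hskew (by linarith : μ₁ ≠ 0) hΛ
  refine ⟨N, (Matrix.mem_orthogonalGroup_iff' (Fin 4) ℝ).mpr hN, hNΛ, fun εd εs hεd hεs => ⟨?_, ?_, ?_⟩⟩
  · exact fun z hz h => exists_coord hm W hμ₂ hμ hskew hN hNΛ hεd hεs hz h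
  · intro z hz w hw hA hL
    obtain ⟨M, c, a, b, hM, h⟩ := hw.exists_bodyFrame hm hN hNΛ hz
    -- The given coordinates may belong to other signs. The state is read again in a frame with the
    -- prescribed signs; area and `L₃` stay the same, so the new coordinates are regular too.
    obtain ⟨M', w', hM', h', e1, e2⟩ := hM.exists_signed hm hN hNΛ hεd hεs hz h
    have hc := (hM.level_eqs hm hz h).1
    have hw' : w' ∈ regular μ₁ μ₂ := ⟨by rwa [e2], by rwa [e1, hc]⟩
    obtain ⟨O, χ, V, s, hR, -, hV, hO⟩ := exists_chart hm hW hμ₂ hμ hskew hN hNΛ hεd hεs hw'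
    exact ⟨O, χ, V, s, hR, hO z M' hM' h', hV⟩
  · intro w hA hL
    obtain ⟨O, χ, V, s, hR, hw, hV, -⟩ := exists_chart hm hW hμ₂ hμ hskew hN hNΛ hεd hεs ⟨hA, hL⟩
    exact ⟨O, χ, V, s, hR, hw, hV⟩
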